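/- **Setting.** Let $K$ be a $p$-field, i.e. a nonarchimedean local field, with valuation ring $R$ and residue field of cardinality $q$. Let $\mu$ be the additive Haar measure with $\mu(R)=1$, let $|x|=\mu(xR)/\mu(R)$ be the canonical absolute value, and put $\|x\|=\max_{1\le i\le N}|x_i|$ for $x\in K^N$, where $N\ge 2$; write $|dx|$ for integration against $\mu^N$. Let $\mathcal N=\{0\}\cup\bigcup_{n\ge1}\{n,\tfrac1n\}$ and let $\rho:\mathcal N\to\mathbb R_{\ge0}$ satisfy $$\limsup_{n\to\infty}\frac{\log\rho(1/n)}{\log n}\le 1,\qquad \limsup_{n\to\infty}\frac{\log\rho(n)}{\log n}=-\infty\qquad(\log 0:=-\infty),$$ and suppose that $x\mapsto\rho(\|x\|)$ is not identically zero on $K^N\setminus\{0\}$, i.e. $\rho(q^m)\ne0$ for some $m\in\mathbb Z$. Let $q_1,\dots,q_N>0$, $\boldsymbol c=(q_iq_j)_{i<j}$ and $\beta>0$. **Combinatorial data.** A splitting filtration of order $N$ is a tuple $S=(\pi_0,\dots,\pi_L)$, $L=L(S)$, of partitions of $[N]=\{1,\dots,N\}$, each $\pi_{\ell+1}$ a proper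 refinement of $\pi_\ell$, with $\pi_0=\{[N]\}$ and $\pi_L$ the partition into singletons. $\mathcal S_N$ is the (finite) set of these. The set $\mathcal B(S)$ of branches consists of the parts with more than one element of $\pi_0,\dots,\pi_{L-1}$. $S$ is reduced if each branch is a part of exactly one of $\pi_0,\dots,\pi_{L-1}$; $\mathcal R_N$ is the set of reduced $S$. For $\lambda\in\mathcal B(S)$ let $\ell_S(\lambda)=\max\{\ell<L:\lambda\in\pi_\ell\}$ and $\deg_S(\lambda)=\#\{\lambda'\in\pi_{\ell_S(\lambda)+1}:\lambda'\subset\lambda\}$, and let $M_{S,q}=\prod_{\lambda\in\mathcal B(S)}(q-1)_{\deg_S(\lambda)-1}$, where $(n)_k$ is the falling factorial. For $\boldsymbol s=(s_{ij})_{i<j}$ complex and $b\in\mathbb C$ let $$e_\lambda(\boldsymbol s)=\#\lambda-1+\sum_{i<j,\ i,j\in\lambda}s_{ij},\qquad E_{S,\ell}(\boldsymbol s)=\sum_{\lambda\in\mathcal B(S)\cap\pi_\ell}e_\lambda(\boldsymbol s),$$ $$I_{S,q}(\boldsymbol s)=\frac{M_{S,q}}{q^{N-1}}\prod_{\lambda\in\mathcal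 B(S)\setminus\{[N]\}}\frac1{q^{e_\lambda(\boldsymbol s)}-1},\qquad J_{S,q}(b,\boldsymbol s)=\frac{M_{S,q}}{q^{N-1}}\prod_{\ell=1}^{L(S)-1}\frac1{q^{b+E_{S,\ell}(\boldsymbol s)}-1},$$ $$H_q^\rho(z)=\frac{1-q^{-z}}{1-q^{-(z-1)}}\sum_{m\in\mathbb Z}\rho(q^m)q^{mz}.$$ **Claim.** The partition function $\mathcal Z_N(\beta)=\int_{K^N}\rho(\|x\|)\prod_{i<j}|x_i-x_j|^{q_iq_j\beta}\,|dx|$ lies in $(0,\infty)$, so that $\mathcal Z_N(\beta)^{-1}\rho(\|x\|)\prod_{i<j}|x_i-x_j|^{q_iq_j\beta}\,|dx|$ is a probability measure on $K^N$; let $\mathbb E$ denote expectation with respect to it. All expectations below exist (the random variables are integrable), all series $H_q^\rho$ below converge absolutely at the points indicated, and $H_q^\rho(N+\sum_{i<j}q_iq_j\beta)$ and the sums of $J_{S,q}(0,\beta\boldsymbol c)$ and of $I_{S,q}(\beta\boldsymbol c)$ in the denominators below are nonzero. (a) If $a,b\in\mathbb C$ with $\operatorname{Re}(b)\ge-1$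 and $\operatorname{Re}(a+b)\ge1-N$, then $$\mathbb E\Big[\big(\max_{i<j}|x_i-x_j|\big)^a\big(\min_{i<j}|x_i-x_j|\big)^b\Big]=\frac{H_q^\rho\big(N+a+b+\sum_{i<j}q_iq_j\beta\big)\sum_{S\in\mathcal S_N,\,M_{S,q}>0}J_{S,q}(b,\beta\boldsymbol c)}{H_q^\rho\big(N+\sum_{i<j}q_iq_j\beta\big)\sum_{S\in\mathcal S_N,\,M_{S,q}>0}J_{S,q}(0,\beta\boldsymbol c)}$$ $$=\frac{H_q^\rho\big(N+a+b+\sum_{i<j}q_iq_j\beta\big)\sum_{S\in\mathcal S_N,\,M_{S,q}>0}J_{S,q}(b,\beta\boldsymbol c)}{H_q^\rho\big(N+\sum_{i<j}q_iq_j\beta\big)\sum_{S\in\mathcal R_N,\,M_{S,q}>0}I_{S,q}(\beta\boldsymbol c)}.$$ (b) In particular ($b=0$), if $a\in\mathbb C$ with $\operatorname{Re}(a)\ge1-N$, then $$\mathbb E\Big[\big(\max_{i<j}|x_i-x_j|\big)^a\Big]=\frac{H_q^\rho\big(N+a+\sum_{i<j}q_iq_j\beta\big)}{H_q^\rho\big(N+\sum_{i<j}q_iq_j\beta\big)}.$$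 -/

import Mathlib

open Finset MeasureTheory ValuativeRel
open scoped NNReal ENNReal

noncomputable section

namespace CoulombGas

/-! ### Haar measure and canonical absolute value of a nonarchimedean local field -/

section LocalField

variable (K : Type*) [Field K] [ValuativeRel K] [TopologicalSpace K] [IsNonarchimedeanLocalField K]

/-- The valuation ring of `K`, as a compact set with nonempty interior. -/
def integersCompacts : TopologicalSpace.PositiveCompacts K where
  carrier := (𝒪[K] : Set K)
  isCompact' := IsNonarchimedeanLocalField.isCompact_closedBall K 1
  interior_nonempty' := by
    refine ⟨0, mem_interior_iff_mem_nhds.mpr ?_⟩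
    rw [IsValuativeTopology.mem_nhds_zero_iff]
    exact ⟨1, fun x hx => le_of_lt (by simpa using hx)⟩

variable [MeasurableSpace K] [BorelSpace K]

/-- The additive Haar measure on `K` that gives the valuation ring measure one. -/
def haar : Measure K := Measure.addHaarMeasure (integersCompacts K)

variable {K}

/-- The canonical absolute value `|x| = μ(xM) / μ(M)`, with `M` the valuation ring. -/
def canonicalAbs (x : K) : ℝ≥0 :=
  (haar K ((fun y => x * y) '' (𝒪[K] : Set K)) / haar K (𝒪[K] : Set K)).toNNReal

/-- The standard norm `max_i |x_i|` on `K^N`. -/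
def standardNorm {N : ℕ} (x : Fin N → K) : ℝ≥0 := univ.sup fun i => canonicalAbs (x i)

end LocalField

/-- The index set of pairs `i < j`. -/
abbrev Pairs (N : ℕ) : Type := {p : Fin N × Fin N // p.1 < p.2}

/-! ### The log-Coulomb gas -/

section Gas

variable {K : Type*} [Field K] [ValuativeRel K] [TopologicalSpace K] [IsNonarchimedeanLocalField K]
  [MeasurableSpace K] [BorelSpace K] {N : ℕ}

/-- The diameter `max_{i<j} |x_i - x_j|`. -/
def maxDist (x : Fin N → K) : ℝ≥0 := ⨆ p : Pairs N, canonicalAbs (x p.1.1 - x p.1.2)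

/-- The minimum distance `min_{i<j} |x_i - x_j|`. -/
def minDist (x : Fin N → K) : ℝ≥0 := ⨅ p : Pairs N, canonicalAbs (x p.1.1 - x p.1.2)

/-- `ρ(‖x‖) ∏_{i<j} |x_i - x_j|^(c_i c_j β)`. -/
def gasWeight (ρ : ℝ≥0 → ℝ≥0) (c : Fin N → ℝ) (β : ℝ) (x : Fin N → K) : ℝ≥0 :=
  ρ (standardNorm x) * ∏ p : Pairs N, canonicalAbs (x p.1.1 - x p.1.2) ^ (c p.1.1 * c p.1.2 * β)

variable (K)

/-- The Haar measure on `K^N`. -/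
def haarPi (N : ℕ) : Measure (Fin N → K) := Measure.pi fun _ => haar K

/-- The canonical partition function. -/
def partitionFunction (ρ : ℝ≥0 → ℝ≥0) (c : Fin N → ℝ) (β : ℝ) : ℝ≥0∞ :=
  ∫⁻ x, (gasWeight ρ c β x : ℝ≥0∞) ∂(haarPi K N)

/-- The law of the microstates of the log-Coulomb gas with charges `c`, background density
`x ↦ ρ(‖x‖)` and inverse temperature `β`. -/
def gasLaw (ρ : ℝ≥0 → ℝ≥0) (c : Fin N → ℝ) (β : ℝ) : Measure (Fin N → K) :=
  (haarPi K N).withDensity fun x => (partitionFunction K ρ c β)⁻¹ * (gasWeight ρ c β x : ℝ≥0∞)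

end Gas

/-! ### Growth condition and root function

A norm-density is only ever evaluated at `0`, at positive integers and at their reciprocals; it is
given here as a total function on the nonnegative reals, whose other values are irrelevant. -/

/-- `limsup log|ρ(1/n)| / log n ≤ 1` and `limsup log|ρ(n)| / log n = -∞`, with `log 0 = -∞`. -/
def GrowthCondition (ρ : ℝ≥0 → ℝ≥0) : Prop :=
  Filter.limsup (fun n : ℕ => ENNReal.log (ρ (1 / (n : ℝ≥0)) : ℝ≥0∞) / ((Real.log n : ℝ) : EReal))
      Filter.atTop ≤ 1 ∧
    Filter.limsup (fun n : ℕ => ENNReal.log (ρ (n : ℝ≥0) : ℝ≥0∞) / ((Real.log n : ℝ) : EReal))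
      Filter.atTop = ⊥

/-- The term `ρ(q^m) q^(mz)` of the series in the root function. -/
def rootTerm (q : ℕ) (ρ : ℝ≥0 → ℝ≥0) (z : ℂ) (m : ℤ) : ℂ :=
  ((ρ ((q : ℝ≥0) ^ m) : ℝ) : ℂ) * (q : ℂ) ^ ((m : ℂ) * z)

/-- The root function `H_q^ρ(z)`. -/
def rootFunction (q : ℕ) (ρ : ℝ≥0 → ℝ≥0) (z : ℂ) : ℂ :=
  (1 - (q : ℂ) ^ (-z)) / (1 - (q : ℂ) ^ (-(z - 1))) * ∑' m : ℤ, rootTerm q ρ z m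

/-! ### Splitting filtrations -/

/-- A splitting filtration of order `N`: a strictly refining tuple of partitions of `Fin N` that
starts with the one-part partition and ends with the partition into singletons. -/
structure SplittingFiltration (N : ℕ) where
  length : ℕ
  level : Fin (length + 1) → Finpartition (univ : Finset (Fin N))
  strictAnti : StrictAnti level
  level_zero : (level 0).parts = {univ}
  level_last : level (Fin.last length) = ⊥

namespace SplittingFiltration

variable {N : ℕ}

theorem toList_injective : Function.Injective fun S : SplittingFiltration N =>
    (⟨List.ofFn S.level, List.nodup_ofFn.mpr S.strictAnti.injective⟩ :
      {l : List (Finpartition (univ : Finset (Fin N))) // l.Nodup}) := by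
  rintro ⟨L, f, h1, h2, h3⟩ ⟨L', f', h1', h2', h3'⟩ h
  have h' : List.ofFn f = List.ofFn f' := congrArg Subtype.val h
  have hL : L = L' := by simpa using congrArg List.length h'
  subst hL
  have hf : f = f' := List.ofFn_injective h'
  subst hf
  rfl

instance : Finite (SplittingFiltration N) := Finite.of_injective _ toList_injective

instance : Fintype (SplittingFiltration N) := Fintype.ofFinite _

variable (S : SplittingFiltration N)

/-- The `ℓ`-th partition of the tuple, for `ℓ ≤ S.length`. -/
def partition (ℓ : ℕ) : Finpartition (univ : Finset (Fin N)) :=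
  if h : ℓ < S.length + 1 then S.level ⟨ℓ, h⟩ else ⊥

/-- The branches: the parts with at least two elements of the levels `0, …, S.length - 1`. -/
def branches : Finset (Finset (Fin N)) :=
  univ.filter fun lam => (∃ ℓ ∈ range S.length, lam ∈ (S.partition ℓ).parts) ∧ 1 < #lam

/-- Every branch is a part of exactly one level. -/
def IsReduced : Prop :=
  ∀ lam ∈ S.branches, ∃! ℓ : ℕ, ℓ < S.length ∧ lam ∈ (S.partition ℓ).parts

/-- The largest level index at which `lam` is a part. -/
def depth (lam : Finset (Fin N)) : ℕ :=
  Nat.findGreatest (fun ℓ => lam ∈ (S.partition ℓ).parts) (S.length - 1)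

/-- The number of parts into which the branch `lam` splits. -/
def degree (lam : Finset (Fin N)) : ℕ :=
  #{lam' ∈ (S.partition (S.depth lam + 1)).parts | lam' ⊆ lam}

/-- The multiplicity, a product of falling factorials `(q - 1)_(degree - 1)`. -/
def multiplicity (q : ℕ) : ℕ :=
  ∏ lam ∈ S.branches, (q - 1).descFactorial (S.degree lam - 1)

end SplittingFiltration

/-- The branch exponent `e_lam(s) = (#lam - 1) + ∑_{i<j in lam} s_ij`. -/
def branchExponent {N : ℕ} (s : Pairs N → ℂ) (lam : Finset (Fin N)) : ℂ :=
  ((#lam : ℂ) - 1) + ∑ p : Pairs N with p.1.1 ∈ lam ∧ p.1.2 ∈ lam, s p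

namespace SplittingFiltration

variable {N : ℕ} (S : SplittingFiltration N)

/-- The level exponent `E_ℓ(s)`. -/
def levelExponent (s : Pairs N → ℂ) (ℓ : ℕ) : ℂ :=
  ∑ lam ∈ S.branches ∩ (S.partition ℓ).parts, branchExponent s lam

/-- The branch function `I_{S,q}(s)`. -/
def branchFunction (q : ℕ) (s : Pairs N → ℂ) : ℂ :=
  (S.multiplicity q : ℂ) / (q : ℂ) ^ (N - 1) *
    ∏ lam ∈ S.branches.erase univ, 1 / ((q : ℂ) ^ branchExponent s lam - 1)

/-- The level function `J_{S,q}(b, s)`. -/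
def levelFunction (q : ℕ) (b : ℂ) (s : Pairs N → ℂ) : ℂ :=
  (S.multiplicity q : ℂ) / (q : ℂ) ^ (N - 1) *
    ∏ ℓ ∈ Ico 1 S.length, 1 / ((q : ℂ) ^ (b + S.levelExponent s ℓ) - 1)

end SplittingFiltration

/-- The sum of the level functions over all splitting filtrations of positive multiplicity. -/
def levelSum {N : ℕ} (q : ℕ) (b : ℂ) (s : Pairs N → ℂ) : ℂ :=
  ∑ S : SplittingFiltration N with 0 < S.multiplicity q, S.levelFunction q b s

open scoped Classical in
/-- The sum of the branch functions over all reduced splitting filtrations of positive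
multiplicity. -/
def branchSum {N : ℕ} (q : ℕ) (s : Pairs N → ℂ) : ℂ :=
  ∑ S : SplittingFiltration N with S.IsReduced ∧ 0 < S.multiplicity q, S.branchFunction q s

/-- The tuple `(c_i c_j β)_{i<j}`. -/
def chargeTuple {N : ℕ} (c : Fin N → ℝ) (β : ℝ) (p : Pairs N) : ℂ :=
  ((c p.1.1 * c p.1.2 * β : ℝ) : ℂ)

end CoulombGas

end

open CoulombGas

set_option linter.unusedSectionVars false

namespace CoulombGas

open scoped Pointwise

/-! ### Uniformizer and residue classes -/

section LocalField

variable (K : Type*) [Field K] [ValuativeRel K] [TopologicalSpace K] [IsNonarchimedeanLocalField K]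

/-! The valuation ring is self-similar: it is the disjoint union of q translates of its image under
a uniformizer. Two integers in different residue classes are at distance 1; in the same class, their
distance is q⁻¹ times the distance of their rescaled versions. Attach to a partition P of the
indices the weight max^a min^b ∏ d^s taken over the pairs inside the parts of P (`partWeight`), and
integrate it over the unit ball by averaging over the residue classes c of all coordinates
(`integral_zoom`). The pairs that stay close are those of the refinement of P by the fibres of c, so
the integral for P becomes a sum over refinements Q (`partWeight_zoom`, `sum_refineBy`), and the
number of c that produce Q is q^#P times a product of falling factorials (`card_refineBy_eq`).

The term Q = P returns the same integral times q^(-(a+b+E_P)) and is moved to the left side. In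
every term with Q < P some distance equals 1, so the maximum is 1 and a disappears. The result is a
triangular recursion along refinement (`partIntegral_mul`). Unwinding it from the one-part partition
down to the singletons gives a sum over strict chains, that is, over splitting filtrations, with a
factor 1/(q^(b+E_Q)-1) at each intermediate level: the sum of the J (`levelSum_eq_splitSum`).

The sum of the I is a second evaluation of the integral with a = b = 0. Requiring a part to have
diameter 1 multiplies the integral by 1 - q^(-e), e being its branch exponent, because the
configurations of smaller diameter on that part are contracted copies of all configurations
(`diamIntegral_insert`). Once every nonsingleton part has diameter 1, averaging over residues
retains only the refinements that split all of them, and chains of such refinements are the reduced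
filtrations (`SplittingFiltration.isReduced_iff`). Comparing both evaluations at the top gives
`branchSum_eq_levelSum`.

Finally K^N without the origin is a disjoint union of spheres, on which the density is constant and
the weight is homogeneous. A sphere is a ball minus the next smaller ball, which produces the factor
1 - q^(-z) of the root function; its denominator 1 - q^(-(z-1)) comes from the term moved to the
left (`integral_density`). The growth condition makes the series converge for Re z > 1. An
expectation is the quotient of two such integrals, and the lower one is nonzero because collisions
form a null set (`partIntegral_zero_zero_ne_zero`). -/

open WithZero in
theorem exists_uniformizer : ∃ ϖ : K, IsNonarchimedeanLocalField.valueGroupWithZeroIsoInt K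
    (valuation K ϖ) = exp (-1 : ℤ) := by
  obtain ⟨x, hx⟩ := valuation_surjective
    ((IsNonarchimedeanLocalField.valueGroupWithZeroIsoInt K).symm (exp (-1 : ℤ)))
  exact ⟨x, by rw [hx]; simp⟩

/-- A generator of the maximal ideal of the valuation ring. -/
noncomputable def uniformizer : K := (exists_uniformizer K).choose

open WithZero in
theorem iso_valuation_uniformizer : IsNonarchimedeanLocalField.valueGroupWithZeroIsoInt K
    (valuation K (uniformizer K)) = exp (-1 : ℤ) := (exists_uniformizer K).choose_spec

theorem uniformizer_ne_zero : uniformizer K ≠ 0 := by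
  intro h
  have := iso_valuation_uniformizer K
  rw [h, map_zero, map_zero] at this
  exact WithZero.exp_ne_zero this.symm

variable {K}

/-- The value group is ℤ, so nothing lies strictly between the value of a uniformizer and 1. -/
theorem valuation_lt_one_iff_le_uniformizer {x : K} :
    valuation K x < 1 ↔ valuation K x ≤ valuation K (uniformizer K) := by
  let e := IsNonarchimedeanLocalField.valueGroupWithZeroIsoInt K
  have he : StrictMono e := e.strictMono
  rw [← he.lt_iff_lt, ← he.le_iff_le]
  change _ ↔ _ ≤ e _
  rw [iso_valuation_uniformizer, map_one]
  by_cases h : e (valuation K x) = 0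
  · simp [h]
  · rw [← WithZero.exp_log h, ← WithZero.exp_zero, WithZero.exp_lt_exp, WithZero.exp_le_exp]
    omega

theorem exists_valuation_eq_zpow {x : K} (hx : x ≠ 0) :
    ∃ n : ℤ, valuation K x = valuation K (uniformizer K ^ n) := by
  let e := IsNonarchimedeanLocalField.valueGroupWithZeroIsoInt K
  have h : e (valuation K x) ≠ 0 := by simpa using hx
  refine ⟨-WithZero.log (e (valuation K x)), e.injective ?_⟩
  rw [map_zpow₀, map_zpow₀]
  change _ = (e _) ^ _
  rw [iso_valuation_uniformizer, ← WithZero.exp_zsmul]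
  simp [WithZero.exp_log h]

/-- A set of representatives of the residue classes. -/
noncomputable def residueLift (c : 𝓀[K]) : K :=
  (Function.surjInv (IsLocalRing.residue_surjective (R := 𝒪[K])) c : 𝒪[K])

theorem valuation_residueLift_le (c : 𝓀[K]) : valuation K (residueLift c) ≤ 1 :=
  (Function.surjInv (IsLocalRing.residue_surjective (R := 𝒪[K])) c).2

theorem residue_eq_iff {c : 𝓀[K]} (x : 𝒪[K]) :
    IsLocalRing.residue 𝒪[K] x = c ↔ valuation K ((x : K) - residueLift c) < 1 := by
  set y := Function.surjInv (IsLocalRing.residue_surjective (R := 𝒪[K])) c with hy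
  have h : IsLocalRing.residue 𝒪[K] y = c := Function.surjInv_eq _ c
  change _ ↔ valuation K ((x - y : 𝒪[K]) : K) < 1
  rw [← h, ← sub_eq_zero, ← map_sub, IsLocalRing.residue_eq_zero_iff, IsLocalRing.mem_maximalIdeal,
    mem_nonunits_iff, Valuation.Integer.not_isUnit_iff_valuation_lt_one]

theorem valuation_residueLift_sub {c c' : 𝓀[K]} (h : c ≠ c') :
    valuation K (residueLift c - residueLift c') = 1 := by
  refine le_antisymm ((Valuation.map_sub_le _ (valuation_residueLift_le c)
    (valuation_residueLift_le c'))) (not_lt.mp fun hlt => h ?_)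
  have h1 := (residue_eq_iff (c := c')
    (Function.surjInv (IsLocalRing.residue_surjective (R := 𝒪[K])) c)).mpr hlt
  exact (Function.surjInv_eq IsLocalRing.residue_surjective c).symm.trans h1

/-- The representatives differ by a unit, and the remaining terms lie in the maximal ideal, so the
ultrametric inequality leaves the unit's value. -/
theorem valuation_sub_zoom {c c' : 𝓀[K]} (h : c ≠ c') {x y : K} (hx : valuation K x ≤ 1)
    (hy : valuation K y ≤ 1) :
    valuation K ((residueLift c + uniformizer K * x) - (residueLift c' + uniformizer K * y)) = 1 := by
  have h1 := valuation_residueLift_sub h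
  have h2 : valuation K (uniformizer K * (x - y)) < 1 := by
    rw [map_mul]
    exact mul_lt_one_of_lt_of_le (valuation_lt_one_iff_le_uniformizer.mpr le_rfl)
      (Valuation.map_sub_le _ hx hy)
  have : (residueLift c + uniformizer K * x) - (residueLift c' + uniformizer K * y) =
      (residueLift c - residueLift c') + uniformizer K * (x - y) := by ring
  rw [this, Valuation.map_add_eq_of_lt_left _ (by rwa [h1]), h1]

theorem mem_integers_iff {x : K} : x ∈ (𝒪[K] : Set K) ↔ valuation K x ≤ 1 := Iff.rfl

/-- The valuation ring is the disjoint union of the residue classes. -/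
theorem mem_image_zoom_iff {c : 𝓀[K]} {x : K} :
    x ∈ (fun y => residueLift c + uniformizer K * y) '' (𝒪[K] : Set K) ↔
      ∃ h : valuation K x ≤ 1, IsLocalRing.residue 𝒪[K] ⟨x, h⟩ = c := by
  constructor
  · rintro ⟨y, hy, rfl⟩
    have h2 : valuation K (uniformizer K * y) < 1 := by
      rw [map_mul]
      exact mul_lt_one_of_lt_of_le (valuation_lt_one_iff_le_uniformizer.mpr le_rfl) hy
    refine ⟨Valuation.map_add_le _ (valuation_residueLift_le c) h2.le, ?_⟩
    rw [residue_eq_iff]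
    simpa using h2
  · rintro ⟨h, hc⟩
    rw [residue_eq_iff, valuation_lt_one_iff_le_uniformizer] at hc
    have h0 := uniformizer_ne_zero K
    refine ⟨(x - residueLift c) / uniformizer K, ?_, by field_simp; ring⟩
    rw [mem_integers_iff, map_div₀]
    exact div_le_one_of_le₀ hc zero_le

theorem isOpen_integers : IsOpen (𝒪[K] : Set K) := by
  let := IsTopologicalAddGroup.rightUniformSpace K
  have := isUniformAddGroup_of_addCommGroup (G := K)
  exact Valued.isOpen_integer K

/-- The countable value group gives a countable basis at 0, and the balls of radius a power of the
uniformizer give σ-compactness, hence separability. This is needed for σ-finiteness of Haar measure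
and for measurability of differences of coordinates. -/
theorem secondCountableTopology : SecondCountableTopology K := by
  let := IsTopologicalAddGroup.rightUniformSpace K
  have := isUniformAddGroup_of_addCommGroup (G := K)
  have hc : Countable (ValueGroupWithZero K) :=
    (IsNonarchimedeanLocalField.valueGroupWithZeroIsoInt K).toEquiv.countable_iff.mpr
      (inferInstanceAs (Countable (Option (Multiplicative ℤ))))
  have h1 : (nhds (0 : K)).IsCountablyGenerated :=
    Filter.HasCountableBasis.isCountablyGenerated
      ⟨IsValuativeTopology.hasBasis_nhds_zero' K, Set.to_countable _⟩
  have h2 : (uniformity K).IsCountablyGenerated := by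
    rw [uniformity_eq_comap_nhds_zero]
    infer_instance
  have h3 : SigmaCompactSpace K := by
    refine ⟨⟨fun n => {x | valuation K x ≤ valuation K (uniformizer K ^ (-(n : ℤ)))},
      fun n => IsNonarchimedeanLocalField.isCompact_closedBall K _, ?_⟩⟩
    refine Set.eq_univ_of_forall fun x => Set.mem_iUnion.mpr ?_
    by_cases hx : x = 0
    · exact ⟨0, by simp [hx]⟩
    · obtain ⟨n, hn⟩ := exists_valuation_eq_zpow hx
      refine ⟨n.natAbs, ?_⟩
      rw [Set.mem_ofPred_eq, hn, map_zpow₀, map_zpow₀]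
      exact zpow_le_zpow_right_of_le_one₀ (zero_lt_iff.mpr (by simp [uniformizer_ne_zero]))
        (valuation_lt_one_iff_le_uniformizer.mpr le_rfl).le (by omega)
  exact UniformSpace.secondCountable_of_separable K

/-! ### Scaling of Haar measure -/

variable [MeasurableSpace K] [BorelSpace K]

instance : (haar K).IsAddHaarMeasure := inferInstanceAs (Measure.addHaarMeasure _).IsAddHaarMeasure

instance : (haar K).Regular := inferInstanceAs (Measure.addHaarMeasure _).Regular

theorem haar_integers : haar K (𝒪[K] : Set K) = 1 :=
  Measure.addHaarMeasure_self (K₀ := integersCompacts K)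

/-- The modulus character is a homomorphism; multiplicativity of the absolute value on nonzero
elements is read off from this identification. -/
theorem canonicalAbs_unit (u : Kˣ) : canonicalAbs (u : K) = distribHaarChar K u := by
  rw [canonicalAbs, haar_integers, div_one]
  change (haar K (u • (𝒪[K] : Set K))).toNNReal = _
  rw [← distribHaarChar_mul, haar_integers, mul_one, ENNReal.toNNReal_coe]

theorem haar_image_mul {a : K} (ha : a ≠ 0) (s : Set K) :
    haar K ((fun x => a * x) '' s) = canonicalAbs a * haar K s := by
  have := distribHaarChar_mul (haar K) (Units.mk0 a ha) s
  rw [← canonicalAbs_unit] at this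
  exact this.symm

theorem haar_image_affine {a : K} (ha : a ≠ 0) (t : K) (s : Set K) :
    haar K ((fun x => t + a * x) '' s) = canonicalAbs a * haar K s := by
  rw [← haar_image_mul ha, ← measure_preimage_add (haar K) t]
  congr 1
  ext x
  simp only [Set.mem_image, Set.mem_preimage]
  constructor
  · rintro ⟨y, hy, h⟩
    exact ⟨y, hy, add_left_cancel h⟩
  · rintro ⟨y, hy, h⟩
    exact ⟨y, hy, by rw [h]⟩

theorem canonicalAbs_mul_of_ne {a b : K} (ha : a ≠ 0) (hb : b ≠ 0) :
    canonicalAbs (a * b) = canonicalAbs a * canonicalAbs b := by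
  have := canonicalAbs_unit (Units.mk0 a ha * Units.mk0 b hb)
  rw [map_mul, ← canonicalAbs_unit, ← canonicalAbs_unit] at this
  exact this

theorem canonicalAbs_one : canonicalAbs (1 : K) = 1 := by
  have := canonicalAbs_unit (1 : Kˣ)
  rwa [map_one, Units.val_one] at this

theorem canonicalAbs_ne_zero {a : K} (ha : a ≠ 0) : canonicalAbs a ≠ 0 := by
  intro h
  have := canonicalAbs_mul_of_ne ha (inv_ne_zero ha)
  rw [mul_inv_cancel₀ ha, canonicalAbs_one, h, zero_mul] at this
  exact one_ne_zero this

/-- Multiplication by a unit of the valuation ring permutes the ring, so it preserves its measure.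
-/
theorem canonicalAbs_of_valuation_eq_one {a : K} (ha : valuation K a = 1) : canonicalAbs a = 1 := by
  have h0 : a ≠ 0 := by rintro rfl; simp at ha
  have h : (fun x => a * x) '' (𝒪[K] : Set K) = 𝒪[K] := by
    ext x
    constructor
    · rintro ⟨y, hy, rfl⟩
      rw [mem_integers_iff] at hy ⊢
      simpa [ha] using hy
    · intro hx
      refine ⟨a⁻¹ * x, ?_, by field_simp⟩
      rw [mem_integers_iff] at hx ⊢
      simpa [ha] using hx
  have := haar_image_mul h0 (𝒪[K] : Set K)
  rw [h, haar_integers, mul_one] at this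
  exact_mod_cast this.symm

theorem canonicalAbs_zpow {a : K} (ha : a ≠ 0) (n : ℤ) :
    canonicalAbs (a ^ n) = canonicalAbs a ^ n := by
  have := canonicalAbs_unit (Units.mk0 a ha ^ n)
  rw [map_zpow, ← canonicalAbs_unit] at this
  simpa using this

theorem canonicalAbs_eq_of_valuation_eq {a b : K} (h : valuation K a = valuation K b) :
    canonicalAbs a = canonicalAbs b := by
  by_cases hb : b = 0
  · have : a = 0 := by simpa [hb] using h
    rw [hb, this]
  · have h1 : canonicalAbs (a / b) = 1 := canonicalAbs_of_valuation_eq_one (by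
      rw [map_div₀, h, div_self (by simpa using hb)])
    have ha : a ≠ 0 := by rintro rfl; exact hb (by simpa using h.symm)
    have := canonicalAbs_mul_of_ne (div_ne_zero ha hb) hb
    rwa [div_mul_cancel₀ a hb, h1, one_mul] at this

theorem measurableSet_integers : MeasurableSet (𝒪[K] : Set K) := isOpen_integers.measurableSet

theorem measurable_affine (t a : K) : Measurable fun x : K => t + a * x :=
  (by fun_prop : Continuous fun x : K => t + a * x).measurable

/-- The affine image of Haar measure on the valuation ring. -/
theorem map_affine_restrict {a : K} (ha : a ≠ 0) (t : K) :
    (canonicalAbs a : ℝ≥0∞) • ((haar K).restrict (𝒪[K] : Set K)).map (fun x => t + a * x) =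
      (haar K).restrict ((fun x => t + a * x) '' (𝒪[K] : Set K)) := by
  ext B hB
  rw [Measure.smul_apply, Measure.map_apply (measurable_affine t a) hB,
    Measure.restrict_apply (measurable_affine t a hB), smul_eq_mul, ← haar_image_affine ha t,
    Measure.restrict_apply hB, Set.image_preimage_inter]

/-! ### Self-similarity of Haar measure on the valuation ring -/

theorem integers_eq_iUnion : (𝒪[K] : Set K) =
    ⋃ c : 𝓀[K], (fun x => residueLift c + uniformizer K * x) '' (𝒪[K] : Set K) := by
  ext x
  simp only [Set.mem_iUnion, mem_image_zoom_iff]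
  exact ⟨fun h => ⟨_, h, rfl⟩, fun ⟨_, h, _⟩ => h⟩

theorem measurableSet_image_zoom (c : 𝓀[K]) :
    MeasurableSet ((fun x => residueLift c + uniformizer K * x) '' (𝒪[K] : Set K)) := by
  have h : Continuous fun x => (uniformizer K)⁻¹ * (x - residueLift c) := by fun_prop
  convert! (isOpen_integers.preimage h).measurableSet using 1
  ext x
  have h0 := uniformizer_ne_zero K
  constructor
  · rintro ⟨y, hy, rfl⟩
    simpa [h0] using hy
  · intro hx
    exact ⟨_, hx, by field_simp; ring⟩

theorem restrict_integers_eq_sum : (haar K).restrict (𝒪[K] : Set K) =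
    Measure.sum fun c : 𝓀[K] => (canonicalAbs (uniformizer K) : ℝ≥0∞) •
      ((haar K).restrict (𝒪[K] : Set K)).map (fun x => residueLift c + uniformizer K * x) := by
  simp_rw [map_affine_restrict (uniformizer_ne_zero K)]
  conv_lhs => rw [integers_eq_iUnion]
  refine Measure.restrict_iUnion (fun c c' hc => ?_) measurableSet_image_zoom
  refine Set.disjoint_left.mpr fun x hx hx' => hc ?_
  obtain ⟨h, h1⟩ := mem_image_zoom_iff.mp hx
  obtain ⟨h', h2⟩ := mem_image_zoom_iff.mp hx'
  rw [← h1, ← h2]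

/-- Compare total masses in the decomposition into residue classes: q pieces of equal mass add up to
1. -/
theorem canonicalAbs_uniformizer : canonicalAbs (uniformizer K) = (Nat.card 𝓀[K] : ℝ≥0)⁻¹ := by
  have := congrArg (fun μ : Measure K => μ Set.univ) (restrict_integers_eq_sum (K := K))
  simp only [Measure.restrict_apply_univ, haar_integers, Measure.sum_apply _ MeasurableSet.univ,
    Measure.smul_apply, Measure.map_apply (measurable_affine _ _) MeasurableSet.univ,
    Set.preimage_univ, smul_eq_mul, mul_one] at this
  have hf := Fintype.ofFinite 𝓀[K]
  rw [tsum_fintype, sum_const, card_univ, ← Nat.card_eq_fintype_card, nsmul_eq_mul] at this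
  refine eq_inv_of_mul_eq_one_right ?_
  exact_mod_cast this.symm

theorem one_lt_card_residue : 1 < Nat.card 𝓀[K] := Finite.one_lt_card

/-! ### Values and balls of the canonical absolute value -/

theorem canonicalAbs_uniformizer_zpow (n : ℤ) :
    canonicalAbs (uniformizer K ^ n) = (Nat.card 𝓀[K] : ℝ≥0) ^ (-n) := by
  rw [canonicalAbs_zpow (uniformizer_ne_zero K), canonicalAbs_uniformizer, inv_zpow, zpow_neg]

theorem exists_canonicalAbs_eq_zpow {x : K} (hx : x ≠ 0) : ∃ n : ℤ,
    valuation K x = valuation K (uniformizer K ^ n) ∧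
      canonicalAbs x = (Nat.card 𝓀[K] : ℝ≥0) ^ (-n) := by
  obtain ⟨n, hn⟩ := exists_valuation_eq_zpow hx
  exact ⟨n, hn, by rw [canonicalAbs_eq_of_valuation_eq hn, canonicalAbs_uniformizer_zpow]⟩

theorem canonicalAbs_le_one_iff_of_ne {x : K} (hx : x ≠ 0) :
    canonicalAbs x ≤ 1 ↔ valuation K x ≤ 1 := by
  obtain ⟨n, hn, hn'⟩ := exists_canonicalAbs_eq_zpow hx
  have hq : (1 : ℝ≥0) < Nat.card 𝓀[K] := by exact_mod_cast one_lt_card_residue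
  have h1 : valuation K (uniformizer K) < 1 := valuation_lt_one_iff_le_uniformizer.mpr le_rfl
  have h2 : 0 < valuation K (uniformizer K) := zero_lt_iff.mpr (by simp [uniformizer_ne_zero])
  rw [hn, hn', map_zpow₀, zpow_le_one_iff_right₀ hq, zpow_le_one_iff_right_of_lt_one₀ h2 h1]
  omega

theorem canonicalAbs_zero : canonicalAbs (0 : K) = 0 := by
  have h : (fun y : K => 0 * y) '' (𝒪[K] : Set K) ⊆ {0} := by
    rintro _ ⟨y, -, rfl⟩
    simp
  have h0 : haar K {(0 : K)} = 0 := by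
    -- The origin is fixed by the uniformizer, so its mass r satisfies r = q⁻¹ r; as r is finite, it
    -- is 0.
    have h1 : haar K {(0 : K)} = canonicalAbs (uniformizer K) * haar K {(0 : K)} := by
      rw [← haar_image_mul (uniformizer_ne_zero K)]
      simp
    have hfin : haar K {(0 : K)} ≠ ⊤ := by
      have hle : haar K {(0 : K)} ≤ haar K (𝒪[K] : Set K) :=
        measure_mono (Set.singleton_subset_iff.mpr (𝒪[K]).zero_mem)
      rw [haar_integers] at hle
      exact (hle.trans_lt ENNReal.one_lt_top).ne
    lift haar K {(0 : K)} to ℝ≥0 using hfin with r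
    have hq : (1 : ℝ≥0) < Nat.card 𝓀[K] := by exact_mod_cast one_lt_card_residue
    rw [canonicalAbs_uniformizer] at h1
    by_contra hr
    have hr' : r ≠ 0 := by simpa using hr
    have h2 : r = (Nat.card 𝓀[K] : ℝ≥0)⁻¹ * r := by exact_mod_cast h1
    have h3 : (Nat.card 𝓀[K] : ℝ≥0)⁻¹ = 1 := by
      exact mul_right_cancel₀ hr' (by rw [← h2, one_mul])
    rw [inv_eq_one] at h3
    exact hq.ne' h3
  rw [canonicalAbs, measure_mono_null h h0]
  simp

theorem canonicalAbs_eq_zero_iff {x : K} : canonicalAbs x = 0 ↔ x = 0 :=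
  ⟨fun h => by_contra fun h0 => canonicalAbs_ne_zero h0 h, fun h => by rw [h, canonicalAbs_zero]⟩

theorem canonicalAbs_mul (a b : K) : canonicalAbs (a * b) = canonicalAbs a * canonicalAbs b := by
  by_cases ha : a = 0
  · simp [ha, canonicalAbs_zero]
  by_cases hb : b = 0
  · simp [hb, canonicalAbs_zero]
  exact canonicalAbs_mul_of_ne ha hb

theorem canonicalAbs_le_one_iff {x : K} : canonicalAbs x ≤ 1 ↔ valuation K x ≤ 1 := by
  by_cases hx : x = 0
  · simp [hx, canonicalAbs_zero]
  · exact canonicalAbs_le_one_iff_of_ne hx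

theorem canonicalAbs_eq_zero_or_zpow (x : K) :
    canonicalAbs x = 0 ∨ ∃ n : ℤ, canonicalAbs x = (Nat.card 𝓀[K] : ℝ≥0) ^ n := by
  by_cases hx : x = 0
  · exact Or.inl (by rw [hx, canonicalAbs_zero])
  · obtain ⟨n, -, hn⟩ := exists_canonicalAbs_eq_zpow hx
    exact Or.inr ⟨_, hn⟩

theorem canonicalAbs_le_zpow_iff {x : K} (n : ℤ) :
    canonicalAbs x ≤ (Nat.card 𝓀[K] : ℝ≥0) ^ n ↔ uniformizer K ^ n * x ∈ (𝒪[K] : Set K) := by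
  have hq : (0 : ℝ≥0) < Nat.card 𝓀[K] := by exact_mod_cast zero_lt_one.trans one_lt_card_residue
  rw [mem_integers_iff, ← canonicalAbs_le_one_iff, canonicalAbs_mul, canonicalAbs_uniformizer_zpow,
    zpow_neg, inv_mul_le_one₀ (zpow_pos hq n)]

open scoped Classical in
-- The dichotomy behind all recursions: a pair is either contracted by q⁻¹ or separated to distance
-- exactly 1.
theorem canonicalAbs_sub_zoom {c c' : 𝓀[K]} {x y : K} (hx : x ∈ (𝒪[K] : Set K))
    (hy : y ∈ (𝒪[K] : Set K)) :
    canonicalAbs ((residueLift c + uniformizer K * x) - (residueLift c' + uniformizer K * y)) =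
      if c = c' then (Nat.card 𝓀[K] : ℝ≥0)⁻¹ * canonicalAbs (x - y) else 1 := by
  split_ifs with h
  · subst h
    rw [← canonicalAbs_uniformizer, ← canonicalAbs_mul]
    congr 1
    ring
  · exact canonicalAbs_of_valuation_eq_one (valuation_sub_zoom h hx hy)

theorem canonicalAbs_sub_le_one {x y : K} (hx : x ∈ (𝒪[K] : Set K)) (hy : y ∈ (𝒪[K] : Set K)) :
    canonicalAbs (x - y) ≤ 1 :=
  canonicalAbs_le_one_iff.mpr (Valuation.map_sub_le _ hx hy)

theorem setOf_canonicalAbs_le_zpow (n : ℤ) :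
    {x : K | canonicalAbs x ≤ (Nat.card 𝓀[K] : ℝ≥0) ^ n} =
      (fun x => 0 + uniformizer K ^ (-n) * x) '' (𝒪[K] : Set K) := by
  have h0 := zpow_ne_zero n (uniformizer_ne_zero K)
  ext x
  rw [Set.mem_ofPred_eq, canonicalAbs_le_zpow_iff]
  constructor
  · intro h
    exact ⟨_, h, by rw [zpow_neg]; field_simp; ring⟩
  · rintro ⟨y, hy, rfl⟩
    rw [zpow_neg]
    convert! hy using 1
    field_simp
    ring

theorem measurableSet_canonicalAbs_le_zpow (n : ℤ) :
    MeasurableSet {x : K | canonicalAbs x ≤ (Nat.card 𝓀[K] : ℝ≥0) ^ n} := by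
  simp_rw [canonicalAbs_le_zpow_iff]
  exact (isOpen_integers.preimage (by fun_prop : Continuous fun x : K => uniformizer K ^ n * x))
    |>.measurableSet

theorem measurable_canonicalAbs : Measurable (canonicalAbs : K → ℝ≥0) := by
  have hq : (1 : ℝ≥0) < Nat.card 𝓀[K] := by exact_mod_cast one_lt_card_residue
  have hq0 : (Nat.card 𝓀[K] : ℝ≥0) ≠ 0 := (zero_lt_one.trans hq).ne'
  refine measurable_of_Iio fun r => ?_
  rcases eq_or_ne r 0 with rfl | hr
  · simp
  -- With q^n < r ≤ q^(n+1), discreteness of the values turns the open condition into membership in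
  -- the ball of radius q^n.
  · obtain ⟨n, hn, hn'⟩ := exists_mem_Ioc_zpow (pos_iff_ne_zero.mpr hr) hq
    convert! measurableSet_canonicalAbs_le_zpow (K := K) n using 1
    ext x
    refine ⟨fun h => ?_, fun h => lt_of_le_of_lt h hn⟩
    rw [Set.mem_ofPred_eq]
    rcases canonicalAbs_eq_zero_or_zpow x with h0 | ⟨m, hm⟩
    · rw [h0]; exact zero_le
    · have h1 : canonicalAbs x < (Nat.card 𝓀[K] : ℝ≥0) ^ (n + 1) := lt_of_lt_of_le h hn'
      rw [hm, zpow_lt_zpow_iff_right₀ hq] at h1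
      rw [hm, zpow_le_zpow_iff_right₀ hq]
      omega

end LocalField

/-! ### Haar measure on the unit ball -/

section Cube

variable (K : Type*) [Field K] [ValuativeRel K] [TopologicalSpace K] [IsNonarchimedeanLocalField K]

noncomputable instance : Fintype 𝓀[K] := Fintype.ofFinite _

variable [MeasurableSpace K] [BorelSpace K]

/-- Haar probability measure on the valuation ring. -/
noncomputable def integersMeasure : Measure K := (haar K).restrict (𝒪[K] : Set K)

instance : IsProbabilityMeasure (integersMeasure K) :=
  ⟨by rw [integersMeasure, Measure.restrict_apply_univ, haar_integers]⟩

/-- Haar probability measure on the unit ball of `K^N`. -/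
noncomputable def cubeMeasure (N : ℕ) : Measure (Fin N → K) :=
  Measure.pi fun _ => integersMeasure K

instance (N : ℕ) : IsProbabilityMeasure (cubeMeasure K N) :=
  inferInstanceAs (IsProbabilityMeasure (Measure.pi _))

variable {K} {N : ℕ}

/-- Replace the coordinates in `A` by their images in prescribed residue classes. -/
noncomputable def zoom (A : Finset (Fin N)) (c : Fin N → 𝓀[K]) (x : Fin N → K) (i : Fin N) : K :=
  if i ∈ A then residueLift (c i) + uniformizer K * x i else x i

theorem measurable_zoom (A : Finset (Fin N)) (c : Fin N → 𝓀[K]) : Measurable (zoom A c) := by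
  refine measurable_pi_lambda _ fun i => ?_
  unfold zoom
  split_ifs
  · exact (measurable_affine _ _).comp (measurable_pi_apply i)
  · exact measurable_pi_apply i

theorem integersMeasure_eq_sum (B : Set K) (hB : MeasurableSet B) : integersMeasure K B =
    ∑ c : 𝓀[K], (Nat.card 𝓀[K] : ℝ≥0∞)⁻¹ *
      integersMeasure K ((fun x => residueLift c + uniformizer K * x) ⁻¹' B) := by
  have h := congrArg (fun μ : Measure K => μ B) (restrict_integers_eq_sum (K := K))
  simp only [Measure.sum_apply _ hB, Measure.smul_apply, tsum_fintype,
    Measure.map_apply (measurable_affine _ _) hB, smul_eq_mul, canonicalAbs_uniformizer] at h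
  rw [ENNReal.coe_inv (by exact_mod_cast (zero_lt_one.trans one_lt_card_residue).ne')] at h
  exact h

/-- The sum runs over residues for all coordinates, also those outside A, so that the normalization
is q⁻ᴺ for every A. For an index outside A the q equal terms cancel its factor q⁻¹. -/
theorem cubeMeasure_eq_sum_zoom (A : Finset (Fin N)) : cubeMeasure K N =
    ∑ c : Fin N → 𝓀[K], ((Nat.card 𝓀[K] : ℝ≥0∞)⁻¹ ^ N) • (cubeMeasure K N).map (zoom A c) := by
  classical
  refine Measure.pi_eq fun s hs => ?_
  have h1 : ∀ i, integersMeasure K (s i) = ∑ c : 𝓀[K], (Nat.card 𝓀[K] : ℝ≥0∞)⁻¹ *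
      integersMeasure K ((fun x => if i ∈ A then residueLift c + uniformizer K * x else x) ⁻¹' s i) := by
    intro i
    split_ifs with hi
    · exact integersMeasure_eq_sum _ (hs i)
    · rw [sum_const, card_univ, ← Nat.card_eq_fintype_card, nsmul_eq_mul, ← mul_assoc,
        ENNReal.mul_inv_cancel, one_mul]
      · rfl
      · exact_mod_cast (zero_lt_one.trans one_lt_card_residue).ne'
      · exact ENNReal.natCast_ne_top _
  simp_rw [h1]
  rw [prod_univ_sum, Fintype.piFinset_univ, Measure.coe_finsetSum, Finset.sum_apply]
  refine sum_congr rfl fun c _ => ?_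
  rw [Measure.smul_apply, Measure.map_apply (measurable_zoom A c)
    (MeasurableSet.univ_pi hs), prod_mul_distrib, prod_const, card_univ, Fintype.card_fin, smul_eq_mul]
  congr 1
  have : zoom A c ⁻¹' Set.univ.pi s = Set.univ.pi fun i =>
      (fun x => if i ∈ A then residueLift (c i) + uniformizer K * x else x) ⁻¹' s i := by
    ext x
    simp [zoom]
  rw [this, cubeMeasure, Measure.pi_pi]

theorem lintegral_zoom (A : Finset (Fin N)) {f : (Fin N → K) → ℝ≥0∞} (hf : Measurable f) :
    ∫⁻ x, f x ∂cubeMeasure K N =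
      (Nat.card 𝓀[K] : ℝ≥0∞)⁻¹ ^ N * ∑ c, ∫⁻ x, f (zoom A c x) ∂cubeMeasure K N := by
  conv_lhs => rw [cubeMeasure_eq_sum_zoom A]
  rw [lintegral_finsetSum_measure, mul_sum]
  refine sum_congr rfl fun c _ => ?_
  rw [lintegral_smul_measure, lintegral_map hf (measurable_zoom A c), smul_eq_mul]

theorem card_residue_inv_pow_ne_zero : (Nat.card 𝓀[K] : ℝ≥0∞)⁻¹ ^ N ≠ 0 :=
  pow_ne_zero _ (ENNReal.inv_ne_zero.mpr (ENNReal.natCast_ne_top _))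

theorem card_residue_inv_pow_ne_top : (Nat.card 𝓀[K] : ℝ≥0∞)⁻¹ ^ N ≠ ⊤ :=
  ENNReal.pow_ne_top (ENNReal.inv_ne_top.mpr
    (by exact_mod_cast (zero_lt_one.trans one_lt_card_residue).ne'))

theorem integral_zoom (A : Finset (Fin N)) {f : (Fin N → K) → ℂ}
    (hf : Integrable f (cubeMeasure K N)) : ∫ x, f x ∂cubeMeasure K N =
      (Nat.card 𝓀[K] : ℂ)⁻¹ ^ N * ∑ c, ∫ x, f (zoom A c x) ∂cubeMeasure K N := by
  have hf' := hf
  rw [cubeMeasure_eq_sum_zoom A, integrable_finsetSum_measure] at hf'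
  conv_lhs => rw [cubeMeasure_eq_sum_zoom A]
  rw [integral_finsetSum_measure hf', mul_sum]
  refine sum_congr rfl fun c hc => ?_
  have h := hf' c hc
  rw [integrable_smul_measure card_residue_inv_pow_ne_zero card_residue_inv_pow_ne_top] at h
  rw [integral_smul_measure, integral_map (measurable_zoom A c).aemeasurable h.1]
  simp

theorem ae_mem_integers : ∀ᵐ x ∂cubeMeasure K N, ∀ i, x i ∈ (𝒪[K] : Set K) := by
  rw [ae_all_iff]
  intro i
  have h : ∀ᵐ y ∂integersMeasure K, y ∈ (𝒪[K] : Set K) :=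
    ae_restrict_mem measurableSet_integers
  exact (Measure.quasiMeasurePreserving_eval (μ := fun _ : Fin N => integersMeasure K) i).ae h

/-! ### Balls of the standard norm -/

instance : SigmaFinite (haar K) := by
  have := secondCountableTopology (K := K)
  infer_instance

theorem standardNorm_le_iff {x : Fin N → K} {r : ℝ≥0} :
    standardNorm x ≤ r ↔ ∀ i, canonicalAbs (x i) ≤ r := by
  simp [standardNorm, Finset.sup_le_iff]

/-- A ball is a product of one-dimensional balls, each a dilate of the valuation ring by a power of
the uniformizer; each coordinate contributes a Jacobian q^m. -/
theorem haarPi_restrict_ball (m : ℤ) :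
    (haarPi K N).restrict {x | standardNorm x ≤ (Nat.card 𝓀[K] : ℝ≥0) ^ m} =
      (((Nat.card 𝓀[K] : ℝ≥0) ^ m) ^ N : ℝ≥0) •
        (cubeMeasure K N).map (fun x => uniformizer K ^ (-m) • x) := by
  have h1 : {x : Fin N → K | standardNorm x ≤ (Nat.card 𝓀[K] : ℝ≥0) ^ m} =
      Set.univ.pi fun _ => {y : K | canonicalAbs y ≤ (Nat.card 𝓀[K] : ℝ≥0) ^ m} := by
    ext x
    simp [standardNorm_le_iff]
  have hmeas : Measurable fun x : Fin N → K => uniformizer K ^ (-m) • x := by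
    refine measurable_pi_lambda _ fun i => ?_
    simpa [Function.comp_def] using (measurable_affine 0 (uniformizer K ^ (-m))).comp (measurable_pi_apply i)
  have h0 := zpow_ne_zero (-m) (uniformizer_ne_zero K)
  rw [h1, haarPi, Measure.restrict_pi_pi]
  refine Measure.pi_eq fun s hs => ?_
  rw [setOf_canonicalAbs_le_zpow, ← map_affine_restrict h0, canonicalAbs_uniformizer_zpow, neg_neg,
    Measure.smul_apply, Measure.map_apply hmeas (MeasurableSet.univ_pi hs)]
  have h2 : (fun x : Fin N → K => uniformizer K ^ (-m) • x) ⁻¹' Set.univ.pi s =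
      Set.univ.pi fun i => (fun y => 0 + uniformizer K ^ (-m) * y) ⁻¹' s i := by
    ext x
    simp
  rw [h2, cubeMeasure, Measure.pi_pi]
  simp_rw [Measure.smul_apply, Measure.map_apply (measurable_affine _ _) (hs _)]
  simp only [smul_eq_mul, prod_mul_distrib, prod_const, card_univ, Fintype.card_fin]
  rw [ENNReal.smul_def, smul_eq_mul, ENNReal.coe_pow]
  rfl

theorem measurable_dist (i j : Fin N) :
    Measurable fun x : Fin N → K => canonicalAbs (x i - x j) := by
  have := secondCountableTopology (K := K)
  exact measurable_canonicalAbs.comp ((measurable_pi_apply i).sub (measurable_pi_apply j))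

theorem measurable_standardNorm : Measurable (standardNorm : (Fin N → K) → ℝ≥0) :=
  measurable_of_Iic fun r => by
    have h : (standardNorm : (Fin N → K) → ℝ≥0) ⁻¹' Set.Iic r =
        ⋂ i, (fun x : Fin N → K => canonicalAbs (x i)) ⁻¹' Set.Iic r := by
      ext x
      simp [standardNorm_le_iff]
    rw [h]
    exact MeasurableSet.iInter fun i =>
      (measurable_canonicalAbs.comp (measurable_pi_apply i)) measurableSet_Iic

theorem standardNorm_eq_zero_or_zpow (x : Fin N → K) :
    standardNorm x = 0 ∨ ∃ n : ℤ, standardNorm x = (Nat.card 𝓀[K] : ℝ≥0) ^ n := by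
  rcases (univ : Finset (Fin N)).eq_empty_or_nonempty with h | h
  · exact Or.inl (by simp [standardNorm, h])
  · obtain ⟨i, -, hi⟩ := exists_mem_eq_sup univ h fun i => canonicalAbs (x i)
    rw [standardNorm, hi]
    exact canonicalAbs_eq_zero_or_zpow _

theorem standardNorm_eq_zero_iff {x : Fin N → K} : standardNorm x = 0 ↔ x = 0 := by
  rw [← nonpos_iff_eq_zero, standardNorm_le_iff, funext_iff]
  simp [canonicalAbs_eq_zero_iff]

end Cube

/-! ### Weights of tuples of distances -/

section PairWeight

variable {ι : Type*}

/-- The maximum over `T`, or `1` if `T` is empty. -/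
noncomputable def maxOn (T : Finset ι) (d : ι → ℝ≥0) : ℝ≥0 :=
  if h : T.Nonempty then T.sup' h d else 1

/-- The minimum over `T`, or `1` if `T` is empty. -/
noncomputable def minOn (T : Finset ι) (d : ι → ℝ≥0) : ℝ≥0 :=
  if h : T.Nonempty then T.inf' h d else 1

/-- The integrand `max^a min^b ∏ d_p^{s_p}`, over the pairs in `T`. -/
noncomputable def pairWeight (a b : ℂ) (s : ι → ℝ) (T : Finset ι) (d : ι → ℝ≥0) : ℂ :=
  ((maxOn T d : ℝ) : ℂ) ^ a * ((minOn T d : ℝ) : ℂ) ^ b * ∏ p ∈ T, ((d p : ℝ) : ℂ) ^ (s p : ℂ)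

variable {T U : Finset ι} {d d' : ι → ℝ≥0} {r : ℝ≥0}

theorem minOn_congr (h : ∀ p ∈ T, d p = d' p) : minOn T d = minOn T d' := by
  unfold minOn
  split_ifs with hT
  · exact inf'_congr hT rfl h
  · rfl

theorem maxOn_congr (h : ∀ p ∈ T, d p = d' p) : maxOn T d = maxOn T d' := by
  unfold maxOn
  split_ifs with hT
  · exact sup'_congr hT rfl h
  · rfl

theorem minOn_mul (hT : T.Nonempty) : minOn T (fun p => r * d p) = r * minOn T d := by
  simp only [minOn, dif_pos hT]
  exact (apply_inf'_eq_inf'_comp hT (fun y => r * y) fun x y => mul_min r x y).symm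

theorem maxOn_mul (hT : T.Nonempty) : maxOn T (fun p => r * d p) = r * maxOn T d := by
  simp only [maxOn, dif_pos hT]
  exact (apply_sup'_eq_sup'_comp hT (fun y => r * y) fun x y => mul_max r x y).symm

theorem minOn_le {p : ι} (hp : p ∈ T) : minOn T d ≤ d p := by
  rw [minOn, dif_pos ⟨p, hp⟩]
  exact inf'_le _ hp

theorem le_maxOn {p : ι} (hp : p ∈ T) : d p ≤ maxOn T d := by
  rw [maxOn, dif_pos ⟨p, hp⟩]
  exact le_sup' _ hp

theorem exists_minOn (hT : T.Nonempty) : ∃ p ∈ T, minOn T d = d p := by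
  rw [minOn, dif_pos hT]
  exact exists_mem_eq_inf' hT d

theorem exists_maxOn (hT : T.Nonempty) : ∃ p ∈ T, maxOn T d = d p := by
  rw [maxOn, dif_pos hT]
  exact exists_mem_eq_sup' hT d

/-- Contracted pairs have distance at most 1, so the separated pairs never matter for the minimum
unless there are no contracted ones. -/
theorem minOn_zoom [DecidableEq ι] (hUT : U ⊆ T) (hr : r ≤ 1) (hd : ∀ p ∈ U, d p ≤ 1)
    (hT : T.Nonempty) :
    minOn T (fun p => if p ∈ U then r * d p else 1) = if U = ∅ then 1 else r * minOn U d := by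
  split_ifs with hU
  · subst hU
    obtain ⟨p, -, hp⟩ := exists_minOn (d := fun p => if p ∈ (∅ : Finset ι) then r * d p else 1) hT
    simpa using hp
  · have hU' := nonempty_iff_ne_empty.mpr hU
    refine le_antisymm ?_ ?_
    · obtain ⟨p, hp, h⟩ := exists_minOn (d := d) hU'
      rw [h]
      refine (minOn_le (hUT hp)).trans ?_
      rw [if_pos hp]
    · obtain ⟨p, -, h⟩ := exists_minOn (d := fun p => if p ∈ U then r * d p else 1) hT
      rw [h]
      split_ifs with hpU
      · exact mul_le_mul_right (minOn_le hpU) r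
      · obtain ⟨p, hp, h⟩ := exists_minOn (d := d) hU'
        rw [h]
        exact mul_le_one' hr (hd p hp)

/-- A single separated pair already attains the largest possible value 1. -/
theorem maxOn_zoom [DecidableEq ι] (hUT : U ⊆ T) (hr : r ≤ 1) (hd : ∀ p ∈ U, d p ≤ 1)
    (hT : T.Nonempty) :
    maxOn T (fun p => if p ∈ U then r * d p else 1) = if U = T then r * maxOn T d else 1 := by
  split_ifs with hU
  · subst hU
    rw [← maxOn_mul hT]
    exact maxOn_congr fun p hp => if_pos hp
  · refine le_antisymm ?_ ?_
    · obtain ⟨p, -, h⟩ := exists_maxOn (d := fun p => if p ∈ U then r * d p else 1) hT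
      rw [h]
      split_ifs with hp
      · exact mul_le_one' hr (hd p hp)
      · exact le_rfl
    · obtain ⟨p, hpT, hpU⟩ := not_subset.mp fun h => hU (subset_antisymm hUT h)
      refine le_trans ?_ (le_maxOn hpT)
      rw [if_neg hpU]

theorem cpow_sum {x : ℂ} (hx : x ≠ 0) (f : ι → ℂ) (T : Finset ι) :
    x ^ (∑ p ∈ T, f p) = ∏ p ∈ T, x ^ f p := by
  classical
  induction T using Finset.induction_on with
  | empty => simp
  | insert p T hp ih => rw [sum_insert hp, prod_insert hp, Complex.cpow_add _ _ hx, ih]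

theorem coe_mul_cpow (x y : ℝ≥0) (z : ℂ) :
    (((x * y : ℝ≥0) : ℝ) : ℂ) ^ z = ((x : ℝ) : ℂ) ^ z * ((y : ℝ) : ℂ) ^ z := by
  rw [NNReal.coe_mul, Complex.ofReal_mul, Complex.mul_cpow_ofReal_nonneg x.coe_nonneg y.coe_nonneg]

/-- The integrand after magnifying the pairs in `U` and separating the other ones. -/
theorem pairWeight_zoom [DecidableEq ι] (a b : ℂ) (s : ι → ℝ) (hUT : U ⊆ T) (hr0 : r ≠ 0)
    (hr : r ≤ 1) (hd : ∀ p ∈ U, d p ≤ 1) (hT : T.Nonempty) :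
    pairWeight a b s T (fun p => if p ∈ U then r * d p else 1) =
      (if U = ∅ then 1 else ((r : ℝ) : ℂ) ^ ((if U = T then a else 0) + b + ∑ p ∈ U, (s p : ℂ))) *
        pairWeight (if U = T then a else 0) b s U d := by
  have hr' : ((r : ℝ) : ℂ) ≠ 0 := by simpa using hr0
  have hprod : ∏ p ∈ T, (((if p ∈ U then r * d p else 1 : ℝ≥0) : ℝ) : ℂ) ^ (s p : ℂ) =
      ((r : ℝ) : ℂ) ^ (∑ p ∈ U, (s p : ℂ)) * ∏ p ∈ U, ((d p : ℝ) : ℂ) ^ (s p : ℂ) := by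
    rw [← prod_subset hUT fun p _ hp => by simp [hp], cpow_sum hr', ← prod_mul_distrib]
    exact prod_congr rfl fun p hp => by rw [if_pos hp, coe_mul_cpow]
  unfold pairWeight
  rw [hprod, minOn_zoom hUT hr hd hT, maxOn_zoom hUT hr hd hT]
  by_cases hU : U = ∅
  · subst hU
    -- Here all pairs are separated. Since T is nonempty, the case U = T does not interfere, and
    -- both sides are 1 by the default values on the empty set.
    rw [if_neg hT.ne_empty.symm, if_pos rfl, if_pos rfl, if_neg hT.ne_empty.symm]
    simp [maxOn, minOn]
  · rw [if_neg hU, if_neg hU]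
    split_ifs with hUT'
    · subst hUT'
      rw [coe_mul_cpow, coe_mul_cpow, Complex.cpow_add _ _ hr', Complex.cpow_add _ _ hr']
      ring
    · rw [coe_mul_cpow, Complex.cpow_add _ _ hr', Complex.cpow_add _ _ hr']
      simp only [NNReal.coe_one, Complex.ofReal_one, Complex.one_cpow, Complex.cpow_zero]
      ring

theorem pairWeight_congr (a b : ℂ) (s : ι → ℝ) (h : ∀ p ∈ T, d p = d' p) :
    pairWeight a b s T d = pairWeight a b s T d' := by
  rw [pairWeight, pairWeight, minOn_congr h, maxOn_congr h]
  congr 1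
  exact prod_congr rfl fun p hp => by rw [h p hp]

@[simp] theorem pairWeight_empty (a b : ℂ) (s : ι → ℝ) : pairWeight a b s ∅ d = 1 := by
  simp [pairWeight, maxOn, minOn]

theorem pairWeight_eq_zero (a b : ℂ) {s : ι → ℝ} (hs : ∀ p, 0 < s p) {p : ι} (hp : p ∈ T)
    (h : d p = 0) : pairWeight a b s T d = 0 := by
  refine mul_eq_zero_of_right _ (prod_eq_zero hp ?_)
  rw [h, NNReal.coe_zero, Complex.ofReal_zero, Complex.zero_cpow]
  exact_mod_cast (hs p).ne'

theorem pairWeight_mul (a b : ℂ) (s : ι → ℝ) (hr0 : r ≠ 0) (hT : T.Nonempty) :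
    pairWeight a b s T (fun p => r * d p) =
      ((r : ℝ) : ℂ) ^ (a + b + ∑ p ∈ T, (s p : ℂ)) * pairWeight a b s T d := by
  have hr' : ((r : ℝ) : ℂ) ≠ 0 := by simpa using hr0
  unfold pairWeight
  rw [minOn_mul hT, maxOn_mul hT, coe_mul_cpow, coe_mul_cpow, Complex.cpow_add _ _ hr',
    Complex.cpow_add _ _ hr', cpow_sum hr']
  have : ∏ p ∈ T, (((r * d p : ℝ≥0) : ℝ) : ℂ) ^ (s p : ℂ) =
      (∏ p ∈ T, ((r : ℝ) : ℂ) ^ (s p : ℂ)) * ∏ p ∈ T, ((d p : ℝ) : ℂ) ^ (s p : ℂ) := by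
    rw [← prod_mul_distrib]
    exact prod_congr rfl fun p _ => coe_mul_cpow _ _ _
  rw [this]
  ring

end PairWeight

/-! ### Partitions and their refinements -/

section Partitions

variable {N : ℕ} {P Q : Finpartition (univ : Finset (Fin N))}

theorem mem_part_iff {i j : Fin N} : i ∈ P.part j ↔ P.part i = P.part j :=
  P.mem_part_iff_part_eq_part (mem_univ i) (mem_univ j)

theorem mem_part_self (i : Fin N) : i ∈ P.part i := mem_part_iff.mpr rfl

theorem part_mem_parts (i : Fin N) : P.part i ∈ P.parts := P.part_mem.mpr (mem_univ i)

theorem part_eq_of_mem_parts {lam : Finset (Fin N)} (h : lam ∈ P.parts) {i : Fin N} (hi : i ∈ lam) :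
    P.part i = lam := P.part_eq_of_mem h hi

theorem mem_parts_iff {lam : Finset (Fin N)} : lam ∈ P.parts ↔ ∃ i, P.part i = lam := by
  constructor
  · intro h
    obtain ⟨i, hi⟩ := P.nonempty_of_mem_parts h
    exact ⟨i, part_eq_of_mem_parts h hi⟩
  · rintro ⟨i, rfl⟩
    exact part_mem_parts i

theorem le_iff_part_subset : P ≤ Q ↔ ∀ i, P.part i ⊆ Q.part i := by
  constructor
  · intro h i
    obtain ⟨mu, hmu, hle⟩ := h (part_mem_parts i)
    rwa [part_eq_of_mem_parts hmu (hle (mem_part_self i))]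
  · intro h lam hlam
    obtain ⟨i, rfl⟩ := mem_parts_iff.mp hlam
    exact ⟨_, part_mem_parts i, h i⟩

theorem le_iff_part_eq : P ≤ Q ↔ ∀ i j, P.part i = P.part j → Q.part i = Q.part j := by
  rw [le_iff_part_subset]
  constructor
  · intro h i j hij
    exact mem_part_iff.mp (h j (mem_part_iff.mpr hij))
  · intro h i j hj
    exact mem_part_iff.mpr (h j i (mem_part_iff.mp hj))

theorem ext_part (h : ∀ i j, P.part i = P.part j ↔ Q.part i = Q.part j) : P = Q :=
  le_antisymm (le_iff_part_eq.mpr fun i j => (h i j).mp) (le_iff_part_eq.mpr fun i j => (h i j).mpr)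

theorem part_bot (i : Fin N) : (⊥ : Finpartition (univ : Finset (Fin N))).part i = {i} :=
  part_eq_of_mem_parts (Finpartition.mem_bot_iff.mpr ⟨i, mem_univ i, rfl⟩) (mem_singleton_self i)

theorem part_bot_eq_iff {i j : Fin N} : (⊥ : Finpartition (univ : Finset (Fin N))).part i =
    (⊥ : Finpartition (univ : Finset (Fin N))).part j ↔ i = j := by
  rw [part_bot, part_bot, singleton_inj]

/-- The pairs whose members are in the same part. -/
def samePairs (P : Finpartition (univ : Finset (Fin N))) : Finset (Pairs N) :=
  univ.filter fun p => P.part p.1.1 = P.part p.1.2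

theorem mem_samePairs {p : Pairs N} : p ∈ samePairs P ↔ P.part p.1.1 = P.part p.1.2 := by
  simp [samePairs]

/-- A partition is determined by its equivalence relation, hence by its unordered related pairs.
Sets of pairs and partitions are thus interchangeable, which transfers the pair computations to
refinements. -/
theorem samePairs_subset_iff : samePairs P ⊆ samePairs Q ↔ P ≤ Q := by
  rw [le_iff_part_eq]
  constructor
  · intro h i j hij
    rcases lt_trichotomy i j with hlt | rfl | hlt
    · exact mem_samePairs.mp (h (mem_samePairs (p := ⟨(i, j), hlt⟩).mpr hij))
    · rfl
    · exact (mem_samePairs.mp (h (mem_samePairs (p := ⟨(j, i), hlt⟩).mpr hij.symm))).symm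
  · intro h p hp
    exact mem_samePairs.mpr (h _ _ (mem_samePairs.mp hp))

theorem samePairs_inj : samePairs P = samePairs Q ↔ P = Q :=
  ⟨fun h => le_antisymm (samePairs_subset_iff.mp h.subset) (samePairs_subset_iff.mp h.superset),
    fun h => by rw [h]⟩

theorem samePairs_bot : samePairs (⊥ : Finpartition (univ : Finset (Fin N))) = ∅ := by
  refine filter_eq_empty_iff.mpr fun p _ h => ?_
  rw [part_bot_eq_iff] at h
  exact p.2.ne h

theorem samePairs_eq_empty_iff : samePairs P = ∅ ↔ P = ⊥ := by
  rw [← samePairs_bot, samePairs_inj]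

theorem samePairs_nonempty_iff : (samePairs P).Nonempty ↔ P ≠ ⊥ := by
  rw [nonempty_iff_ne_empty, ne_eq, samePairs_eq_empty_iff]

theorem samePairs_of_parts_eq (h : P.parts = {univ}) : samePairs P = univ := by
  refine filter_true_of_mem fun p _ => ?_
  have h1 : ∀ i, P.part i = univ := fun i => by
    have := part_mem_parts (P := P) i
    rwa [h, mem_singleton] at this
  rw [h1, h1]

variable {κ : Type*}

open scoped Classical in
/-- The common refinement of a partition with the fibres of a function. -/
noncomputable def refineBy (P : Finpartition (univ : Finset (Fin N))) (c : Fin N → κ) :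
    Finpartition (univ : Finset (Fin N)) :=
  Finpartition.ofSetoid ⟨fun i j => P.part i = P.part j ∧ c i = c j,
    fun _ => ⟨rfl, rfl⟩, fun h => ⟨h.1.symm, h.2.symm⟩, fun h h' => ⟨h.1.trans h'.1, h.2.trans h'.2⟩⟩

theorem part_refineBy_eq_iff {c : Fin N → κ} {i j : Fin N} :
    (refineBy P c).part i = (refineBy P c).part j ↔ P.part i = P.part j ∧ c i = c j := by
  classical
  rw [← mem_part_iff, refineBy, Finpartition.mem_part_ofSetoid_iff_rel]
  exact ⟨fun h => ⟨h.1.symm, h.2.symm⟩, fun h => ⟨h.1.symm, h.2.symm⟩⟩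

theorem refineBy_le (c : Fin N → κ) : refineBy P c ≤ P :=
  le_iff_part_eq.mpr fun _ _ h => (part_refineBy_eq_iff.mp h).1

theorem mem_samePairs_refineBy {c : Fin N → κ} {p : Pairs N} :
    p ∈ samePairs (refineBy P c) ↔ p ∈ samePairs P ∧ c p.1.1 = c p.1.2 := by
  rw [mem_samePairs, mem_samePairs, part_refineBy_eq_iff]

/-- The number of parts of `Q` contained in `lam`. -/
def partDegree (Q : Finpartition (univ : Finset (Fin N))) (lam : Finset (Fin N)) : ℕ :=
  #{mu ∈ Q.parts | mu ⊆ lam}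

/-- Colourings that refine `P` to `Q` are families of injective colourings of the children. -/
theorem nonempty_refineByEquiv (h : Q ≤ P) : Nonempty ({c : Fin N → κ // refineBy P c = Q} ≃
    ∀ lam : P.parts, ({mu // mu ∈ Q.parts.filter fun mu => mu ⊆ lam.1} ↪ κ)) := by
  have hne : ∀ (lam : P.parts) (mu : {mu // mu ∈ Q.parts.filter fun mu => mu ⊆ lam.1}),
      ∃ i, Q.part i = mu.1 ∧ P.part i = lam.1 := fun lam mu => by
    obtain ⟨hQ, hsub⟩ := mem_filter.mp mu.2
    obtain ⟨i, hi⟩ := mem_parts_iff.mp hQ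
    exact ⟨i, hi, part_eq_of_mem_parts lam.2 (hsub (hi ▸ mem_part_self i))⟩
  choose rep hrep hrep' using hne
  have key : ∀ (f : ∀ lam : P.parts, ({mu // mu ∈ Q.parts.filter fun mu => mu ⊆ lam.1} ↪ κ))
      (lam : P.parts) (mu mu' : {mu // mu ∈ Q.parts.filter fun mu => mu ⊆ lam.1}),
      f lam mu = f lam mu' ↔ mu.1 = mu'.1 := fun f lam mu mu' => by
    rw [(f lam).injective.eq_iff, Subtype.ext_iff]
  have hmem : ∀ i, Q.part i ∈ Q.parts.filter fun mu => mu ⊆ P.part i := fun i =>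
    mem_filter.mpr ⟨part_mem_parts i, le_iff_part_subset.mp h i⟩
  -- Transport along equalities of parts: stated for arbitrary `lam` and `mu`, so that substitution
  -- handles the dependent arguments of `f`.
  have tr : ∀ (f : ∀ lam : P.parts, ({mu // mu ∈ Q.parts.filter fun mu => mu ⊆ lam.1} ↪ κ))
      (i : Fin N) (lam : P.parts) (mu : {mu // mu ∈ Q.parts.filter fun mu => mu ⊆ lam.1}),
      P.part i = lam.1 → Q.part i = mu.1 →
      f ⟨P.part i, part_mem_parts i⟩ ⟨Q.part i, hmem i⟩ = f lam mu := by
    rintro f i ⟨lam, hlam⟩ ⟨mu, hmu⟩ h1 h2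
    dsimp only at h1 h2
    subst h1
    subst h2
    rfl
  refine ⟨
    { toFun := fun c lam => ⟨fun mu => c.1 (rep lam mu), fun mu mu' hc => ?_⟩
      invFun := fun f => ⟨fun i => f ⟨P.part i, part_mem_parts i⟩ ⟨Q.part i, hmem i⟩, ?_⟩
      left_inv := fun c => ?_
      right_inv := fun f => ?_ }⟩
  · have h1 : (refineBy P c.1).part (rep lam mu) = (refineBy P c.1).part (rep lam mu') :=
      part_refineBy_eq_iff.mpr ⟨by rw [hrep', hrep'], hc⟩
    rw [c.2, hrep, hrep] at h1
    exact Subtype.ext h1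
  · refine ext_part fun i j => ?_
    rw [part_refineBy_eq_iff]
    constructor
    · rintro ⟨h1, h2⟩
      have hj : Q.part j ∈ Q.parts.filter fun mu => mu ⊆ P.part i := h1 ▸ hmem j
      rw [tr f j ⟨P.part i, part_mem_parts i⟩ ⟨Q.part j, hj⟩ h1.symm rfl, key] at h2
      exact h2
    · intro h1
      have h2 := le_iff_part_eq.mp h i j h1
      exact ⟨h2, (tr f j ⟨P.part i, part_mem_parts i⟩ ⟨Q.part i, hmem i⟩ h2.symm h1.symm).symm⟩
  · refine Subtype.ext (funext fun i => ?_)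
    have h1 : (refineBy P c.1).part (rep ⟨P.part i, part_mem_parts i⟩ ⟨Q.part i, hmem i⟩) =
        (refineBy P c.1).part i := by
      rw [c.2, hrep]
    exact (part_refineBy_eq_iff.mp h1).2
  · refine funext fun lam => Function.Embedding.ext fun mu => ?_
    exact tr f (rep lam mu) lam mu (hrep' lam mu) (hrep lam mu)

/-! ### Counting the residue patterns that induce a refinement -/

theorem partDegree_pos (h : Q ≤ P) {lam : Finset (Fin N)} (hlam : lam ∈ P.parts) :
    0 < partDegree Q lam := by
  obtain ⟨i, rfl⟩ := mem_parts_iff.mp hlam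
  exact card_pos.mpr ⟨Q.part i, mem_filter.mpr ⟨part_mem_parts i, le_iff_part_subset.mp h i⟩⟩

/-- The product of falling factorials over the parts of `P`, counting the ways to refine to `Q`. -/
def splitCount (q : ℕ) (P Q : Finpartition (univ : Finset (Fin N))) : ℕ :=
  ∏ lam ∈ P.parts, (q - 1).descFactorial (partDegree Q lam - 1)

open scoped Classical in
-- The children of each part of P need distinct colours, and different parts are coloured
-- independently. A part with d children admits q(q-1)⋯(q-d+1) colourings; splitting off the first
-- factor q for each part leaves the falling factorials of q - 1.
theorem card_refineBy_eq [Fintype κ] [Nonempty κ] (h : Q ≤ P) :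
    #{c : Fin N → κ | refineBy P c = Q} =
      Fintype.card κ ^ #P.parts * splitCount (Fintype.card κ) P Q := by
  obtain ⟨e⟩ := nonempty_refineByEquiv (κ := κ) h
  rw [← Fintype.card_subtype, Fintype.card_congr e, Fintype.card_pi]
  simp_rw [Fintype.card_embedding_eq, Fintype.card_coe]
  rw [splitCount, ← prod_const, ← prod_mul_distrib,
    ← prod_coe_sort P.parts fun lam => Fintype.card κ *
      (Fintype.card κ - 1).descFactorial (partDegree Q lam - 1)]
  refine prod_congr rfl fun lam _ => ?_
  have h1 := partDegree_pos h lam.2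
  obtain ⟨n, hn⟩ := Nat.exists_eq_add_of_le' (Fintype.card_pos (α := κ))
  obtain ⟨m, hm⟩ := Nat.exists_eq_add_of_le' h1
  change (Fintype.card κ).descFactorial (partDegree Q lam.1) = _
  rw [hn, hm, Nat.succ_descFactorial_succ]
  rfl

theorem partDegree_of_mem {Q : Finpartition (univ : Finset (Fin N))} {lam : Finset (Fin N)}
    (h : lam ∈ Q.parts) : partDegree Q lam = 1 := by
  rw [partDegree, card_eq_one]
  refine ⟨lam, ?_⟩
  ext mu
  rw [mem_filter, mem_singleton]
  constructor
  · rintro ⟨h1, h2⟩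
    obtain ⟨i, rfl⟩ := mem_parts_iff.mp h1
    exact part_eq_of_mem_parts h (h2 (mem_part_self i))
  · rintro rfl
    exact ⟨h, Subset.refl _⟩

theorem splitCount_self (q : ℕ) : splitCount q P P = 1 :=
  prod_eq_one fun lam hlam => by
    rw [partDegree_of_mem hlam]
    rfl

open scoped Classical in
/-- Sums over colourings, grouped by the induced refinement. -/
theorem sum_refineBy [Fintype κ] [Nonempty κ] (g : Finpartition (univ : Finset (Fin N)) → ℂ) :
    ∑ c : Fin N → κ, g (refineBy P c) = ∑ Q with Q ≤ P,
      (Fintype.card κ : ℂ) ^ #P.parts * (splitCount (Fintype.card κ) P Q : ℂ) * g Q := by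
  rw [← sum_fiberwise_of_maps_to (t := univ.filter fun Q => Q ≤ P) (g := fun c => refineBy P c)
    (fun c _ => mem_filter.mpr ⟨mem_univ _, refineBy_le c⟩)]
  refine sum_congr rfl fun Q hQ => ?_
  rw [sum_congr rfl fun c hc => by rw [(mem_filter.mp hc).2], sum_const,
    card_refineBy_eq (mem_filter.mp hQ).2, nsmul_eq_mul]
  push_cast
  rfl

end Partitions

/-! ### Weights of configurations -/

section Weights

variable {K : Type*} [Field K] [ValuativeRel K] [TopologicalSpace K] [IsNonarchimedeanLocalField K]
  [MeasurableSpace K] [BorelSpace K] {N : ℕ}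

/-- The tuple of pairwise distances. -/
noncomputable def pairDist (x : Fin N → K) (p : Pairs N) : ℝ≥0 :=
  canonicalAbs (x p.1.1 - x p.1.2)

theorem measurable_pairDist (p : Pairs N) : Measurable fun x : Fin N → K => pairDist x p :=
  measurable_dist _ _

theorem measurable_maxOn (T : Finset (Pairs N)) :
    Measurable fun x : Fin N → K => maxOn T (pairDist x) := by
  unfold maxOn
  split_ifs with h
  · simp_rw [← Finset.sup'_apply h (fun p (x : Fin N → K) => pairDist x p)]
    exact Finset.measurable_sup' h fun p _ => measurable_pairDist p
  · exact measurable_const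

theorem measurable_minOn (T : Finset (Pairs N)) :
    Measurable fun x : Fin N → K => minOn T (pairDist x) := by
  unfold minOn
  split_ifs with h
  · refine measurable_of_Ici fun r => ?_
    have : (fun x : Fin N → K => T.inf' h (pairDist x)) ⁻¹' Set.Ici r =
        ⋂ p ∈ T, (fun x : Fin N → K => pairDist x p) ⁻¹' Set.Ici r := by
      ext x
      simp [le_inf'_iff]
    rw [this]
    exact Finset.measurableSet_biInter _ fun p _ => measurable_pairDist p measurableSet_Ici
  · exact measurable_const

theorem measurable_pairWeight (a b : ℂ) (s : Pairs N → ℝ) (T : Finset (Pairs N)) :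
    Measurable fun x : Fin N → K => pairWeight a b s T (pairDist x) := by
  unfold pairWeight
  refine ((((Complex.measurable_ofReal.comp (measurable_maxOn T).coe_nnreal_real).pow_const a).mul
    ((Complex.measurable_ofReal.comp (measurable_minOn T).coe_nnreal_real).pow_const b))).mul ?_
  exact Finset.measurable_prod _ fun p _ =>
    (Complex.measurable_ofReal.comp (measurable_pairDist p).coe_nnreal_real).pow_const _

theorem pairDist_le_one {x : Fin N → K} (hx : ∀ i, x i ∈ (𝒪[K] : Set K)) (p : Pairs N) :
    pairDist x p ≤ 1 := canonicalAbs_sub_le_one (hx _) (hx _)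

open scoped Classical in
theorem pairDist_zoom {A : Finset (Fin N)} {x : Fin N → K} (hx : ∀ i, x i ∈ (𝒪[K] : Set K))
    (c : Fin N → 𝓀[K]) {p : Pairs N} (h1 : p.1.1 ∈ A) (h2 : p.1.2 ∈ A) :
    pairDist (zoom A c x) p =
      if c p.1.1 = c p.1.2 then (Nat.card 𝓀[K] : ℝ≥0)⁻¹ * pairDist x p else 1 := by
  rw [pairDist, zoom, zoom, if_pos h1, if_pos h2, canonicalAbs_sub_zoom (hx _) (hx _)]
  rfl

theorem pairDist_zoom_of_notMem {A : Finset (Fin N)} {x : Fin N → K} (c : Fin N → 𝓀[K])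
    {p : Pairs N} (h1 : p.1.1 ∉ A) (h2 : p.1.2 ∉ A) : pairDist (zoom A c x) p = pairDist x p := by
  rw [pairDist, zoom, zoom, if_neg h1, if_neg h2]
  rfl

theorem card_residue_ne_zero : (Nat.card 𝓀[K] : ℝ≥0) ≠ 0 := by
  exact_mod_cast (zero_lt_one.trans one_lt_card_residue).ne'

theorem card_residue_inv_le_one : (Nat.card 𝓀[K] : ℝ≥0)⁻¹ ≤ 1 :=
  inv_le_one_of_one_le₀ (by exact_mod_cast one_lt_card_residue.le)

/-- The weight of a configuration in which only the pairs within the parts of `P` interact. -/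
noncomputable def partWeight (a b : ℂ) (s : Pairs N → ℝ)
    (P : Finpartition (univ : Finset (Fin N))) (x : Fin N → K) : ℂ :=
  pairWeight a b s (samePairs P) (pairDist x)

theorem measurable_partWeight (a b : ℂ) (s : Pairs N → ℝ)
    (P : Finpartition (univ : Finset (Fin N))) :
    Measurable (partWeight a b s P : (Fin N → K) → ℂ) := measurable_pairWeight a b s _

open scoped Classical in
/-- The factor by which the weight changes under magnification. -/
noncomputable def zoomFactor (q : ℕ) (a b : ℂ) (s : Pairs N → ℝ)
    (Q : Finpartition (univ : Finset (Fin N))) : ℂ :=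
  if Q = ⊥ then 1 else (q : ℂ) ^ (-(a + b + ∑ p ∈ samePairs Q, (s p : ℂ)))

theorem inv_natCast_cpow (q : ℕ) (z : ℂ) : (((q : ℝ≥0)⁻¹ : ℝ≥0) : ℂ) ^ z = (q : ℂ) ^ (-z) := by
  rw [Complex.cpow_neg, NNReal.coe_inv, Complex.ofReal_inv, Complex.inv_cpow]
  · simp
  · rw [NNReal.coe_natCast, Complex.ofReal_natCast, Complex.natCast_arg]
    exact Real.pi_ne_zero.symm

open scoped Classical in
theorem samePairs_refineBy_zoom {P : Finpartition (univ : Finset (Fin N))} {x : Fin N → K}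
    (hx : ∀ i, x i ∈ (𝒪[K] : Set K)) (c : Fin N → 𝓀[K]) :
    ∀ p ∈ samePairs P, pairDist (zoom univ c x) p = if p ∈ samePairs (refineBy P c) then
      (Nat.card 𝓀[K] : ℝ≥0)⁻¹ * pairDist x p else 1 := by
  intro p hp
  rw [pairDist_zoom hx c (mem_univ _) (mem_univ _)]
  simp only [mem_samePairs_refineBy, hp, true_and]

open scoped Classical in
-- The contracted pairs are exactly those of the refinement by residues. The exponent a survives
-- only when nothing is split, since otherwise the maximum is 1.
theorem partWeight_zoom (a b : ℂ) (s : Pairs N → ℝ) {P : Finpartition (univ : Finset (Fin N))}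
    (hP : P ≠ ⊥) {x : Fin N → K} (hx : ∀ i, x i ∈ (𝒪[K] : Set K)) (c : Fin N → 𝓀[K]) :
    partWeight a b s P (zoom univ c x) =
      zoomFactor (Nat.card 𝓀[K]) (if refineBy P c = P then a else 0) b s (refineBy P c) *
        partWeight (if refineBy P c = P then a else 0) b s (refineBy P c) x := by
  unfold partWeight
  rw [pairWeight_congr a b s (samePairs_refineBy_zoom hx c),
    pairWeight_zoom a b s (samePairs_subset_iff.mpr (refineBy_le c))
      (inv_ne_zero card_residue_ne_zero) card_residue_inv_le_one
      (fun p _ => pairDist_le_one hx p) (samePairs_nonempty_iff.mpr hP)]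
  simp only [samePairs_inj, samePairs_eq_empty_iff, inv_natCast_cpow]
  rfl

open scoped Classical in
theorem minOn_zoom_refineBy {P : Finpartition (univ : Finset (Fin N))}
    (hP : P ≠ ⊥) {x : Fin N → K} (hx : ∀ i, x i ∈ (𝒪[K] : Set K)) (c : Fin N → 𝓀[K]) :
    minOn (samePairs P) (pairDist (zoom univ c x)) = if refineBy P c = ⊥ then 1 else
      (Nat.card 𝓀[K] : ℝ≥0)⁻¹ * minOn (samePairs (refineBy P c)) (pairDist x) := by
  rw [minOn_congr (samePairs_refineBy_zoom hx c),
    minOn_zoom (samePairs_subset_iff.mpr (refineBy_le c)) card_residue_inv_le_one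
      (fun p _ => pairDist_le_one hx p) (samePairs_nonempty_iff.mpr hP)]
  simp only [samePairs_eq_empty_iff]

/-! ### Integrability -/

/-- The exponent `∑ e_lam(s)` over the parts of `P`. -/
noncomputable def partExponent (s : Pairs N → ℝ) (P : Finpartition (univ : Finset (Fin N))) : ℝ :=
  N - #P.parts + ∑ p ∈ samePairs P, s p

/-- The part sizes add up to N and are at least 1, so N parts would all be singletons. -/
theorem card_parts_lt {P : Finpartition (univ : Finset (Fin N))} (hP : P ≠ ⊥) : #P.parts < N := by
  refine lt_of_le_of_ne (by simpa using P.card_parts_le_card) fun h => hP ?_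
  have h1 : ∀ lam ∈ P.parts, #lam = 1 := by
    have hs := P.sum_card_parts
    rw [card_univ, Fintype.card_fin] at hs
    replace hs := h.trans hs.symm
    rw [card_eq_sum_ones] at hs
    have := (sum_eq_sum_iff_of_le (fun lam hlam =>
      Nat.one_le_iff_ne_zero.mpr (card_pos.mpr (P.nonempty_of_mem_parts hlam)).ne')).mp hs
    exact fun lam hlam => (this lam hlam).symm
  refine ext_part fun i j => ?_
  rw [part_bot_eq_iff]
  refine ⟨fun hij => ?_, fun hij => by rw [hij]⟩
  obtain ⟨k, hk⟩ := card_eq_one.mp (h1 _ (part_mem_parts (P := P) i))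
  have hi := mem_part_self (P := P) i
  have hj := mem_part_self (P := P) j
  rw [← hij, hk, mem_singleton] at hj
  rw [hk, mem_singleton] at hi
  rw [hi, hj]

/-- This bound is why Re b ≥ -1 suffices: Re b plus the exponent is then strictly positive at every
partition other than the singletons. -/
theorem one_lt_partExponent {s : Pairs N → ℝ} (hs : ∀ p, 0 < s p)
    {P : Finpartition (univ : Finset (Fin N))} (hP : P ≠ ⊥) : 1 < partExponent s P := by
  have h1 : (#P.parts : ℝ) + 1 ≤ N := by exact_mod_cast card_parts_lt hP
  have h2 : 0 < ∑ p ∈ samePairs P, s p :=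
    sum_pos (fun p _ => hs p) (samePairs_nonempty_iff.mpr hP)
  unfold partExponent
  linarith

/-- The bound is the fixed point of t ↦ r t + C; a sequence started at 0 never passes it. -/
theorem ENNReal_le_of_affine_recursion {u : ℕ → ℝ≥0∞} {r C : ℝ≥0} (hr : r < 1) (h0 : u 0 = 0)
    (h : ∀ k, u (k + 1) ≤ r * u k + C) (k : ℕ) : u k ≤ ((C / (1 - r) : ℝ≥0) : ℝ≥0∞) := by
  induction k with
  | zero => rw [h0]; exact zero_le
  | succ k ih =>
    refine (h k).trans ((add_le_add_left (mul_le_mul_right ih _) _).trans ?_)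
    have h1 : r * (C / (1 - r)) + C ≤ C / (1 - r) := by
      have h2 : (1 : ℝ) - r ≠ 0 := by
        have : (r : ℝ) < 1 := hr
        linarith
      rw [← NNReal.coe_le_coe]
      push_cast [NNReal.coe_sub hr.le]
      apply le_of_eq
      field_simp
      ring
    exact_mod_cast h1

/-- The recursion I = r I + C with r < 1 says nothing if I could be infinite. So truncate to minimum
distance above q⁻ᵏ: one magnification lowers k by one, giving an affine recursion in k that starts
at 0 and hence a uniform bound. Monotone convergence removes the truncation. The constant collects
proper refinements and is finite by induction. -/
theorem integrable_partWeight_aux (b : ℂ) {s : Pairs N → ℝ} (hs : ∀ p, 0 < s p)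
    (hb : -1 ≤ b.re) (P : Finpartition (univ : Finset (Fin N))) :
    ∀ a : ℂ, (P ≠ ⊥ → 0 < a.re + b.re + partExponent s P) →
      ∫⁻ x, ‖partWeight a b s P x‖ₑ ∂cubeMeasure K N < ⊤ := by
  classical
  induction P using WellFoundedLT.induction with
  | ind P ih =>
  intro a ha
  by_cases hP : P = ⊥
  · simp [partWeight, hP, samePairs_bot]
  have ha := ha hP
  set q := Nat.card 𝓀[K] with hqdef
  have hq1 : (1 : ℝ) < q := by exact_mod_cast one_lt_card_residue (K := K)
  have hq0 : (q : ℝ≥0) ≠ 0 := card_residue_ne_zero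
  set S : ℕ → Set (Fin N → K) := fun k =>
    {x | (q : ℝ≥0)⁻¹ ^ k < minOn (samePairs P) (pairDist x)} with hS
  have hSm : ∀ k, MeasurableSet (S k) := fun k =>
    measurableSet_lt measurable_const (measurable_minOn _)
  set f : (Fin N → K) → ℝ≥0∞ := fun x => ‖partWeight a b s P x‖ₑ with hf
  have hfm : Measurable f := (measurable_partWeight a b s P).enorm
  have hfS : ∀ k, Measurable ((S k).indicator f) := fun k => hfm.indicator (hSm k)
  -- The truncations exhaust everything except collisions, and there the weight vanishes because
  -- some factor is 0 to a positive power.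
  have hsup : ∀ x, f x = ⨆ k, (S k).indicator f x := by
    intro x
    by_cases hx : minOn (samePairs P) (pairDist x) = 0
    · obtain ⟨p, hp, h⟩ := exists_minOn (d := pairDist x) (samePairs_nonempty_iff.mpr hP)
      have : f x = 0 := by
        rw [hf]
        dsimp only
        rw [partWeight, pairWeight_eq_zero a b hs hp (h.symm.trans hx), enorm_zero]
      rw [this]
      symm
      rw [← bot_eq_zero, iSup_eq_bot]
      intro k
      by_cases hk : x ∈ S k
      · rw [Set.indicator_of_mem hk, this]; rfl
      · rw [Set.indicator_of_notMem hk]; rfl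
    · refine le_antisymm ?_ (iSup_le fun k => Set.indicator_le_self _ _ _)
      obtain ⟨k, hk⟩ := exists_pow_lt_of_lt_one (pos_iff_ne_zero.mpr hx)
        (inv_lt_one_of_one_lt₀ (by exact_mod_cast hq1 : (1 : ℝ≥0) < q))
      refine le_iSup_of_le k ?_
      rw [Set.indicator_of_mem (show x ∈ S k from hk)]
  have hmono : Monotone fun k => (S k).indicator f := by
    refine monotone_nat_of_le_succ fun k => ?_
    refine Set.indicator_le_indicator_of_subset (fun x hx => ?_) (fun _ => zero_le)
    refine lt_of_le_of_lt (b := (q : ℝ≥0)⁻¹ ^ k) ?_ hx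
    exact pow_le_pow_of_le_one zero_le card_residue_inv_le_one (Nat.le_succ k)
  have hlim : ∫⁻ x, f x ∂cubeMeasure K N =
      ⨆ k, ∫⁻ x, (S k).indicator f x ∂cubeMeasure K N := by
    rw [← lintegral_iSup hfS hmono]
    exact lintegral_congr hsup
  set u : ℕ → ℝ≥0∞ := fun k => ∫⁻ x, (S k).indicator f x ∂cubeMeasure K N with hu
  have hu0 : u 0 = 0 := by
    rw [hu]
    dsimp only
    rw [lintegral_eq_zero_iff (hfS 0)]
    filter_upwards [ae_mem_integers (K := K) (N := N)] with x hx
    refine Set.indicator_of_notMem (fun h => ?_) _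
    obtain ⟨p, hp, h'⟩ := exists_minOn (d := pairDist x) (samePairs_nonempty_iff.mpr hP)
    have h2 : (q : ℝ≥0)⁻¹ ^ 0 < minOn (samePairs P) (pairDist x) := h
    rw [h', pow_zero] at h2
    exact absurd (pairDist_le_one hx p) (not_le.mpr h2)
  set ρ : ℝ≥0 := ‖zoomFactor q a b s P‖₊ with hρ
  -- The q^#P residue patterns that leave P unrefined, normalized by q⁻ᴺ, each contribute the zoom
  -- factor; altogether r = q^(-(Re a + Re b + E_P)).
  set r : ℝ≥0 := (q : ℝ≥0)⁻¹ ^ N * ((q : ℝ≥0) ^ #P.parts * ρ) with hr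
  have hr1 : r < 1 := by
    have h1 : (r : ℝ) = (q : ℝ) ^ (-(a.re + b.re + partExponent s P)) := by
      rw [hr, hρ, zoomFactor, if_neg hP]
      push_cast
      rw [← Complex.ofReal_natCast, Complex.norm_cpow_eq_rpow_re_of_pos (by linarith), inv_pow,
        ← Real.rpow_natCast, ← Real.rpow_natCast, ← Real.rpow_neg (by linarith),
        ← Real.rpow_add (by linarith), ← Real.rpow_add (by linarith)]
      congr 1
      rw [partExponent]
      simp only [Complex.neg_re, Complex.add_re, Complex.re_sum, Complex.ofReal_re]
      ring
    rw [← NNReal.coe_lt_coe, h1, NNReal.coe_one]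
    exact Real.rpow_lt_one_of_one_lt_of_neg hq1 (by linarith)
  set C : ℝ≥0∞ := (q : ℝ≥0∞)⁻¹ ^ N * ∑ c : Fin N → 𝓀[K] with refineBy P c ≠ P,
    ‖zoomFactor q 0 b s (refineBy P c)‖ₑ *
      ∫⁻ x, ‖partWeight 0 b s (refineBy P c) x‖ₑ ∂cubeMeasure K N with hC
  have hCtop : C ≠ ⊤ := by
    refine ENNReal.mul_ne_top card_residue_inv_pow_ne_top (ENNReal.sum_ne_top.mpr fun c hc => ?_)
    refine ENNReal.mul_ne_top enorm_ne_top (ne_of_lt (ih _ ?_ 0 fun h => ?_))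
    · exact lt_of_le_of_ne (refineBy_le c) (mem_filter.mp hc).2
    -- Proper refinements carry a = 0, so positivity of the exponent no longer depends on the
    -- original a.
    · have := one_lt_partExponent hs h
      rw [Complex.zero_re]
      linarith
  have hrec : ∀ k, u (k + 1) ≤ r * u k + C.toNNReal := by
    intro k
    rw [ENNReal.coe_toNNReal hCtop, hu]
    dsimp only
    rw [lintegral_zoom univ (hfS (k + 1)), ← sum_filter_add_sum_filter_not univ
      (fun c : Fin N → 𝓀[K] => refineBy P c = P), mul_add]
    refine add_le_add ?_ (mul_le_mul_right (sum_le_sum fun c hc => ?_) _)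
    · have h1 : ∀ c ∈ univ.filter (fun c : Fin N → 𝓀[K] => refineBy P c = P),
          ∫⁻ x, (S (k + 1)).indicator f (zoom univ c x) ∂cubeMeasure K N ≤ ρ * u k := by
        intro c hc
        have hc := (mem_filter.mp hc).2
        rw [hu]
        dsimp only
        rw [← lintegral_const_mul _ (hfS k)]
        refine lintegral_mono_ae ?_
        filter_upwards [ae_mem_integers (K := K) (N := N)] with x hx
        by_cases hxS : zoom univ c x ∈ S (k + 1)
        · have hxS' : x ∈ S k := by
            have h2 : (q : ℝ≥0)⁻¹ ^ (k + 1) < minOn (samePairs P) (pairDist (zoom univ c x)) := hxS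
            rw [minOn_zoom_refineBy hP hx, hc, if_neg hP, pow_succ', ← hqdef] at h2
            exact lt_of_mul_lt_mul_left h2 zero_le
          rw [Set.indicator_of_mem hxS, Set.indicator_of_mem hxS', hf]
          dsimp only
          rw [partWeight_zoom a b s hP hx, if_pos hc, hc, enorm_mul]
          rfl
        · rw [Set.indicator_of_notMem hxS]
          exact zero_le
      refine (mul_le_mul_right (sum_le_sum h1) _).trans (le_of_eq ?_)
      rw [sum_const, card_refineBy_eq le_rfl, splitCount_self, mul_one, nsmul_eq_mul, hr,
        ← Nat.card_eq_fintype_card, ← hqdef]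
      push_cast
      ring
    · have hc := (mem_filter.mp hc).2
      rw [← lintegral_const_mul _ (measurable_partWeight _ _ _ _).enorm]
      refine lintegral_mono_ae ?_
      filter_upwards [ae_mem_integers (K := K) (N := N)] with x hx
      refine (Set.indicator_le_self _ _ _).trans (le_of_eq ?_)
      rw [hf]
      dsimp only
      rw [partWeight_zoom a b s hP hx, if_neg hc, enorm_mul]
  rw [show ∫⁻ x, ‖partWeight a b s P x‖ₑ ∂cubeMeasure K N = ∫⁻ x, f x ∂cubeMeasure K N from rfl,
    hlim]
  exact lt_of_le_of_lt (iSup_le fun k => ENNReal_le_of_affine_recursion hr1 hu0 hrec k)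
    ENNReal.coe_lt_top

theorem integrable_partWeight {a b : ℂ} {s : Pairs N → ℝ} (hs : ∀ p, 0 < s p)
    (hb : -1 ≤ b.re) {P : Finpartition (univ : Finset (Fin N))}
    (ha : P ≠ ⊥ → 0 < a.re + b.re + partExponent s P) :
    Integrable (partWeight a b s P) (cubeMeasure K N) :=
  ⟨(measurable_partWeight a b s P).aestronglyMeasurable, integrable_partWeight_aux b hs hb P a ha⟩

end Weights

/-! ### Recursion for the integrals over the unit ball -/

section Recursion

variable (K : Type*) [Field K] [ValuativeRel K] [TopologicalSpace K] [IsNonarchimedeanLocalField K]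
  [MeasurableSpace K] [BorelSpace K] {N : ℕ}

/-- The integral of `partWeight` over the unit ball. -/
noncomputable def partIntegral (a b : ℂ) (s : Pairs N → ℝ)
    (P : Finpartition (univ : Finset (Fin N))) : ℂ :=
  ∫ x, partWeight a b s P x ∂cubeMeasure K N

open scoped Classical in
/-- The contribution to `partIntegral` of the configurations in which some part of `P` is split by
reduction. -/
noncomputable def splitSum (b : ℂ) (s : Pairs N → ℝ)
    (P : Finpartition (univ : Finset (Fin N))) : ℂ :=
  ∑ Q with Q < P, (Nat.card 𝓀[K] : ℂ) ^ #P.parts * (splitCount (Nat.card 𝓀[K]) P Q : ℂ) *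
    ((Nat.card 𝓀[K] : ℂ)⁻¹ ^ N * (zoomFactor (Nat.card 𝓀[K]) 0 b s Q * partIntegral K 0 b s Q))

variable {K}

theorem card_residue_complex_ne_zero : (Nat.card 𝓀[K] : ℂ) ≠ 0 := by
  exact_mod_cast (zero_lt_one.trans one_lt_card_residue).ne'

theorem pow_mul_zoomFactor {q : ℕ} (hq : (q : ℂ) ≠ 0) (a b : ℂ) (s : Pairs N → ℝ)
    {P : Finpartition (univ : Finset (Fin N))} (hP : P ≠ ⊥) :
    (q : ℂ)⁻¹ ^ N * ((q : ℂ) ^ #P.parts * zoomFactor q a b s P) =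
      (q : ℂ) ^ (-(a + b + partExponent s P)) := by
  rw [zoomFactor, if_neg hP, inv_pow, ← Complex.cpow_natCast, ← Complex.cpow_natCast,
    ← Complex.cpow_neg, ← Complex.cpow_add _ _ hq, ← Complex.cpow_add _ _ hq]
  congr 1
  rw [partExponent]
  push_cast
  ring

theorem partIntegral_bot (a b : ℂ) (s : Pairs N → ℝ) : partIntegral K a b s ⊥ = 1 := by
  simp [partIntegral, partWeight, samePairs_bot]

/-- Average over residues and move the unrefined term to the left. What remains involves proper
refinements only, hence is independent of a. -/
theorem partIntegral_mul {a b : ℂ} {s : Pairs N → ℝ} (hs : ∀ p, 0 < s p) (hb : -1 ≤ b.re)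
    {P : Finpartition (univ : Finset (Fin N))} (hP : P ≠ ⊥)
    (ha : 0 < a.re + b.re + partExponent s P) :
    partIntegral K a b s P * (1 - (Nat.card 𝓀[K] : ℂ) ^ (-(a + b + partExponent s P))) =
      splitSum K b s P := by
  classical
  have hI := integrable_partWeight (K := K) hs hb fun _ => ha
  set g : Finpartition (univ : Finset (Fin N)) → ℂ := fun Q =>
    zoomFactor (Nat.card 𝓀[K]) (if Q = P then a else 0) b s Q *
      partIntegral K (if Q = P then a else 0) b s Q with hg
  have h1 : partIntegral K a b s P = (Nat.card 𝓀[K] : ℂ)⁻¹ ^ N *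
      ∑ c : Fin N → 𝓀[K], g (refineBy P c) := by
    rw [partIntegral, integral_zoom univ hI]
    congr 1
    refine sum_congr rfl fun c _ => ?_
    rw [hg]
    dsimp only
    rw [partIntegral, ← integral_const_mul]
    refine integral_congr_ae ?_
    filter_upwards [ae_mem_integers (K := K) (N := N)] with x hx
    exact partWeight_zoom a b s hP hx c
  have h2 : (univ.filter fun Q => Q ≤ P) = insert P (univ.filter fun Q => Q < P) := by
    ext Q
    simp [le_iff_eq_or_lt]
  rw [sum_refineBy, h2, sum_insert (by simp), splitCount_self, ← Nat.card_eq_fintype_card,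
    mul_add] at h1
  have h3 : (Nat.card 𝓀[K] : ℂ)⁻¹ ^ N * ((Nat.card 𝓀[K] : ℂ) ^ #P.parts * ((1 : ℕ) : ℂ) * g P) =
      (Nat.card 𝓀[K] : ℂ) ^ (-(a + b + partExponent s P)) * partIntegral K a b s P := by
    rw [← pow_mul_zoomFactor card_residue_complex_ne_zero a b s hP, hg]
    simp only [if_true]
    push_cast
    ring
  rw [h3] at h1
  have h4 : splitSum K b s P = (Nat.card 𝓀[K] : ℂ)⁻¹ ^ N *
      ∑ Q with Q < P, (Nat.card 𝓀[K] : ℂ) ^ #P.parts *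
        (splitCount (Nat.card 𝓀[K]) P Q : ℂ) * g Q := by
    rw [splitSum, mul_sum]
    refine sum_congr rfl fun Q hQ => ?_
    rw [hg]
    dsimp only
    rw [if_neg (mem_filter.mp hQ).2.ne]
    ring
  rw [h4]
  linear_combination h1

theorem one_sub_cpow_ne_zero {q : ℕ} (hq : 1 < q) {z : ℂ} (hz : 0 < z.re) :
    (1 : ℂ) - (q : ℂ) ^ (-z) ≠ 0 := by
  intro h
  have h1 : ‖(q : ℂ) ^ (-z)‖ = 1 := by rw [← sub_eq_zero.mp h, norm_one]
  have hq' : (1 : ℝ) < q := by exact_mod_cast hq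
  rw [← Complex.ofReal_natCast, Complex.norm_cpow_eq_rpow_re_of_pos (by linarith)] at h1
  have := Real.rpow_lt_one_of_one_lt_of_neg hq' (z := (-z).re) (by simpa using hz)
  linarith

variable (K) in
open scoped Classical in
/-- The normalized split sum, with its value at the partition into singletons. -/
noncomputable def splitValue (b : ℂ) (s : Pairs N → ℝ)
    (P : Finpartition (univ : Finset (Fin N))) : ℂ :=
  if P = ⊥ then (Nat.card 𝓀[K] : ℂ)⁻¹ ^ N else
    (Nat.card 𝓀[K] : ℂ)⁻¹ ^ #P.parts * splitSum K b s P

open scoped Classical in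
-- Dividing by q^#P removes the powers of q that depend on the source and target of a step. Solving
-- the previous recursion at Q then turns q^(-(b+E))/(1 - q^(-(b+E))) into 1/(q^(b+E) - 1).
theorem splitValue_eq_sum {b : ℂ} {s : Pairs N → ℝ} (hs : ∀ p, 0 < s p) (hb : -1 ≤ b.re)
    {P : Finpartition (univ : Finset (Fin N))} (hP : P ≠ ⊥) :
    splitValue K b s P = ∑ Q with Q < P, (splitCount (Nat.card 𝓀[K]) P Q : ℂ) *
      (if Q = ⊥ then 1 else 1 / ((Nat.card 𝓀[K] : ℂ) ^ (b + partExponent s Q) - 1)) *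
        splitValue K b s Q := by
  have hq := card_residue_complex_ne_zero (K := K)
  rw [splitValue, if_neg hP, splitSum, mul_sum]
  refine sum_congr rfl fun Q _ => ?_
  have h1 : (Nat.card 𝓀[K] : ℂ)⁻¹ ^ N * (zoomFactor (Nat.card 𝓀[K]) 0 b s Q * partIntegral K 0 b s Q) =
      (if Q = ⊥ then 1 else 1 / ((Nat.card 𝓀[K] : ℂ) ^ (b + partExponent s Q) - 1)) *
        splitValue K b s Q := by
    by_cases hQ : Q = ⊥
    · rw [if_pos hQ, splitValue, if_pos hQ, zoomFactor, if_pos hQ, hQ, partIntegral_bot]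
      ring
    · have hE := one_lt_partExponent hs hQ
      have hre : 0 < (0 : ℂ).re + b.re + partExponent s Q := by
        rw [Complex.zero_re]
        linarith
      have h2 := partIntegral_mul (K := K) hs hb hQ hre
      have h3 := pow_mul_zoomFactor hq 0 b s hQ
      have h4 : (1 : ℂ) - (Nat.card 𝓀[K] : ℂ) ^ (-(0 + b + partExponent s Q)) ≠ 0 :=
        one_sub_cpow_ne_zero one_lt_card_residue (by simpa using hre)
      rw [if_neg hQ, splitValue, if_neg hQ, ← h2]
      rw [zero_add, Complex.cpow_neg] at h3 h4
      rw [zero_add, Complex.cpow_neg]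
      have h5 : (Nat.card 𝓀[K] : ℂ) ^ (b + partExponent s Q) ≠ 0 := by
        rw [ne_eq, Complex.cpow_eq_zero_iff]
        exact fun h => hq h.1
      set Y := (Nat.card 𝓀[K] : ℂ) ^ (b + partExponent s Q) with hY
      have h6 : Y - 1 ≠ 0 := by
        intro h
        rw [sub_eq_zero] at h
        rw [h] at h4
        simp at h4
      have h7 : (Nat.card 𝓀[K] : ℂ)⁻¹ ^ #Q.parts * (Nat.card 𝓀[K] : ℂ) ^ #Q.parts = 1 := by
        rw [← mul_pow, inv_mul_cancel₀ hq, one_pow]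
      calc _ = ((Nat.card 𝓀[K] : ℂ)⁻¹ ^ #Q.parts * (Nat.card 𝓀[K] : ℂ) ^ #Q.parts) *
            ((Nat.card 𝓀[K] : ℂ)⁻¹ ^ N * (zoomFactor (Nat.card 𝓀[K]) 0 b s Q)) *
              partIntegral K 0 b s Q := by rw [h7]; ring
        _ = (Nat.card 𝓀[K] : ℂ)⁻¹ ^ #Q.parts * ((Nat.card 𝓀[K] : ℂ)⁻¹ ^ N *
            ((Nat.card 𝓀[K] : ℂ) ^ #Q.parts * zoomFactor (Nat.card 𝓀[K]) 0 b s Q)) *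
              partIntegral K 0 b s Q := by ring
        _ = _ := by
          rw [h3]
          field_simp
  rw [h1]
  have h7 : (Nat.card 𝓀[K] : ℂ)⁻¹ ^ #P.parts * (Nat.card 𝓀[K] : ℂ) ^ #P.parts = 1 := by
    rw [← mul_pow, inv_mul_cancel₀ hq, one_pow]
  calc _ = ((Nat.card 𝓀[K] : ℂ)⁻¹ ^ #P.parts * (Nat.card 𝓀[K] : ℂ) ^ #P.parts) *
        ((splitCount (Nat.card 𝓀[K]) P Q : ℂ) * ((if Q = ⊥ then 1 else
          1 / ((Nat.card 𝓀[K] : ℂ) ^ (b + partExponent s Q) - 1)) * splitValue K b s Q)) := by ring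
    _ = _ := by rw [h7]; ring

end Recursion

/-! ### Sums over strict chains -/

section Chains

variable {X : Type*} [PartialOrder X] [OrderBot X] [Fintype X] [DecidableEq X]

open scoped Classical in
/-- Strict chains of length `n` from `P` to `⊥`. -/
noncomputable def chains (n : ℕ) (P : X) : Finset (Fin (n + 1) → X) :=
  univ.filter fun f => StrictAnti f ∧ f 0 = P ∧ f (Fin.last n) = ⊥

theorem mem_chains {n : ℕ} {P : X} {f : Fin (n + 1) → X} :
    f ∈ chains n P ↔ StrictAnti f ∧ f 0 = P ∧ f (Fin.last n) = ⊥ := by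
  simp [chains]

/-- The sum over chains of the products of the weights of their steps. -/
noncomputable def chainSum (A : X → X → ℂ) (n : ℕ) (P : X) : ℂ :=
  ∑ f ∈ chains n P, ∏ i : Fin n, A (f i.castSucc) (f i.succ)

theorem chainSum_zero (A : X → X → ℂ) (P : X) : chainSum A 0 P = if P = ⊥ then 1 else 0 := by
  split_ifs with h
  · have : chains 0 P = {fun _ => ⊥} := by
      ext f
      rw [mem_chains, mem_singleton]
      constructor
      · rintro ⟨-, -, h0⟩
        ext i
        rw [Fin.fin_one_eq_zero i]
        exact h0
      · rintro rfl
        exact ⟨fun i j hij => absurd hij (by simp [Fin.fin_one_eq_zero i, Fin.fin_one_eq_zero j]),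
          h.symm, rfl⟩
    rw [chainSum, this, sum_singleton]
    simp
  · have : chains 0 P = ∅ := by
      refine eq_empty_of_forall_notMem fun f hf => h ?_
      obtain ⟨-, h1, h2⟩ := mem_chains.mp hf
      rw [← h1, ← h2]
      rfl
    rw [chainSum, this, sum_empty]

open scoped Classical in
-- Cut a chain after its first step: the tail is a chain starting at the second element.
theorem chainSum_succ (A : X → X → ℂ) (n : ℕ) (P : X) :
    chainSum A (n + 1) P = ∑ Q with Q < P, A P Q * chainSum A n Q := by
  unfold chainSum
  simp_rw [mul_sum]
  rw [sum_sigma']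
  refine sum_bij' (fun f _ => ⟨f 1, Fin.tail f⟩) (fun y _ => Fin.cons P y.2) ?_ ?_ ?_ ?_ ?_
  · intro f hf
    obtain ⟨h1, h2, h3⟩ := mem_chains.mp hf
    refine mem_sigma.mpr ⟨mem_filter.mpr ⟨mem_univ _, ?_⟩, mem_chains.mpr ⟨?_, rfl, h3⟩⟩
    · rw [← h2]
      exact h1 (by simp)
    · exact h1.comp_strictMono Fin.strictMono_succ
  · rintro ⟨Q, f⟩ hf
    obtain ⟨hQ, hf⟩ := mem_sigma.mp hf
    obtain ⟨h1, h2, h3⟩ := mem_chains.mp hf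
    have hQ := (mem_filter.mp hQ).2
    refine mem_chains.mpr ⟨?_, rfl, ?_⟩
    · refine Fin.strictAnti_iff_succ_lt.mpr fun i => ?_
      refine Fin.cases ?_ (fun j => ?_) i
      · change f 0 = Q at h2
        change Q < P at hQ
        rw [← h2] at hQ
        exact hQ
      · simpa using Fin.strictAnti_iff_succ_lt.mp h1 j
    · rw [← Fin.succ_last]
      simpa using h3
  · intro f hf
    obtain ⟨-, h2, -⟩ := mem_chains.mp hf
    rw [← h2]
    exact Fin.cons_self_tail f
  · rintro ⟨Q, f⟩ hf
    obtain ⟨-, h2, -⟩ := mem_chains.mp (mem_sigma.mp hf).2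
    dsimp only at h2 ⊢
    rw [Fin.tail_cons]
    congr 1
  · intro f hf
    obtain ⟨-, h2, -⟩ := mem_chains.mp hf
    rw [Fin.prod_univ_succ, ← h2]
    rfl

theorem chainSum_eq_zero (A : X → X → ℂ) {n : ℕ} (hn : Fintype.card X ≤ n) (P : X) :
    chainSum A n P = 0 := by
  have : chains n P = ∅ := by
    refine eq_empty_of_forall_notMem fun f hf => ?_
    have := Fintype.card_le_of_injective f (mem_chains.mp hf).1.injective
    rw [Fintype.card_fin] at this
    omega
  rw [chainSum, this, sum_empty]

open scoped Classical in
/-- A function that satisfies a triangular recursion is a sum over strict chains. -/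
theorem eq_sum_chainSum {A : X → X → ℂ} {T : X → ℂ}
    (hT : ∀ P, P ≠ ⊥ → T P = ∑ Q with Q < P, A P Q * T Q) (P : X) :
    T P = T ⊥ * ∑ n ∈ range (Fintype.card X), chainSum A n P := by
  have hG : ∀ P, ∑ n ∈ range (Fintype.card X), chainSum A n P = (if P = ⊥ then 1 else 0) +
      ∑ Q with Q < P, A P Q * ∑ n ∈ range (Fintype.card X), chainSum A n Q := by
    intro P
    -- Chains of this length would have more elements than X, so the extra term is free and makes
    -- room for the index shift.
    have h1 : ∑ n ∈ range (Fintype.card X + 1), chainSum A n P =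
        ∑ n ∈ range (Fintype.card X), chainSum A n P := by
      rw [sum_range_succ, chainSum_eq_zero A le_rfl, add_zero]
    rw [← h1, sum_range_succ', chainSum_zero, add_comm]
    congr 1
    simp_rw [chainSum_succ, mul_sum]
    exact sum_comm
  induction P using WellFoundedLT.induction with
  | ind P ih =>
  by_cases hP : P = ⊥
  · rw [hG, hP, if_pos rfl]
    simp
  · rw [hG, hT P hP, if_neg hP, zero_add, mul_sum]
    refine sum_congr rfl fun Q hQ => ?_
    rw [ih Q (mem_filter.mp hQ).2]
    ring

end Chains

/-! ### Splitting filtrations as chains -/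

section Filtrations

variable {N : ℕ}

open scoped Classical in
theorem sum_splittingFiltration {P₀ : Finpartition (univ : Finset (Fin N))} (h0 : P₀.parts = {univ})
    (F : ∀ n : ℕ, (Fin (n + 1) → Finpartition (univ : Finset (Fin N))) → ℂ) :
    ∑ S : SplittingFiltration N, F S.length S.level =
      ∑ n ∈ range (Fintype.card (Finpartition (univ : Finset (Fin N)))),
        ∑ f ∈ chains n P₀, F n f := by
  rw [sum_sigma']
  refine sum_bij (fun S _ => ⟨S.length, S.level⟩) ?_ ?_ ?_ ?_
  · intro S _
    refine mem_sigma.mpr ⟨mem_range.mpr ?_, mem_chains.mpr ⟨S.strictAnti, ?_, S.level_last⟩⟩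
    · have := Fintype.card_le_of_injective S.level S.strictAnti.injective
      rwa [Fintype.card_fin] at this
    · exact Finpartition.ext (by rw [S.level_zero, h0])
  · rintro ⟨L, f, h1, h2, h3⟩ _ ⟨L', f', h1', h2', h3'⟩ _ h
    obtain ⟨rfl, h⟩ := Sigma.mk.inj_iff.mp h
    obtain rfl := eq_of_heq h
    rfl
  · rintro ⟨n, f⟩ hf
    obtain ⟨h1, h2, h3⟩ := mem_chains.mp (mem_sigma.mp hf).2
    exact ⟨⟨n, f, h1, (congrArg Finpartition.parts h2).trans h0, h3⟩, mem_univ _, rfl⟩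
  · intro S _
    rfl

/-- Parts only shrink under refinement, so the part between two equal ones is squeezed. Consequently
the levels at which a branch is present form an interval. -/
theorem mem_parts_of_le {P Q : Finpartition (univ : Finset (Fin N))} {R} (hQR : Q ≤ R) (hRP : R ≤ P)
    {lam : Finset (Fin N)} (hP : lam ∈ P.parts) (hQ : lam ∈ Q.parts) : lam ∈ R.parts := by
  obtain ⟨i, rfl⟩ := mem_parts_iff.mp hQ
  refine mem_parts_iff.mpr ⟨i, subset_antisymm ?_ (le_iff_part_subset.mp hQR i)⟩
  rw [← part_eq_of_mem_parts hP (mem_part_self i)]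
  exact le_iff_part_subset.mp hRP i

theorem mem_parts_of_card_le_one {P Q : Finpartition (univ : Finset (Fin N))} (h : Q ≤ P)
    {lam : Finset (Fin N)} (hP : lam ∈ P.parts) (h1 : ¬ 1 < #lam) : lam ∈ Q.parts := by
  obtain ⟨i, rfl⟩ := mem_parts_iff.mp hP
  refine mem_parts_iff.mpr ⟨i, ?_⟩
  refine eq_of_subset_of_card_le (le_iff_part_subset.mp h i) ?_
  exact (not_lt.mp h1).trans (card_pos.mpr ⟨i, mem_part_self i⟩)

theorem card_of_mem_parts_bot {lam : Finset (Fin N)}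
    (h : lam ∈ (⊥ : Finpartition (univ : Finset (Fin N))).parts) : #lam = 1 := by
  obtain ⟨i, -, rfl⟩ := Finpartition.mem_bot_iff.mp h
  exact card_singleton i

/-! ### Multiplicities of filtrations, level by level -/

namespace SplittingFiltration

variable (S : SplittingFiltration N)

theorem partition_eq_level {l : ℕ} (h : l < S.length + 1) : S.partition l = S.level ⟨l, h⟩ :=
  dif_pos h

theorem partition_length : S.partition S.length = ⊥ := by
  rw [partition_eq_level S (Nat.lt_succ_self _)]
  exact S.level_last

theorem partition_lt {k l : ℕ} (hkl : k < l) (hl : l ≤ S.length) :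
    S.partition l < S.partition k := by
  rw [partition_eq_level S (by omega : l < S.length + 1),
    partition_eq_level S (by omega : k < S.length + 1)]
  exact S.strictAnti hkl

theorem partition_le {k l : ℕ} (hkl : k ≤ l) (hl : l ≤ S.length) :
    S.partition l ≤ S.partition k := by
  rcases hkl.eq_or_lt with rfl | h
  · exact le_rfl
  · exact (S.partition_lt h hl).le

theorem partition_ne_bot {l : ℕ} (h : l < S.length) : S.partition l ≠ ⊥ := by
  rw [← S.partition_length]
  exact (S.partition_lt h le_rfl).ne'

theorem prod_steps {M : Type*} [CommMonoid M]
    (A : Finpartition (univ : Finset (Fin N)) → Finpartition (univ : Finset (Fin N)) → M) :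
    ∏ i : Fin S.length, A (S.level i.castSucc) (S.level i.succ) =
      ∏ l ∈ range S.length, A (S.partition l) (S.partition (l + 1)) := by
  rw [prod_range]
  refine prod_congr rfl fun i _ => ?_
  rw [partition_eq_level S (by omega : (i : ℕ) < S.length + 1),
    partition_eq_level S (by omega : (i : ℕ) + 1 < S.length + 1)]
  rfl

theorem mem_branches {lam : Finset (Fin N)} : lam ∈ S.branches ↔
    (∃ l < S.length, lam ∈ (S.partition l).parts) ∧ 1 < #lam := by
  simp [branches]

theorem mem_partition_depth {lam : Finset (Fin N)} (h : lam ∈ S.branches) :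
    S.depth lam < S.length ∧ lam ∈ (S.partition (S.depth lam)).parts := by
  obtain ⟨⟨l, hl, hlam⟩, -⟩ := S.mem_branches.mp h
  have h1 : S.depth lam ≤ S.length - 1 := Nat.findGreatest_le _
  exact ⟨by omega, Nat.findGreatest_spec (P := fun l => lam ∈ (S.partition l).parts)
    (by omega : l ≤ S.length - 1) hlam⟩

theorem le_depth {lam : Finset (Fin N)} {l : ℕ} (hl : l < S.length)
    (h : lam ∈ (S.partition l).parts) : l ≤ S.depth lam :=
  Nat.le_findGreatest (by omega) h

/-- A branch splits only at its depth. At earlier levels where it is present it has a single child,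
and its falling factorial is the empty product 1; the same holds for singletons. So products over
branches and over levels agree. -/
theorem multiplicity_eq_prod (q : ℕ) : S.multiplicity q =
    ∏ l ∈ range S.length, splitCount q (S.partition l) (S.partition (l + 1)) := by
  classical
  have h1 : ∀ l ∈ range S.length, splitCount q (S.partition l) (S.partition (l + 1)) =
      ∏ lam ∈ S.branches, if lam ∈ (S.partition l).parts then
        (q - 1).descFactorial (partDegree (S.partition (l + 1)) lam - 1) else 1 := by
    intro l hl
    have hl := mem_range.mp hl
    rw [← prod_filter, splitCount]
    symm
    refine prod_subset (fun lam h => (mem_filter.mp h).2) fun lam hlam hnot => ?_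
    have h1 : ¬ 1 < #lam := fun h => hnot
      (mem_filter.mpr ⟨S.mem_branches.mpr ⟨⟨l, hl, hlam⟩, h⟩, hlam⟩)
    rw [partDegree_of_mem (mem_parts_of_card_le_one (S.partition_le (Nat.le_succ l) hl) hlam h1)]
    rfl
  rw [prod_congr rfl h1, prod_comm, multiplicity]
  refine prod_congr rfl fun lam hlam => ?_
  obtain ⟨hd, hmem⟩ := S.mem_partition_depth hlam
  rw [prod_eq_single (S.depth lam), if_pos hmem]
  · rfl
  · intro l hl hne
    have hl := mem_range.mp hl
    split_ifs with h
    · have hle := S.le_depth hl h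
      have h2 : lam ∈ (S.partition (l + 1)).parts := mem_parts_of_le
        (S.partition_le (by omega : l + 1 ≤ S.depth lam) hd.le)
        (S.partition_le (Nat.le_succ l) (by omega)) h hmem
      rw [partDegree_of_mem h2]
      rfl
    · rfl
  · intro h
    exact absurd (mem_range.mpr hd) h

end SplittingFiltration

/-! ### Exponents -/

theorem branchExponent_of_card_le_one (s : Pairs N → ℂ) {lam : Finset (Fin N)} (h : #lam = 1) :
    branchExponent s lam = 0 := by
  have : (univ.filter fun p : Pairs N => p.1.1 ∈ lam ∧ p.1.2 ∈ lam) = ∅ := by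
    refine filter_eq_empty_iff.mpr fun p _ hp => p.2.ne ?_
    exact card_le_one.mp h.le _ hp.1 _ hp.2
  rw [branchExponent, this, h]
  simp

/-- The sizes of the parts add up to N, and every pair inside a part is counted once, in that part.
-/
theorem sum_branchExponent (s : Pairs N → ℝ) (P : Finpartition (univ : Finset (Fin N))) :
    ∑ lam ∈ P.parts, branchExponent (fun p => (s p : ℂ)) lam = (partExponent s P : ℂ) := by
  have h1 : ∑ lam ∈ P.parts, ((#lam : ℂ) - 1) = N - #P.parts := by
    rw [sum_sub_distrib, sum_const, nsmul_eq_mul, mul_one, ← Nat.cast_sum, P.sum_card_parts,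
      card_univ, Fintype.card_fin]
  have h2 : ∑ lam ∈ P.parts, ∑ p : Pairs N with p.1.1 ∈ lam ∧ p.1.2 ∈ lam, (s p : ℂ) =
      ∑ p ∈ samePairs P, (s p : ℂ) := by
    rw [← sum_fiberwise_of_maps_to (s := samePairs P) (t := P.parts) (g := fun p => P.part p.1.1)
      (fun p _ => part_mem_parts _)]
    refine sum_congr rfl fun lam hlam => sum_congr ?_ fun _ _ => rfl
    ext p
    rw [mem_filter, mem_filter, mem_samePairs]
    constructor
    · rintro ⟨-, h1, h2⟩
      rw [part_eq_of_mem_parts hlam h1, part_eq_of_mem_parts hlam h2]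
      exact ⟨rfl, rfl⟩
    · rintro ⟨h1, h2⟩
      exact ⟨mem_univ _, h2 ▸ mem_part_self _, h2 ▸ h1 ▸ mem_part_self _⟩
  simp only [branchExponent, sum_add_distrib, h1, h2, partExponent]
  push_cast
  rfl

theorem SplittingFiltration.levelExponent_eq (S : SplittingFiltration N) (s : Pairs N → ℝ) {l : ℕ}
    (hl : l < S.length) :
    S.levelExponent (fun p => (s p : ℂ)) l = (partExponent s (S.partition l) : ℂ) := by
  rw [levelExponent, ← sum_branchExponent]
  refine sum_subset inter_subset_right fun lam hlam hnot => ?_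
  refine branchExponent_of_card_le_one _ (le_antisymm (not_lt.mp fun h => hnot ?_) ?_)
  · exact mem_inter.mpr ⟨S.mem_branches.mpr ⟨⟨l, hl, hlam⟩, h⟩, hlam⟩
  · exact card_pos.mpr ((S.partition l).nonempty_of_mem_parts hlam)

theorem SplittingFiltration.length_pos (hN : 2 ≤ N) (S : SplittingFiltration N) : 0 < S.length := by
  refine Nat.pos_of_ne_zero fun h => ?_
  have h1 : (S.partition 0).parts = {univ} := by
    rw [S.partition_eq_level (Nat.succ_pos _)]
    exact S.level_zero
  have h2 := S.partition_length
  rw [h] at h2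
  have h3 := card_of_mem_parts_bot (h2 ▸ h1 ▸ mem_singleton_self univ)
  rw [card_univ, Fintype.card_fin] at h3
  omega

open scoped Classical in
/-- The sum of level functions is a chain sum. -/
theorem levelSum_eq (hN : 2 ≤ N) {P₀ : Finpartition (univ : Finset (Fin N))}
    (h0 : P₀.parts = {univ}) (q : ℕ) (b : ℂ) (s : Pairs N → ℝ) :
    levelSum q b (fun p => (s p : ℂ)) = ((q : ℂ) ^ (N - 1))⁻¹ *
      ∑ n ∈ range (Fintype.card (Finpartition (univ : Finset (Fin N)))),
        chainSum (fun P Q => (splitCount q P Q : ℂ) *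
          (if Q = ⊥ then 1 else 1 / ((q : ℂ) ^ (b + partExponent s Q) - 1))) n P₀ := by
  unfold chainSum
  rw [← sum_splittingFiltration h0 (fun n f => ∏ i : Fin n, (splitCount q (f i.castSucc) (f i.succ) : ℂ) *
    (if f i.succ = ⊥ then 1 else 1 / ((q : ℂ) ^ (b + partExponent s (f i.succ)) - 1))), levelSum,
    sum_filter, mul_sum]
  refine sum_congr rfl fun S _ => ?_
  rw [S.prod_steps fun P Q => (splitCount q P Q : ℂ) *
    (if Q = ⊥ then 1 else 1 / ((q : ℂ) ^ (b + partExponent s Q) - 1)), prod_mul_distrib,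
    ← Nat.cast_prod, ← S.multiplicity_eq_prod]
  -- The step from level l to l + 1 carries the factor of its target. Level 0 is never a target, and
  -- the last target is ⊥ with factor 1, so levels 1 to L - 1 remain.
  have h1 : ∏ l ∈ range S.length, (if S.partition (l + 1) = ⊥ then (1 : ℂ) else
      1 / ((q : ℂ) ^ (b + partExponent s (S.partition (l + 1))) - 1)) =
      ∏ l ∈ Ico 1 S.length, 1 / ((q : ℂ) ^ (b + S.levelExponent (fun p => (s p : ℂ)) l) - 1) := by
    obtain ⟨L, hL⟩ := Nat.exists_eq_add_of_le' (S.length_pos hN)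
    replace hL : S.length = L + 1 := hL
    have hlast := S.partition_length
    rw [hL] at hlast ⊢
    rw [prod_range_succ, hlast, if_pos rfl, mul_one, prod_Ico_eq_prod_range, Nat.add_sub_cancel]
    refine prod_congr rfl fun l hl => ?_
    have hl := mem_range.mp hl
    rw [if_neg (S.partition_ne_bot (by omega)), add_comm 1 l, S.levelExponent_eq s (by omega)]
  rw [h1, SplittingFiltration.levelFunction]
  split_ifs with h
  · ring
  · rw [Nat.eq_zero_of_not_pos h]
    simp

end Filtrations

/-! ### Integrals over configurations with prescribed diameters -/

section Reduced

variable {K : Type*} [Field K] [ValuativeRel K] [TopologicalSpace K] [IsNonarchimedeanLocalField K]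
  [MeasurableSpace K] [BorelSpace K] {N : ℕ}

/-- The pairs inside a set of indices. -/
def pairsIn (lam : Finset (Fin N)) : Finset (Pairs N) :=
  univ.filter fun p => p.1.1 ∈ lam ∧ p.1.2 ∈ lam

theorem mem_pairsIn {lam : Finset (Fin N)} {p : Pairs N} :
    p ∈ pairsIn lam ↔ p.1.1 ∈ lam ∧ p.1.2 ∈ lam := by
  simp [pairsIn]

theorem exists_mem_pairsIn {lam : Finset (Fin N)} {i j : Fin N} (hi : i ∈ lam) (hj : j ∈ lam)
    (hij : i ≠ j) {κ : Type*} (c : Fin N → κ) (hc : c i ≠ c j) :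
    ∃ p ∈ pairsIn lam, c p.1.1 ≠ c p.1.2 := by
  rcases lt_or_gt_of_ne hij with h | h
  · exact ⟨⟨(i, j), h⟩, mem_pairsIn.mpr ⟨hi, hj⟩, hc⟩
  · exact ⟨⟨(j, i), h⟩, mem_pairsIn.mpr ⟨hj, hi⟩, hc.symm⟩

theorem pairsIn_nonempty {lam : Finset (Fin N)} (h : 1 < #lam) : (pairsIn lam).Nonempty := by
  obtain ⟨i, hi, j, hj, hij⟩ := one_lt_card.mp h
  obtain ⟨p, hp, -⟩ := exists_mem_pairsIn hi hj hij id hij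
  exact ⟨p, hp⟩

/-- The configurations in the unit ball for which the points indexed by `lam` have diameter one. -/
def diamOne (K : Type*) [Field K] [ValuativeRel K] [TopologicalSpace K]
    [IsNonarchimedeanLocalField K] [MeasurableSpace K] [BorelSpace K] (lam : Finset (Fin N)) :
    Set (Fin N → K) :=
  {x | maxOn (pairsIn lam) (pairDist x) = 1}

theorem measurableSet_diamOne (lam : Finset (Fin N)) : MeasurableSet (diamOne K lam) :=
  measurable_maxOn (pairsIn lam) (measurableSet_singleton 1)

/-- Diameter 1 can be read off from residues: some pair must be separated, as contracted pairs are
at distance at most q⁻¹ < 1. -/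
theorem zoom_mem_diamOne_iff {A lam : Finset (Fin N)} (hA : lam ⊆ A) (hlam : 1 < #lam)
    {x : Fin N → K} (hx : ∀ i, x i ∈ (𝒪[K] : Set K)) (c : Fin N → 𝓀[K]) :
    zoom A c x ∈ diamOne K lam ↔ ¬ ∀ i ∈ lam, ∀ j ∈ lam, c i = c j := by
  classical
  have hd : ∀ p ∈ pairsIn lam, pairDist (zoom A c x) p =
      if c p.1.1 = c p.1.2 then (Nat.card 𝓀[K] : ℝ≥0)⁻¹ * pairDist x p else 1 := fun p hp =>
    pairDist_zoom hx c (hA (mem_pairsIn.mp hp).1) (hA (mem_pairsIn.mp hp).2)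
  have hq : (Nat.card 𝓀[K] : ℝ≥0)⁻¹ < 1 :=
    inv_lt_one_of_one_lt₀ (by exact_mod_cast one_lt_card_residue)
  have hne := pairsIn_nonempty hlam
  constructor
  · intro h hc
    obtain ⟨p, hp, hp'⟩ := exists_maxOn (d := pairDist (zoom A c x)) hne
    have h1 : maxOn (pairsIn lam) (pairDist (zoom A c x)) = 1 := h
    rw [hp', hd p hp, if_pos (hc _ (mem_pairsIn.mp hp).1 _ (mem_pairsIn.mp hp).2)] at h1
    exact (lt_of_le_of_lt (mul_le_of_le_one_right zero_le (pairDist_le_one hx p)) hq).ne h1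
  · intro hc
    push Not at hc
    obtain ⟨i, hi, j, hj, hij⟩ := hc
    obtain ⟨p, hp, hpc⟩ := exists_mem_pairsIn hi hj (fun h => hij (by rw [h])) c hij
    refine le_antisymm ?_ ?_
    · obtain ⟨p, hp, hp'⟩ := exists_maxOn (d := pairDist (zoom A c x)) hne
      rw [hp', hd p hp]
      split_ifs
      · exact mul_le_one' hq.le (pairDist_le_one hx p)
      · exact le_rfl
    · refine le_trans ?_ (le_maxOn hp)
      rw [hd p hp, if_neg hpc]

theorem zoom_mem_diamOne_iff_of_disjoint {A lam : Finset (Fin N)} (hA : Disjoint lam A)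
    {x : Fin N → K} (c : Fin N → 𝓀[K]) : zoom A c x ∈ diamOne K lam ↔ x ∈ diamOne K lam := by
  have : maxOn (pairsIn lam) (pairDist (zoom A c x)) = maxOn (pairsIn lam) (pairDist x) :=
    maxOn_congr fun p hp => pairDist_zoom_of_notMem c
      (disjoint_left.mp hA (mem_pairsIn.mp hp).1) (disjoint_left.mp hA (mem_pairsIn.mp hp).2)
  change _ = _ ↔ _ = _
  rw [this]

theorem partWeight_zero_zero (s : Pairs N → ℝ) (P : Finpartition (univ : Finset (Fin N)))
    (x : Fin N → K) :
    partWeight 0 0 s P x = ∏ p ∈ samePairs P, ((pairDist x p : ℝ) : ℂ) ^ (s p : ℂ) := by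
  simp [partWeight, pairWeight]

theorem pairsIn_subset_samePairs {P : Finpartition (univ : Finset (Fin N))} {lam : Finset (Fin N)}
    (hlam : lam ∈ P.parts) : pairsIn lam ⊆ samePairs P := fun p hp => by
  rw [mem_pairsIn] at hp
  rw [mem_samePairs, part_eq_of_mem_parts hlam hp.1, part_eq_of_mem_parts hlam hp.2]

/-- Magnifying one part also changes its distances to the other parts, but the weight does not see
pairs across parts. -/
theorem partWeight_zoom_block (s : Pairs N → ℝ) {P : Finpartition (univ : Finset (Fin N))}
    {lam : Finset (Fin N)} (hlam : lam ∈ P.parts) {x : Fin N → K}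
    (hx : ∀ i, x i ∈ (𝒪[K] : Set K)) {c : Fin N → 𝓀[K]} (hc : ∀ i ∈ lam, ∀ j ∈ lam, c i = c j) :
    partWeight 0 0 s P (zoom lam c x) =
      (Nat.card 𝓀[K] : ℂ) ^ (-∑ p ∈ pairsIn lam, (s p : ℂ)) * partWeight 0 0 s P x := by
  classical
  rw [← inv_natCast_cpow, cpow_sum (by simp),
    ← inter_eq_right.mpr (pairsIn_subset_samePairs hlam), ← prod_ite_mem, partWeight_zero_zero,
    partWeight_zero_zero, ← prod_mul_distrib]
  refine prod_congr rfl fun p hp => ?_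
  split_ifs with h
  · have h' := mem_pairsIn.mp h
    rw [pairDist_zoom hx c h'.1 h'.2, if_pos (hc _ h'.1 _ h'.2), coe_mul_cpow]
  · have h1 := mem_samePairs.mp hp
    have h2 : ∀ i j, P.part i = P.part j → i ∈ lam → j ∈ lam := fun i j hij hi => by
      rw [← part_eq_of_mem_parts hlam hi, hij]
      exact mem_part_self j
    rw [pairDist_zoom_of_notMem c (fun h3 => h (mem_pairsIn.mpr ⟨h3, h2 _ _ h1 h3⟩))
      (fun h3 => h (mem_pairsIn.mpr ⟨h2 _ _ h1.symm h3, h3⟩)), one_mul]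

open scoped Classical in
theorem card_constant_on {κ : Type*} [Fintype κ] {lam : Finset (Fin N)} (hlam : lam.Nonempty) :
    #{c : Fin N → κ | ∀ i ∈ lam, ∀ j ∈ lam, c i = c j} = Fintype.card κ ^ (N - #lam + 1) := by
  obtain ⟨i₀, hi₀⟩ := hlam
  let e : {c : Fin N → κ // ∀ i ∈ lam, ∀ j ∈ lam, c i = c j} ≃
      ((insert i₀ lamᶜ : Finset (Fin N)) → κ) :=
    { toFun := fun c j => c.1 j
      invFun := fun g => ⟨fun i => if h : i ∈ lam then g ⟨i₀, mem_insert_self _ _⟩ else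
        g ⟨i, mem_insert_of_mem (mem_compl.mpr h)⟩, fun i hi j hj => by simp only [dif_pos hi, dif_pos hj]⟩
      left_inv := fun c => Subtype.ext (funext fun i => by
        dsimp only
        split_ifs with h
        · exact c.2 _ hi₀ _ h
        · rfl)
      right_inv := fun g => funext fun j => by
        dsimp only
        split_ifs with h
        · congr 1
          have := mem_insert.mp j.2
          rw [mem_compl] at this
          exact Subtype.ext (this.resolve_right fun h' => h' h).symm
        · rfl }
  rw [← Fintype.card_subtype, Fintype.card_congr e, Fintype.card_fun, Fintype.card_coe,
    card_insert_of_notMem (by simpa using hi₀), card_compl, Fintype.card_fin]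

open scoped Classical in
/-- The integral of the weight over the configurations for which the parts in `A` have
diameter one. -/
noncomputable def diamIntegral (K : Type*) [Field K] [ValuativeRel K] [TopologicalSpace K]
    [IsNonarchimedeanLocalField K] [MeasurableSpace K] [BorelSpace K] (s : Pairs N → ℝ)
    (P : Finpartition (univ : Finset (Fin N))) (A : Finset (Finset (Fin N))) : ℂ :=
  ∫ x, Set.indicator (⋂ lam ∈ A, diamOne K lam) (partWeight 0 0 s P) x ∂cubeMeasure K N

theorem measurableSet_diamOnes (A : Finset (Finset (Fin N))) :
    MeasurableSet (⋂ lam ∈ A, diamOne K lam) :=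
  Finset.measurableSet_biInter _ fun lam _ => measurableSet_diamOne lam

theorem integrable_partWeight_zero {s : Pairs N → ℝ} (hs : ∀ p, 0 < s p)
    (P : Finpartition (univ : Finset (Fin N))) :
    Integrable (partWeight 0 0 s P) (cubeMeasure K N) :=
  integrable_partWeight hs (by simp) fun hP => by
    have := one_lt_partExponent hs hP
    simp only [Complex.zero_re]
    linarith

open scoped Classical in
-- Split according to whether `lam` has diameter 1. Configurations where it does not are contracted
-- on `lam` alone; this leaves the diameters of the disjoint parts in A unchanged, so their integral
-- is q^(-e) times the integral without the condition on `lam`.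
theorem diamIntegral_insert {s : Pairs N → ℝ} (hs : ∀ p, 0 < s p)
    {P : Finpartition (univ : Finset (Fin N))} {A : Finset (Finset (Fin N))} (hA : A ⊆ P.parts)
    {lam : Finset (Fin N)} (hlam : lam ∈ P.parts) (hlamA : lam ∉ A) (h1 : 1 < #lam) :
    diamIntegral K s P (insert lam A) =
      (1 - (Nat.card 𝓀[K] : ℂ) ^ (-branchExponent (fun p => (s p : ℂ)) lam)) *
        diamIntegral K s P A := by
  have hI := integrable_partWeight_zero (K := K) hs P
  have hIA := hI.indicator (measurableSet_diamOnes A)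
  set E : Set (Fin N → K) := ⋂ lam ∈ A, diamOne K lam with hE
  have hEm : MeasurableSet E := measurableSet_diamOnes A
  have hDm := measurableSet_diamOne (K := K) lam
  have hins : (⋂ mu ∈ insert lam A, diamOne K mu) = diamOne K lam ∩ E :=
    Finset.set_biInter_insert lam A _
  have hsplit : diamIntegral K s P A = diamIntegral K s P (insert lam A) +
      ∫ x, Set.indicator (E \ diamOne K lam) (partWeight 0 0 s P) x ∂cubeMeasure K N := by
    rw [diamIntegral, diamIntegral, hins, ← hE, ← integral_add (hI.indicator (hDm.inter hEm))
      (hI.indicator (hEm.diff hDm))]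
    refine integral_congr_ae (Filter.Eventually.of_forall fun x => ?_)
    by_cases h2 : x ∈ E <;> by_cases h3 : x ∈ diamOne K lam <;> simp [Set.indicator, h2, h3]
  have hzoom : ∫ x, Set.indicator (E \ diamOne K lam) (partWeight 0 0 s P) x ∂cubeMeasure K N =
      (Nat.card 𝓀[K] : ℂ) ^ (-branchExponent (fun p => (s p : ℂ)) lam) *
        diamIntegral K s P A := by
    have hz : ∀ c : Fin N → 𝓀[K],
        ∫ x, Set.indicator (E \ diamOne K lam) (partWeight 0 0 s P) (zoom lam c x) ∂cubeMeasure K N =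
        if ∀ i ∈ lam, ∀ j ∈ lam, c i = c j then
          (Nat.card 𝓀[K] : ℂ) ^ (-∑ p ∈ pairsIn lam, (s p : ℂ)) * diamIntegral K s P A else 0 := by
      intro c
      split_ifs with hc
      · rw [diamIntegral, ← integral_const_mul]
        refine integral_congr_ae ?_
        filter_upwards [ae_mem_integers (K := K) (N := N)] with x hx
        have h2 : zoom lam c x ∉ diamOne K lam := fun h =>
          (zoom_mem_diamOne_iff (Subset.refl _) h1 hx c).mp h hc
        have h3 : zoom lam c x ∈ E ↔ x ∈ E := by
          rw [hE, Set.mem_iInter₂, Set.mem_iInter₂]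
          refine forall₂_congr fun mu hmu => zoom_mem_diamOne_iff_of_disjoint ?_ c
          exact P.disjoint (hA hmu) hlam (fun h => hlamA (h ▸ hmu))
        by_cases h4 : x ∈ E
        · rw [Set.indicator_of_mem (show zoom lam c x ∈ E \ diamOne K lam from ⟨h3.mpr h4, h2⟩),
            Set.indicator_of_mem h4, partWeight_zoom_block s hlam hx hc]
        · rw [Set.indicator_of_notMem (fun h => h4 (h3.mp h.1)), Set.indicator_of_notMem h4, mul_zero]
      · rw [← integral_zero (Fin N → K) ℂ (μ := cubeMeasure K N)]
        refine integral_congr_ae ?_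
        filter_upwards [ae_mem_integers (K := K) (N := N)] with x hx
        exact Set.indicator_of_notMem
          (fun h => h.2 ((zoom_mem_diamOne_iff (Subset.refl _) h1 hx c).mpr hc)) _
    have hq := card_residue_complex_ne_zero (K := K)
    have hcard : #lam ≤ N := by simpa using card_le_univ lam
    -- Counting: q⁻ᴺ times the q^(N-#lam+1) residue patterns constant on `lam` is q^(-(#lam-1)), the
    -- combinatorial part of the branch exponent.
    rw [integral_zoom lam (hI.indicator (hEm.diff hDm)), sum_congr rfl fun c _ => hz c, ← sum_filter,
      sum_const, card_constant_on (card_pos.mp (by omega)), nsmul_eq_mul, branchExponent,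
      ← Nat.card_eq_fintype_card, ← mul_assoc, ← mul_assoc]
    congr 1
    rw [neg_add, Complex.cpow_add _ _ hq]
    congr 1
    push_cast
    rw [inv_pow, ← Complex.cpow_natCast, ← Complex.cpow_natCast, ← Complex.cpow_neg,
      ← Complex.cpow_add _ _ hq]
    congr 1
    push_cast [Nat.cast_sub hcard]
    ring
  rw [hzoom] at hsplit
  linear_combination -hsplit

/-! ### Recursion when every nonsingleton part is split -/

/-- The parts with more than one element. -/
def bigParts (P : Finpartition (univ : Finset (Fin N))) : Finset (Finset (Fin N)) :=
  P.parts.filter fun lam => 1 < #lam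

theorem mem_bigParts {P : Finpartition (univ : Finset (Fin N))} {lam : Finset (Fin N)} :
    lam ∈ bigParts P ↔ lam ∈ P.parts ∧ 1 < #lam := mem_filter

theorem diamIntegral_eq {s : Pairs N → ℝ} (hs : ∀ p, 0 < s p)
    (P : Finpartition (univ : Finset (Fin N))) :
    diamIntegral K s P (bigParts P) = (∏ lam ∈ bigParts P,
      (1 - (Nat.card 𝓀[K] : ℂ) ^ (-branchExponent (fun p => (s p : ℂ)) lam))) *
        partIntegral K 0 0 s P := by
  classical
  suffices h : ∀ A ⊆ bigParts P, diamIntegral K s P A = (∏ lam ∈ A,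
      (1 - (Nat.card 𝓀[K] : ℂ) ^ (-branchExponent (fun p => (s p : ℂ)) lam))) *
        partIntegral K 0 0 s P from h _ (Subset.refl _)
  intro A
  induction A using Finset.induction_on with
  | empty =>
    intro _
    simp [diamIntegral, partIntegral]
  | insert lam A hlam ih =>
    intro hA
    have h1 := mem_bigParts.mp (hA (mem_insert_self _ _))
    have h2 : A ⊆ bigParts P := (subset_insert _ _).trans hA
    rw [diamIntegral_insert hs (h2.trans (filter_subset _ _)) h1.1 hlam h1.2, ih h2,
      prod_insert hlam, mul_assoc]

/-- Every part of `P` with more than one element is split in `Q`. -/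
def SplitsAll (P Q : Finpartition (univ : Finset (Fin N))) : Prop :=
  ∀ lam ∈ bigParts P, lam ∉ Q.parts

theorem mem_parts_refineBy_iff {κ : Type*} {P : Finpartition (univ : Finset (Fin N))}
    {lam : Finset (Fin N)} (hlam : lam ∈ P.parts) (c : Fin N → κ) :
    lam ∈ (refineBy P c).parts ↔ ∀ i ∈ lam, ∀ j ∈ lam, c i = c j := by
  constructor
  · intro h i hi j hj
    have h1 : (refineBy P c).part i = (refineBy P c).part j := by
      rw [part_eq_of_mem_parts h hi, part_eq_of_mem_parts h hj]
    exact (part_refineBy_eq_iff.mp h1).2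
  · intro h
    obtain ⟨i, rfl⟩ := mem_parts_iff.mp hlam
    refine mem_parts_iff.mpr ⟨i, ?_⟩
    ext j
    rw [mem_part_iff, mem_part_iff, part_refineBy_eq_iff]
    exact ⟨fun h' => h'.1, fun h' => ⟨h', h _ (mem_part_iff.mpr h') _ (mem_part_self i)⟩⟩

theorem bigParts_nonempty {P : Finpartition (univ : Finset (Fin N))} (hP : P ≠ ⊥) :
    (bigParts P).Nonempty := by
  obtain ⟨p, hp⟩ := samePairs_nonempty_iff.mpr hP
  refine ⟨P.part p.1.1, mem_bigParts.mpr ⟨part_mem_parts _, one_lt_card.mpr ?_⟩⟩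
  exact ⟨p.1.1, mem_part_self _, p.1.2, mem_part_iff.mpr (mem_samePairs.mp hp).symm, p.2.ne⟩

theorem bigParts_bot : bigParts (⊥ : Finpartition (univ : Finset (Fin N))) = ∅ :=
  filter_eq_empty_iff.mpr fun _ h => by rw [card_of_mem_parts_bot h]; exact lt_irrefl 1

open scoped Classical in
-- For residues c, the diameter conditions hold exactly when the refinement by c splits every
-- nonsingleton part. Thus the unrefined term is absent and nothing needs to be moved to the left.
theorem diamIntegral_eq_sum {s : Pairs N → ℝ} (hs : ∀ p, 0 < s p)
    {P : Finpartition (univ : Finset (Fin N))} (hP : P ≠ ⊥) :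
    diamIntegral K s P (bigParts P) = ∑ Q with Q < P, (Nat.card 𝓀[K] : ℂ) ^ #P.parts *
      ((Nat.card 𝓀[K] : ℂ)⁻¹ ^ N * (splitCount (Nat.card 𝓀[K]) P Q : ℂ) *
        (if SplitsAll P Q then zoomFactor (Nat.card 𝓀[K]) 0 0 s Q * partIntegral K 0 0 s Q else 0)) := by
  have hI := (integrable_partWeight_zero (K := K) hs P).indicator
    (measurableSet_diamOnes (bigParts P))
  set g : Finpartition (univ : Finset (Fin N)) → ℂ := fun Q =>
    if SplitsAll P Q then zoomFactor (Nat.card 𝓀[K]) 0 0 s Q * partIntegral K 0 0 s Q else 0 with hg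
  have h1 : diamIntegral K s P (bigParts P) = (Nat.card 𝓀[K] : ℂ)⁻¹ ^ N *
      ∑ c : Fin N → 𝓀[K], g (refineBy P c) := by
    rw [diamIntegral, integral_zoom univ hI]
    congr 1
    refine sum_congr rfl fun c _ => ?_
    have hmem : ∀ x : Fin N → K, (∀ i, x i ∈ (𝒪[K] : Set K)) →
        (zoom univ c x ∈ (⋂ lam ∈ bigParts P, diamOne K lam) ↔ SplitsAll P (refineBy P c)) := by
      intro x hx
      rw [Set.mem_iInter₂]
      refine forall₂_congr fun lam hlam => ?_
      rw [zoom_mem_diamOne_iff (subset_univ _) (mem_bigParts.mp hlam).2 hx,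
        mem_parts_refineBy_iff (mem_bigParts.mp hlam).1]
    rw [hg]
    dsimp only
    split_ifs with h
    · rw [partIntegral, ← integral_const_mul]
      refine integral_congr_ae ?_
      filter_upwards [ae_mem_integers (K := K) (N := N)] with x hx
      rw [Set.indicator_of_mem ((hmem x hx).mpr h), partWeight_zoom 0 0 s hP hx c]
      simp
    · rw [← integral_zero (Fin N → K) ℂ (μ := cubeMeasure K N)]
      refine integral_congr_ae ?_
      filter_upwards [ae_mem_integers (K := K) (N := N)] with x hx
      exact Set.indicator_of_notMem (fun h' => h ((hmem x hx).mp h')) _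
  have h2 : (univ.filter fun Q => Q ≤ P) = insert P (univ.filter fun Q => Q < P) := by
    ext Q
    simp [le_iff_eq_or_lt]
  have h3 : g P = 0 := by
    refine if_neg fun h => ?_
    obtain ⟨lam, hlam⟩ := bigParts_nonempty hP
    exact h lam hlam (mem_bigParts.mp hlam).1
  rw [h1, sum_refineBy, h2, sum_insert (by simp), h3, mul_zero, zero_add, mul_sum,
    ← Nat.card_eq_fintype_card]
  refine sum_congr rfl fun Q _ => ?_
  rw [hg]
  ring

theorem prod_cpow_branchExponent {q : ℕ} (hq : (q : ℂ) ≠ 0) (s : Pairs N → ℝ)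
    (P : Finpartition (univ : Finset (Fin N))) :
    ∏ lam ∈ bigParts P, (q : ℂ) ^ (-branchExponent (fun p => (s p : ℂ)) lam) =
      (q : ℂ) ^ (-(partExponent s P : ℂ)) := by
  rw [← cpow_sum hq, sum_neg_distrib, ← sum_branchExponent]
  congr 2
  refine sum_subset (filter_subset _ _) fun lam hlam hnot => branchExponent_of_card_le_one _ ?_
  refine le_antisymm (not_lt.mp fun h => hnot (mem_bigParts.mpr ⟨hlam, h⟩)) ?_
  exact card_pos.mpr (P.nonempty_of_mem_parts hlam)

theorem branchExponent_re_pos {s : Pairs N → ℝ} (hs : ∀ p, 0 < s p) {lam : Finset (Fin N)}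
    (h : 1 < #lam) : 0 < (branchExponent (fun p => (s p : ℂ)) lam).re := by
  rw [branchExponent]
  have h1 : (1 : ℝ) < #lam := by exact_mod_cast h
  have h2 : 0 ≤ ∑ p : Pairs N with p.1.1 ∈ lam ∧ p.1.2 ∈ lam, s p :=
    sum_nonneg fun p _ => (hs p).le
  simp only [Complex.add_re, Complex.sub_re, Complex.natCast_re, Complex.one_re, Complex.re_sum,
    Complex.ofReal_re]
  linarith

/-- The normalized integral over configurations with all parts of diameter one. -/
noncomputable def diamValue (K : Type*) [Field K] [ValuativeRel K] [TopologicalSpace K]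
    [IsNonarchimedeanLocalField K] [MeasurableSpace K] [BorelSpace K] (s : Pairs N → ℝ)
    (P : Finpartition (univ : Finset (Fin N))) : ℂ :=
  (Nat.card 𝓀[K] : ℂ)⁻¹ ^ #P.parts * diamIntegral K s P (bigParts P)

theorem diamValue_bot (s : Pairs N → ℝ) : diamValue K s ⊥ = (Nat.card 𝓀[K] : ℂ)⁻¹ ^ N := by
  rw [diamValue, bigParts_bot, Finpartition.card_bot, card_univ, Fintype.card_fin]
  have : diamIntegral K s ⊥ ∅ = partIntegral K 0 0 s ⊥ := by simp [diamIntegral, partIntegral]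
  rw [this, partIntegral_bot, mul_one]

open scoped Classical in
-- The integral at Q without diameter conditions is the one with them divided by ∏ (1 - q^(-e)).
-- Magnification supplies q^(-E_Q) = ∏ q^(-e), so the quotient is a product of factors 1/(q^e - 1),
-- one for each branch instead of one for each level.
theorem diamValue_eq_sum {s : Pairs N → ℝ} (hs : ∀ p, 0 < s p)
    {P : Finpartition (univ : Finset (Fin N))} (hP : P ≠ ⊥) :
    diamValue K s P = ∑ Q with Q < P, (if SplitsAll P Q then
      (splitCount (Nat.card 𝓀[K]) P Q : ℂ) * ∏ lam ∈ bigParts Q,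
        1 / ((Nat.card 𝓀[K] : ℂ) ^ branchExponent (fun p => (s p : ℂ)) lam - 1) else 0) *
        diamValue K s Q := by
  have hq := card_residue_complex_ne_zero (K := K)
  rw [diamValue, diamIntegral_eq_sum hs hP, mul_sum]
  refine sum_congr rfl fun Q _ => ?_
  have h7 : ∀ n : ℕ, (Nat.card 𝓀[K] : ℂ)⁻¹ ^ n * (Nat.card 𝓀[K] : ℂ) ^ n = 1 := fun n => by
    rw [← mul_pow, inv_mul_cancel₀ hq, one_pow]
  rw [← mul_assoc, h7, one_mul]
  split_ifs with h
  · have h1 : (Nat.card 𝓀[K] : ℂ)⁻¹ ^ N * ((Nat.card 𝓀[K] : ℂ) ^ #Q.parts *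
        zoomFactor (Nat.card 𝓀[K]) 0 0 s Q) = (Nat.card 𝓀[K] : ℂ) ^ (-(partExponent s Q : ℂ)) := by
      by_cases hQ : Q = ⊥
      · subst hQ
        rw [zoomFactor, if_pos rfl, Finpartition.card_bot, card_univ, Fintype.card_fin,
          mul_one, h7, ← prod_cpow_branchExponent hq, bigParts_bot, prod_empty]
      · rw [pow_mul_zoomFactor hq 0 0 s hQ]
        simp
    have h2 : (∏ lam ∈ bigParts Q,
          1 / ((Nat.card 𝓀[K] : ℂ) ^ branchExponent (fun p => (s p : ℂ)) lam - 1)) *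
        ∏ lam ∈ bigParts Q,
          (1 - (Nat.card 𝓀[K] : ℂ) ^ (-branchExponent (fun p => (s p : ℂ)) lam)) =
        (Nat.card 𝓀[K] : ℂ) ^ (-(partExponent s Q : ℂ)) := by
      rw [← prod_cpow_branchExponent hq, ← prod_mul_distrib]
      refine prod_congr rfl fun lam hlam => ?_
      have h3 := one_sub_cpow_ne_zero (one_lt_card_residue (K := K))
        (branchExponent_re_pos hs (mem_bigParts.mp hlam).2)
      rw [Complex.cpow_neg] at h3 ⊢
      have h5 : (Nat.card 𝓀[K] : ℂ) ^ branchExponent (fun p => (s p : ℂ)) lam ≠ 0 := by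
        rw [ne_eq, Complex.cpow_eq_zero_iff]
        exact fun h => hq h.1
      set Y := (Nat.card 𝓀[K] : ℂ) ^ branchExponent (fun p => (s p : ℂ)) lam with hY
      have h6 : Y - 1 ≠ 0 := by
        intro h
        rw [sub_eq_zero] at h
        rw [h] at h3
        simp at h3
      field_simp
    have h8 := h7 (#Q.parts)
    rw [diamValue, diamIntegral_eq hs]
    linear_combination (splitCount (Nat.card 𝓀[K]) P Q : ℂ) * partIntegral K 0 0 s Q *
      (-(Nat.card 𝓀[K] : ℂ)⁻¹ ^ #Q.parts * h2 + (Nat.card 𝓀[K] : ℂ)⁻¹ ^ #Q.parts * h1 -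
        (Nat.card 𝓀[K] : ℂ)⁻¹ ^ N * zoomFactor (Nat.card 𝓀[K]) 0 0 s Q * h8)
  · ring

end Reduced

/-! ### Reduced filtrations as chains -/

section BranchSum

variable {N : ℕ}

namespace SplittingFiltration

variable (S : SplittingFiltration N)

theorem mem_branches_of_mem_bigParts {l : ℕ} (hl : l < S.length) {lam : Finset (Fin N)}
    (h : lam ∈ bigParts (S.partition l)) : lam ∈ S.branches :=
  S.mem_branches.mpr ⟨⟨l, hl, (mem_bigParts.mp h).1⟩, (mem_bigParts.mp h).2⟩

theorem lt_length_of_mem_bigParts {l : ℕ} (hl : l ≤ S.length) {lam : Finset (Fin N)}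
    (h : lam ∈ bigParts (S.partition l)) : l < S.length := by
  refine lt_of_le_of_ne hl fun h' => ?_
  rw [h', S.partition_length, bigParts_bot] at h
  exact absurd h (notMem_empty _)

/-- Because presence of a branch is an interval of levels, uniqueness of its level only has to be
tested between consecutive levels. -/
theorem isReduced_iff : S.IsReduced ↔
    ∀ l < S.length, SplitsAll (S.partition l) (S.partition (l + 1)) := by
  constructor
  · intro h l hl lam hlam hlam'
    have h1 := mem_bigParts.mp hlam
    have h2 : lam ∈ bigParts (S.partition (l + 1)) := mem_bigParts.mpr ⟨hlam', h1.2⟩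
    have h3 := (h lam (S.mem_branches_of_mem_bigParts hl hlam)).unique ⟨hl, h1.1⟩
      ⟨S.lt_length_of_mem_bigParts hl h2, hlam'⟩
    omega
  · intro h lam hlam
    obtain ⟨⟨l, hl, hmem⟩, h1⟩ := S.mem_branches.mp hlam
    have key : ∀ k m : ℕ, k < m → m < S.length → lam ∈ (S.partition k).parts →
        lam ∉ (S.partition m).parts := by
      intro k m hkm hm hk hmm
      refine h k (hkm.trans hm) lam (mem_bigParts.mpr ⟨hk, h1⟩) ?_
      exact mem_parts_of_le (S.partition_le hkm hm.le)
        (S.partition_le (Nat.le_succ k) (by omega)) hk hmm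
    refine ⟨l, ⟨hl, hmem⟩, ?_⟩
    rintro m ⟨hm, hmm⟩
    rcases lt_trichotomy l m with hlt | rfl | hlt
    · exact absurd hmm (key l m hlt hm hmem)
    · rfl
    · exact absurd hmem (key m l hlt hl hmm)

theorem partition_zero_parts : (S.partition 0).parts = {univ} := by
  rw [S.partition_eq_level (Nat.succ_pos _)]
  exact S.level_zero

variable {S} in
theorem IsReduced.prod_branches (hS : S.IsReduced) (hN : 2 ≤ N) (h : Finset (Fin N) → ℂ) :
    ∏ lam ∈ S.branches.erase univ, h lam =
      ∏ l ∈ range S.length, ∏ lam ∈ bigParts (S.partition (l + 1)), h lam := by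
  have hpos := S.length_pos hN
  have huniv : (univ : Finset (Fin N)) ∈ bigParts (S.partition 0) :=
    mem_bigParts.mpr ⟨by rw [S.partition_zero_parts]; exact mem_singleton_self _, by simp; omega⟩
  have huniq : ∀ k m, k < S.length → m < S.length → ∀ lam, lam ∈ bigParts (S.partition k) →
      lam ∈ bigParts (S.partition m) → k = m := fun k m hk hm lam h1 h2 =>
    (hS lam (S.mem_branches_of_mem_bigParts hk h1)).unique ⟨hk, (mem_bigParts.mp h1).1⟩
      ⟨hm, (mem_bigParts.mp h2).1⟩
  -- The whole index set is the only branch at level 0. Every other branch occurs at one later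
  -- level, and the final level has no parts of size above 1.
  have heq : S.branches.erase univ =
      (range S.length).biUnion fun l => bigParts (S.partition (l + 1)) := by
    ext lam
    rw [mem_erase, mem_biUnion]
    constructor
    · rintro ⟨hne, hlam⟩
      obtain ⟨⟨l, hl, hmem⟩, h1⟩ := S.mem_branches.mp hlam
      obtain _ | l := l
      · rw [S.partition_zero_parts, mem_singleton] at hmem
        exact absurd hmem hne
      · exact ⟨l, mem_range.mpr (by omega), mem_bigParts.mpr ⟨hmem, h1⟩⟩
    · rintro ⟨l, hl, hlam⟩
      have hl' := S.lt_length_of_mem_bigParts (mem_range.mp hl) hlam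
      refine ⟨?_, S.mem_branches_of_mem_bigParts hl' hlam⟩
      rintro rfl
      have := huniq _ _ hpos hl' _ huniv hlam
      omega
  rw [heq, prod_biUnion]
  intro k hk m hm hkm
  refine disjoint_left.mpr fun lam h1 h2 => hkm ?_
  have := huniq _ _ (S.lt_length_of_mem_bigParts (mem_range.mp hk) h1)
    (S.lt_length_of_mem_bigParts (mem_range.mp hm) h2) lam h1 h2
  omega

end SplittingFiltration

open scoped Classical in
/-- The sum of branch functions over reduced filtrations is a chain sum. -/
theorem branchSum_eq (hN : 2 ≤ N) {P₀ : Finpartition (univ : Finset (Fin N))}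
    (h0 : P₀.parts = {univ}) (q : ℕ) (s : Pairs N → ℝ) :
    branchSum q (fun p => (s p : ℂ)) = ((q : ℂ) ^ (N - 1))⁻¹ *
      ∑ n ∈ range (Fintype.card (Finpartition (univ : Finset (Fin N)))),
        chainSum (fun P Q => if SplitsAll P Q then (splitCount q P Q : ℂ) *
          ∏ lam ∈ bigParts Q, 1 / ((q : ℂ) ^ branchExponent (fun p => (s p : ℂ)) lam - 1) else 0)
            n P₀ := by
  unfold chainSum
  rw [← sum_splittingFiltration h0 (fun n f => ∏ i : Fin n,
    if SplitsAll (f i.castSucc) (f i.succ) then (splitCount q (f i.castSucc) (f i.succ) : ℂ) *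
      ∏ lam ∈ bigParts (f i.succ),
        1 / ((q : ℂ) ^ branchExponent (fun p => (s p : ℂ)) lam - 1) else 0), branchSum,
    sum_filter, mul_sum]
  refine sum_congr rfl fun S _ => ?_
  rw [S.prod_steps fun P Q => if SplitsAll P Q then (splitCount q P Q : ℂ) *
    ∏ lam ∈ bigParts Q, 1 / ((q : ℂ) ^ branchExponent (fun p => (s p : ℂ)) lam - 1) else 0]
  by_cases hS : S.IsReduced
  · have h1 := S.isReduced_iff.mp hS
    rw [prod_congr rfl fun l hl => if_pos (h1 l (mem_range.mp hl)), prod_mul_distrib,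
      ← Nat.cast_prod, ← S.multiplicity_eq_prod, ← hS.prod_branches hN,
      SplittingFiltration.branchFunction]
    split_ifs with h
    · ring
    · rw [Nat.eq_zero_of_not_pos fun h' => h ⟨hS, h'⟩]
      simp
  · rw [if_neg fun h => hS h.1]
    rw [S.isReduced_iff] at hS
    push Not at hS
    obtain ⟨l, hl, h⟩ := hS
    rw [prod_eq_zero (mem_range.mpr hl) (if_neg h), mul_zero]

end BranchSum

/-! ### Comparison of the combinatorial sums -/

section Identities

variable {K : Type*} [Field K] [ValuativeRel K] [TopologicalSpace K] [IsNonarchimedeanLocalField K]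
  [MeasurableSpace K] [BorelSpace K] {N : ℕ}

theorem ne_bot_of_parts_eq (hN : 2 ≤ N) {P₀ : Finpartition (univ : Finset (Fin N))}
    (h0 : P₀.parts = {univ}) : P₀ ≠ ⊥ := by
  rintro rfl
  have h3 := card_of_mem_parts_bot (h0 ▸ mem_singleton_self univ)
  rw [card_univ, Fintype.card_fin] at h3
  omega

theorem natCast_pow_inv_mul {q : ℂ} (hq : q ≠ 0) (hN : 2 ≤ N) :
    (q ^ (N - 1))⁻¹ = q * q⁻¹ ^ N := by
  obtain ⟨n, rfl⟩ := Nat.exists_eq_add_of_le' hN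
  rw [show n + 2 - 1 = n + 1 by omega, inv_pow]
  field_simp
  ring

/-- The chain formula applied at the one-part partition; the normalizations q⁻¹ there and q⁻ᴺ at the
singletons combine to q^(-(N-1)). -/
theorem levelSum_eq_splitSum (hN : 2 ≤ N) {b : ℂ} {s : Pairs N → ℝ} (hs : ∀ p, 0 < s p)
    (hb : -1 ≤ b.re) {P₀ : Finpartition (univ : Finset (Fin N))} (h0 : P₀.parts = {univ}) :
    levelSum (Nat.card 𝓀[K]) b (fun p => (s p : ℂ)) = splitSum K b s P₀ := by
  classical
  have hq := card_residue_complex_ne_zero (K := K)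
  have h1 := eq_sum_chainSum (fun P hP => splitValue_eq_sum (K := K) hs hb hP) P₀
  rw [levelSum_eq hN h0, natCast_pow_inv_mul hq hN]
  rw [splitValue, if_neg (ne_bot_of_parts_eq hN h0), splitValue, if_pos rfl, h0, card_singleton,
    pow_one] at h1
  rw [mul_assoc, ← h1, mul_inv_cancel_left₀ hq]

theorem branchSum_eq_diamIntegral (hN : 2 ≤ N) {s : Pairs N → ℝ} (hs : ∀ p, 0 < s p)
    {P₀ : Finpartition (univ : Finset (Fin N))} (h0 : P₀.parts = {univ}) :
    branchSum (Nat.card 𝓀[K]) (fun p => (s p : ℂ)) = diamIntegral K s P₀ (bigParts P₀) := by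
  classical
  have hq := card_residue_complex_ne_zero (K := K)
  have h1 := eq_sum_chainSum (fun P hP => diamValue_eq_sum (K := K) hs hP) P₀
  rw [branchSum_eq hN h0, natCast_pow_inv_mul hq hN]
  rw [diamValue_bot, diamValue, h0, card_singleton, pow_one] at h1
  rw [mul_assoc, ← h1, mul_inv_cancel_left₀ hq]

/-- For the one-part partition the exponent is N - 1 + ∑ s, so the factor moved to the left is 1 -
q^(-(z-1)), the denominator of the root function. -/
theorem partIntegral_univ_mul (hN : 2 ≤ N) {a b : ℂ} {s : Pairs N → ℝ} (hs : ∀ p, 0 < s p)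
    (hb : -1 ≤ b.re) {P₀ : Finpartition (univ : Finset (Fin N))} (h0 : P₀.parts = {univ})
    (ha : 1 - (N : ℝ) ≤ (a + b).re) :
    partIntegral K a b s P₀ * (1 - (Nat.card 𝓀[K] : ℂ) ^ (-(N + a + b + ∑ p, (s p : ℂ) - 1))) =
      levelSum (Nat.card 𝓀[K]) b (fun p => (s p : ℂ)) := by
  have hne := ne_bot_of_parts_eq hN h0
  have hE : partExponent s P₀ = N - 1 + ∑ p, s p := by
    rw [partExponent, h0, card_singleton, samePairs_of_parts_eq h0, Nat.cast_one]
  have hpos : 0 < ∑ p, s p := by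
    refine sum_pos (fun p _ => hs p) ?_
    rw [← samePairs_of_parts_eq h0]
    exact samePairs_nonempty_iff.mpr hne
  rw [Complex.add_re] at ha
  rw [levelSum_eq_splitSum hN hs hb h0,
    ← partIntegral_mul (K := K) (a := a) hs hb hne (by rw [hE]; linarith), hE]
  congr 4
  push_cast
  ring

/-- Both sides are the integral over the unit ball times 1 - q^(-e) for the whole index set: on one
side it is the cost of diameter 1, on the other the unrefined term. -/
theorem branchSum_eq_levelSum (hN : 2 ≤ N) {s : Pairs N → ℝ} (hs : ∀ p, 0 < s p)
    {P₀ : Finpartition (univ : Finset (Fin N))} (h0 : P₀.parts = {univ}) :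
    branchSum (Nat.card 𝓀[K]) (fun p => (s p : ℂ)) =
      levelSum (Nat.card 𝓀[K]) 0 (fun p => (s p : ℂ)) := by
  have h1 : bigParts P₀ = {univ} := by
    rw [bigParts, h0, filter_singleton, if_pos (by rw [card_univ, Fintype.card_fin]; omega)]
  have hre : 1 - (N : ℝ) ≤ ((0 : ℂ) + 0).re := by
    have : (2 : ℝ) ≤ N := by exact_mod_cast hN
    rw [add_zero, Complex.zero_re]
    linarith
  rw [branchSum_eq_diamIntegral (K := K) hN hs h0, diamIntegral_eq hs, h1, prod_singleton, mul_comm,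
    ← partIntegral_univ_mul (K := K) (a := 0) (b := 0) hN hs (by simp) h0 hre, branchExponent]
  congr 4
  simp
  ring

end Identities

/-! ### Convergence of the root function -/

section Growth

theorem eventually_le_rpow_of_limsup_lt {g : ℕ → ℝ≥0} {t : ℝ}
    (h : Filter.limsup (fun n : ℕ => ENNReal.log (g n : ℝ≥0∞) / ((Real.log n : ℝ) : EReal))
      Filter.atTop < (t : EReal)) :
    ∀ᶠ n : ℕ in Filter.atTop, (g n : ℝ) ≤ (n : ℝ) ^ t := by
  filter_upwards [Filter.eventually_lt_of_limsup_lt h, Filter.eventually_ge_atTop 2] with n hn hn2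
  have hn1 : (1 : ℝ) < n := by exact_mod_cast hn2
  have hlog : 0 < Real.log n := Real.log_pos hn1
  rw [EReal.div_lt_iff (by exact_mod_cast hlog) (EReal.coe_ne_top _), ← EReal.coe_mul] at hn
  have h1 := EReal.exp_lt_exp_iff.mpr hn
  rw [EReal.exp_coe, ENNReal.exp_log] at h1
  rw [Real.rpow_def_of_pos (by linarith), mul_comm]
  have h2 := ENNReal.toReal_mono ENNReal.ofReal_ne_top h1.le
  rwa [ENNReal.toReal_ofReal (Real.exp_pos _).le] at h2

variable {q : ℕ} {ρ : ℝ≥0 → ℝ≥0}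

theorem natCast_cpow_int_mul (hq : 1 < q) (m : ℤ) (z : ℂ) :
    (((((q : ℝ≥0) ^ m : ℝ≥0)) : ℝ) : ℂ) ^ z = (q : ℂ) ^ ((m : ℂ) * z) := by
  have hq0 : (0 : ℝ) < q := by exact_mod_cast (zero_lt_one.trans hq)
  have h1 : ((((q : ℝ≥0) ^ m : ℝ≥0)) : ℝ) = (q : ℝ) ^ m := by simp
  rw [h1, ← Complex.ofReal_natCast, Complex.cpow_def_of_ne_zero (by exact_mod_cast (zpow_pos hq0 m).ne'),
    Complex.cpow_def_of_ne_zero (by exact_mod_cast hq0.ne'), ← Complex.ofReal_log (zpow_pos hq0 m).le,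
    ← Complex.ofReal_log hq0.le, Real.log_zpow]
  push_cast
  ring_nf

theorem norm_rootTerm (hq : 1 < q) (z : ℂ) (m : ℤ) :
    ‖rootTerm q ρ z m‖ = ρ ((q : ℝ≥0) ^ m) * (q : ℝ) ^ (m * z.re) := by
  have hq0 : (0 : ℝ) < q := by exact_mod_cast (zero_lt_one.trans hq)
  rw [rootTerm, norm_mul, Complex.norm_real, Real.norm_of_nonneg (NNReal.coe_nonneg _),
    ← Complex.ofReal_natCast, Complex.norm_cpow_eq_rpow_re_of_pos hq0]
  congr 2
  simp

theorem tendsto_natPow (hq : 1 < q) : Filter.Tendsto (fun k : ℕ => q ^ k) Filter.atTop Filter.atTop :=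
  tendsto_pow_atTop_atTop_of_one_lt hq

theorem summable_rpow_neg_mul (hq : 1 < q) {t : ℝ} (ht : t < 0) :
    Summable fun k : ℕ => (q : ℝ) ^ (k * t) := by
  have hq0 : (1 : ℝ) < q := by exact_mod_cast hq
  have h1 : ∀ k : ℕ, (q : ℝ) ^ (k * t) = ((q : ℝ) ^ t) ^ k := fun k => by
    rw [← Real.rpow_natCast, ← Real.rpow_mul (by linarith), mul_comm]
  simp_rw [h1]
  exact summable_geometric_of_lt_one (by positivity) (Real.rpow_lt_one_of_one_lt_of_neg hq0 ht)

/-- The series in the root function converges absolutely for `Re z > 1`. -/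
theorem summable_rootTerm (hq : 1 < q) (hρ : GrowthCondition ρ) {z : ℂ} (hz : 1 < z.re) :
    Summable (rootTerm q ρ z) := by
  have hq0 : (0 : ℝ) < q := by exact_mod_cast (zero_lt_one.trans hq)
  have hpow : ∀ (k : ℕ) (t : ℝ), (((q ^ k : ℕ) : ℝ)) ^ t = (q : ℝ) ^ (k * t) := fun k t => by
    rw [Nat.cast_pow, ← Real.rpow_natCast, ← Real.rpow_mul hq0.le]
  refine Summable.of_nat_of_neg ?_ ?_
  -- At infinity any power decay is available; this one leaves terms bounded by q⁻ᵏ.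
  · have h1 := eventually_le_rpow_of_limsup_lt (g := fun n => ρ n) (t := -(z.re + 1))
      (by rw [hρ.2]; exact EReal.bot_lt_coe _)
    refine Summable.of_norm_bounded_eventually_nat
      (summable_rpow_neg_mul hq (show (-1 : ℝ) < 0 by norm_num)) ?_
    filter_upwards [(tendsto_natPow hq).eventually h1] with k hk
    rw [hpow] at hk
    rw [norm_rootTerm hq]
    have h2 : (q : ℝ≥0) ^ (k : ℤ) = ((q ^ k : ℕ) : ℝ≥0) := by simp
    rw [h2]
    refine (mul_le_mul_of_nonneg_right hk (by positivity)).trans (le_of_eq ?_)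
    rw [← Real.rpow_add hq0]
    congr 1
    push_cast
    ring
  -- Near 0 the exponent is chosen midway between 1 and Re z, which leaves a geometric series of
  -- ratio q^((1 - Re z)/2).
  · have h1 := eventually_le_rpow_of_limsup_lt (g := fun n => ρ (1 / n)) (t := (1 + z.re) / 2)
      (lt_of_le_of_lt hρ.1 (by
        rw [← EReal.coe_one, EReal.coe_lt_coe_iff]
        linarith))
    refine Summable.of_norm_bounded_eventually_nat
      (summable_rpow_neg_mul hq (show (1 - z.re) / 2 < 0 by linarith)) ?_
    filter_upwards [(tendsto_natPow hq).eventually h1] with k hk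
    rw [hpow] at hk
    rw [norm_rootTerm hq]
    have h2 : (q : ℝ≥0) ^ (-(k : ℤ)) = 1 / ((q ^ k : ℕ) : ℝ≥0) := by simp
    rw [h2]
    refine (mul_le_mul_of_nonneg_right hk (by positivity)).trans (le_of_eq ?_)
    rw [← Real.rpow_add hq0]
    congr 1
    push_cast
    ring

end Growth

/-! ### Integrals over the whole space -/

section Global

variable {K : Type*} [Field K] [ValuativeRel K] [TopologicalSpace K] [IsNonarchimedeanLocalField K]
  [MeasurableSpace K] [BorelSpace K] {N : ℕ}

theorem pairDist_smul (m : ℤ) (x : Fin N → K) (p : Pairs N) :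
    pairDist (uniformizer K ^ (-m) • x) p = (Nat.card 𝓀[K] : ℝ≥0) ^ m * pairDist x p := by
  rw [pairDist, Pi.smul_apply, Pi.smul_apply, smul_eq_mul, smul_eq_mul, ← mul_sub,
    canonicalAbs_mul, canonicalAbs_uniformizer_zpow, neg_neg]
  rfl

theorem partWeight_smul {a b : ℂ} {s : Pairs N → ℝ} {P : Finpartition (univ : Finset (Fin N))}
    (hP : P ≠ ⊥) (m : ℤ) (x : Fin N → K) :
    partWeight a b s P (uniformizer K ^ (-m) • x) =
      (Nat.card 𝓀[K] : ℂ) ^ ((m : ℂ) * (a + b + ∑ p ∈ samePairs P, (s p : ℂ))) *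
        partWeight a b s P x := by
  rw [partWeight, ← natCast_cpow_int_mul one_lt_card_residue]
  exact (pairWeight_congr a b s fun p _ => pairDist_smul m x p).trans
    (pairWeight_mul a b s (zpow_ne_zero m card_residue_ne_zero) (samePairs_nonempty_iff.mpr hP))

/-- The ball of radius `q^m` for the standard norm. -/
def normBall (K : Type*) [Field K] [ValuativeRel K] [TopologicalSpace K]
    [IsNonarchimedeanLocalField K] [MeasurableSpace K] [BorelSpace K] (N : ℕ) (m : ℤ) :
    Set (Fin N → K) :=
  {x | standardNorm x ≤ (Nat.card 𝓀[K] : ℝ≥0) ^ m}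

/-- The sphere of radius `q^m` for the standard norm. -/
def normSphere (K : Type*) [Field K] [ValuativeRel K] [TopologicalSpace K]
    [IsNonarchimedeanLocalField K] [MeasurableSpace K] [BorelSpace K] (N : ℕ) (m : ℤ) :
    Set (Fin N → K) :=
  {x | standardNorm x = (Nat.card 𝓀[K] : ℝ≥0) ^ m}

theorem measurableSet_normBall (m : ℤ) : MeasurableSet (normBall K N m) :=
  measurable_standardNorm measurableSet_Iic

theorem measurableSet_normSphere (m : ℤ) : MeasurableSet (normSphere K N m) :=
  measurable_standardNorm (measurableSet_singleton _)

theorem one_lt_card_residue_nnreal : (1 : ℝ≥0) < Nat.card 𝓀[K] := by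
  exact_mod_cast one_lt_card_residue

theorem normBall_subset (m : ℤ) : normBall K N (m - 1) ⊆ normBall K N m := fun _ hx =>
  le_trans hx (zpow_le_zpow_right₀ one_lt_card_residue_nnreal.le (by omega))

theorem normSphere_eq_diff (m : ℤ) : normSphere K N m = normBall K N m \ normBall K N (m - 1) := by
  ext x
  change standardNorm x = _ ↔ standardNorm x ≤ _ ∧ ¬ standardNorm x ≤ _
  have hq := one_lt_card_residue_nnreal (K := K)
  rcases standardNorm_eq_zero_or_zpow x with h | ⟨n, h⟩
  · rw [h]
    refine iff_of_false (zpow_ne_zero m card_residue_ne_zero).symm fun h' => h'.2 zero_le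
  · rw [h, (zpow_right_injective₀ (zero_lt_one.trans hq) hq.ne').eq_iff,
      zpow_le_zpow_iff_right₀ hq, zpow_le_zpow_iff_right₀ hq]
    omega

theorem measurable_smul_uniformizer (m : ℤ) :
    Measurable fun x : Fin N → K => uniformizer K ^ (-m) • x := by
  refine measurable_pi_lambda _ fun i => ?_
  simpa [Function.comp_def] using
    (measurable_affine 0 (uniformizer K ^ (-m))).comp (measurable_pi_apply i)

theorem integrableOn_normBall {a b : ℂ} {s : Pairs N → ℝ}
    {P : Finpartition (univ : Finset (Fin N))} (hP : P ≠ ⊥)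
    (hI : Integrable (partWeight a b s P) (cubeMeasure K N)) (m : ℤ) :
    IntegrableOn (partWeight a b s P) (normBall K N m) (haarPi K N) := by
  rw [IntegrableOn, normBall, haarPi_restrict_ball]
  refine Integrable.smul_measure_nnreal ?_
  rw [integrable_map_measure (measurable_partWeight a b s P).aestronglyMeasurable
    (measurable_smul_uniformizer m).aemeasurable]
  refine (hI.const_mul ((Nat.card 𝓀[K] : ℂ) ^
    ((m : ℂ) * (a + b + ∑ p ∈ samePairs P, (s p : ℂ))))).congr ?_
  exact Filter.Eventually.of_forall fun x => (partWeight_smul hP m x).symm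

theorem setIntegral_normBall {E : Type*} [NormedAddCommGroup E] [NormedSpace ℝ E]
    {f : (Fin N → K) → E} (hf : StronglyMeasurable f) (m : ℤ) :
    ∫ x in normBall K N m, f x ∂haarPi K N = ((Nat.card 𝓀[K] : ℝ) ^ m) ^ N •
      ∫ x, f (uniformizer K ^ (-m) • x) ∂cubeMeasure K N := by
  rw [normBall, haarPi_restrict_ball, integral_smul_nnreal_measure,
    integral_map (measurable_smul_uniformizer m).aemeasurable hf.aestronglyMeasurable,
    NNReal.smul_def]
  simp

theorem cpow_exponent (a b : ℂ) (s : Pairs N → ℝ) {P : Finpartition (univ : Finset (Fin N))}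
    (m : ℤ) : (((Nat.card 𝓀[K] : ℝ) ^ m) ^ N : ℂ) *
      (Nat.card 𝓀[K] : ℂ) ^ ((m : ℂ) * (a + b + ∑ p ∈ samePairs P, (s p : ℂ))) =
      (Nat.card 𝓀[K] : ℂ) ^ ((m : ℂ) * (N + a + b + ∑ p ∈ samePairs P, (s p : ℂ))) := by
  have hq := card_residue_complex_ne_zero (K := K)
  rw [Complex.ofReal_natCast, ← Complex.cpow_intCast, ← Complex.cpow_mul_nat, ← Complex.cpow_add _ _ hq]
  congr 1
  ring

theorem setIntegral_partWeight_normBall {a b : ℂ} {s : Pairs N → ℝ}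
    {P : Finpartition (univ : Finset (Fin N))} (hP : P ≠ ⊥) (m : ℤ) :
    ∫ x in normBall K N m, partWeight a b s P x ∂haarPi K N =
      (Nat.card 𝓀[K] : ℂ) ^ ((m : ℂ) * (N + a + b + ∑ p ∈ samePairs P, (s p : ℂ))) *
        partIntegral K a b s P := by
  rw [setIntegral_normBall (measurable_partWeight a b s P).stronglyMeasurable,
    integral_congr_ae (Filter.Eventually.of_forall fun x => partWeight_smul hP m x),
    integral_const_mul, Complex.real_smul, ← mul_assoc, ← cpow_exponent, partIntegral]
  push_cast
  rfl

theorem setIntegral_norm_partWeight_normBall {a b : ℂ} {s : Pairs N → ℝ}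
    {P : Finpartition (univ : Finset (Fin N))} (hP : P ≠ ⊥) (m : ℤ) :
    ∫ x in normBall K N m, ‖partWeight a b s P x‖ ∂haarPi K N =
      ‖(Nat.card 𝓀[K] : ℂ) ^ ((m : ℂ) * (N + a + b + ∑ p ∈ samePairs P, (s p : ℂ)))‖ *
        ∫ x, ‖partWeight a b s P x‖ ∂cubeMeasure K N := by
  rw [setIntegral_normBall (measurable_partWeight a b s P).stronglyMeasurable.norm,
    integral_congr_ae (Filter.Eventually.of_forall fun x => congrArg norm (partWeight_smul hP m x))]
  simp_rw [norm_mul]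
  rw [integral_const_mul, smul_eq_mul, ← mul_assoc, ← cpow_exponent, norm_mul]
  congr 2
  simp

/-- By homogeneity the ball of radius q^(m-1) carries q^(-z) times the integral over the ball of
radius q^m; subtracting leaves 1 - q^(-z). -/
theorem setIntegral_normSphere {a b : ℂ} {s : Pairs N → ℝ}
    {P : Finpartition (univ : Finset (Fin N))} (hP : P ≠ ⊥)
    (hI : Integrable (partWeight a b s P) (cubeMeasure K N)) (m : ℤ) :
    ∫ x in normSphere K N m, partWeight a b s P x ∂haarPi K N =
      (1 - (Nat.card 𝓀[K] : ℂ) ^ (-(N + a + b + ∑ p ∈ samePairs P, (s p : ℂ)))) *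
      (Nat.card 𝓀[K] : ℂ) ^ ((m : ℂ) * (N + a + b + ∑ p ∈ samePairs P, (s p : ℂ))) *
        partIntegral K a b s P := by
  have hq := card_residue_complex_ne_zero (K := K)
  rw [normSphere_eq_diff, setIntegral_sdiff (measurableSet_normBall _) (integrableOn_normBall hP hI m)
    (normBall_subset m), setIntegral_partWeight_normBall hP, setIntegral_partWeight_normBall hP,
    ← sub_mul]
  congr 1
  rw [sub_mul, one_mul, ← Complex.cpow_add _ _ hq]
  congr 2
  push_cast
  ring

theorem partWeight_zero {a b : ℂ} {s : Pairs N → ℝ} (hs : ∀ p, 0 < s p)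
    {P : Finpartition (univ : Finset (Fin N))} (hP : P ≠ ⊥) :
    partWeight a b s P (0 : Fin N → K) = 0 := by
  obtain ⟨p, hp⟩ := samePairs_nonempty_iff.mpr hP
  refine pairWeight_eq_zero a b hs hp ?_
  simp [pairDist, canonicalAbs_zero]

/-- The spheres cover all points except the origin, where the weight vanishes, so the value of ρ at
0 plays no role. The norm integral on a sphere is at most that on its ball, so absolute convergence
of the series gives integrability. -/
theorem integral_density_partWeight {ρ : ℝ≥0 → ℝ≥0} {a b : ℂ} {s : Pairs N → ℝ}
    (hs : ∀ p, 0 < s p) {P : Finpartition (univ : Finset (Fin N))} (hP : P ≠ ⊥)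
    (hI : Integrable (partWeight a b s P) (cubeMeasure K N))
    (hsum : Summable (rootTerm (Nat.card 𝓀[K]) ρ (N + a + b + ∑ p ∈ samePairs P, (s p : ℂ)))) :
    Integrable (fun x : Fin N → K => ((ρ (standardNorm x) : ℝ) : ℂ) * partWeight a b s P x)
        (haarPi K N) ∧
      ∫ x, ((ρ (standardNorm x) : ℝ) : ℂ) * partWeight a b s P x ∂haarPi K N =
        (1 - (Nat.card 𝓀[K] : ℂ) ^ (-(N + a + b + ∑ p ∈ samePairs P, (s p : ℂ)))) *
          (∑' m : ℤ, rootTerm (Nat.card 𝓀[K]) ρ (N + a + b + ∑ p ∈ samePairs P, (s p : ℂ)) m) *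
            partIntegral K a b s P := by
  set z : ℂ := N + a + b + ∑ p ∈ samePairs P, (s p : ℂ) with hz
  set f : (Fin N → K) → ℂ := fun x => ((ρ (standardNorm x) : ℝ) : ℂ) * partWeight a b s P x with hf
  have hfm : ∀ m, ∀ x ∈ normSphere K N m, f x =
      ((ρ ((Nat.card 𝓀[K] : ℝ≥0) ^ m) : ℝ) : ℂ) * partWeight a b s P x := fun m x hx => by
    rw [hf]
    dsimp only
    rw [show standardNorm x = _ from hx]
  have hsub : ∀ m, normSphere K N m ⊆ normBall K N m := fun m x hx =>
    le_of_eq (show standardNorm x = _ from hx)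
  have hIm : ∀ m, IntegrableOn (partWeight a b s P) (normSphere K N m) (haarPi K N) := fun m =>
    (integrableOn_normBall hP hI m).mono_set (hsub m)
  have hfI : ∀ m, IntegrableOn f (normSphere K N m) (haarPi K N) := fun m =>
    IntegrableOn.congr_fun ((hIm m).const_mul ((ρ ((Nat.card 𝓀[K] : ℝ≥0) ^ m) : ℝ) : ℂ))
      (fun x hx => (hfm m x hx).symm) (measurableSet_normSphere m)
  have hzero : ∀ x, x ∉ (⋃ m, normSphere K N m) → f x = 0 := by
    intro x hx
    rcases standardNorm_eq_zero_or_zpow x with h | ⟨n, h⟩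
    · rw [standardNorm_eq_zero_iff] at h
      rw [hf, h]
      dsimp only
      rw [partWeight_zero hs hP, mul_zero]
    · exact absurd (Set.mem_iUnion.mpr ⟨n, h⟩) hx
  have hnorm : Summable fun m : ℤ => ∫ x in normSphere K N m, ‖f x‖ ∂haarPi K N := by
    refine Summable.of_nonneg_of_le (fun m => integral_nonneg fun _ => norm_nonneg _) (fun m => ?_)
      (hsum.norm.mul_right (∫ x, ‖partWeight a b s P x‖ ∂cubeMeasure K N))
    rw [setIntegral_congr_fun (measurableSet_normSphere m) fun x hx => congrArg norm (hfm m x hx)]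
    simp_rw [norm_mul]
    rw [integral_const_mul, rootTerm, norm_mul, mul_assoc]
    refine mul_le_mul_of_nonneg_left ?_ (norm_nonneg _)
    rw [← setIntegral_norm_partWeight_normBall hP]
    exact setIntegral_mono_set (integrableOn_normBall hP hI m).norm
      (Filter.Eventually.of_forall fun _ => norm_nonneg _) (hsub m).eventuallyLE
  have hUI : IntegrableOn f (⋃ m, normSphere K N m) (haarPi K N) :=
    integrableOn_iUnion_of_summable_integral_norm hfI hnorm
  have hdisj : Pairwise (Function.onFun Disjoint (normSphere K N)) := by
    intro m n hmn
    refine Set.disjoint_left.mpr fun x hx hx' => hmn ?_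
    have hq := one_lt_card_residue_nnreal (K := K)
    have h1 : (Nat.card 𝓀[K] : ℝ≥0) ^ m = (Nat.card 𝓀[K] : ℝ≥0) ^ n :=
      (show standardNorm x = _ from hx).symm.trans hx'
    exact zpow_right_injective₀ (zero_lt_one.trans hq) hq.ne' h1
  refine ⟨hUI.integrable_of_forall_notMem_eq_zero hzero, ?_⟩
  rw [← setIntegral_eq_integral_of_forall_compl_eq_zero hzero]
  refine (hasSum_integral_iUnion measurableSet_normSphere hdisj hUI).unique ?_
  have hterm : ∀ m : ℤ, ∫ x in normSphere K N m, f x ∂haarPi K N =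
      (1 - (Nat.card 𝓀[K] : ℂ) ^ (-z)) * rootTerm (Nat.card 𝓀[K]) ρ z m *
        partIntegral K a b s P := fun m => by
    rw [setIntegral_congr_fun (measurableSet_normSphere m) (hfm m), integral_const_mul,
      setIntegral_normSphere hP hI, rootTerm]
    ring
  simp_rw [hterm]
  exact (hsum.hasSum.mul_left _).mul_right _

/-- A collision requires equal residues, which has probability q⁻¹, and then a collision of the
rescaled points. The measure therefore equals q⁻¹ times itself. -/
theorem measure_collision_eq_zero {i j : Fin N} (hij : i ≠ j) :
    cubeMeasure K N {x | canonicalAbs (x i - x j) = 0} = 0 := by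
  classical
  set S : Set (Fin N → K) := {x | canonicalAbs (x i - x j) = 0} with hS
  have hSm : MeasurableSet S := measurable_dist i j (measurableSet_singleton 0)
  have hI : Integrable (S.indicator fun _ => (1 : ℂ)) (cubeMeasure K N) :=
    (integrable_const 1).indicator hSm
  have hz : ∀ c : Fin N → 𝓀[K], ∫ x, S.indicator (fun _ => (1 : ℂ)) (zoom univ c x) ∂cubeMeasure K N =
      if ∀ k ∈ ({i, j} : Finset (Fin N)), ∀ l ∈ ({i, j} : Finset (Fin N)), c k = c l then
        ∫ x, S.indicator (fun _ => (1 : ℂ)) x ∂cubeMeasure K N else 0 := by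
    intro c
    have hc : (∀ k ∈ ({i, j} : Finset (Fin N)), ∀ l ∈ ({i, j} : Finset (Fin N)), c k = c l) ↔
        c i = c j := by
      refine ⟨fun h => h i (by simp) j (by simp), fun h k hk l hl => ?_⟩
      rw [mem_insert, mem_singleton] at hk hl
      rcases hk with rfl | rfl <;> rcases hl with rfl | rfl <;> simp [h]
    have hd : ∀ x : Fin N → K, (∀ i, x i ∈ (𝒪[K] : Set K)) →
        canonicalAbs (zoom univ c x i - zoom univ c x j) =
          if c i = c j then (Nat.card 𝓀[K] : ℝ≥0)⁻¹ * canonicalAbs (x i - x j) else 1 := by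
      intro x hx
      rw [zoom, zoom, if_pos (mem_univ _), if_pos (mem_univ _), canonicalAbs_sub_zoom (hx i) (hx j)]
    simp only [hc]
    split_ifs with h
    · refine integral_congr_ae ?_
      filter_upwards [ae_mem_integers (K := K) (N := N)] with x hx
      have : zoom univ c x ∈ S ↔ x ∈ S := by
        rw [hS, Set.mem_ofPred_eq, Set.mem_ofPred_eq, hd x hx, if_pos h]
        simp
      by_cases hxS : x ∈ S
      · rw [Set.indicator_of_mem (this.mpr hxS), Set.indicator_of_mem hxS]
      · rw [Set.indicator_of_notMem (fun h' => hxS (this.mp h')), Set.indicator_of_notMem hxS]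
    · rw [← integral_zero (Fin N → K) ℂ (μ := cubeMeasure K N)]
      refine integral_congr_ae ?_
      filter_upwards [ae_mem_integers (K := K) (N := N)] with x hx
      refine Set.indicator_of_notMem (fun h' => ?_) _
      rw [hS, Set.mem_ofPred_eq, hd x hx, if_neg h] at h'
      exact one_ne_zero h'
  have h1 := integral_zoom univ hI
  have hN : 2 ≤ N := by
    have := card_le_univ ({i, j} : Finset (Fin N))
    rwa [card_pair hij, Fintype.card_fin] at this
  rw [sum_congr rfl fun c _ => hz c, ← sum_filter, sum_const,
    card_constant_on ⟨i, mem_insert_self _ _⟩, card_pair hij, nsmul_eq_mul,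
    ← Nat.card_eq_fintype_card, integral_indicator_const _ hSm] at h1
  have hq := card_residue_complex_ne_zero (K := K)
  have h2 : (Nat.card 𝓀[K] : ℂ)⁻¹ ^ N * ((Nat.card 𝓀[K] ^ (N - 2 + 1) : ℕ) : ℂ) =
      (Nat.card 𝓀[K] : ℂ)⁻¹ := by
    obtain ⟨n, rfl⟩ := Nat.exists_eq_add_of_le' hN
    push_cast
    rw [inv_pow]
    field_simp
    ring
  rw [← mul_assoc, h2, Complex.real_smul, mul_one] at h1
  have h3 : (Nat.card 𝓀[K] : ℂ)⁻¹ ≠ 1 := by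
    rw [ne_eq, inv_eq_one]
    exact_mod_cast (one_lt_card_residue (K := K)).ne'
  have h4 : ((1 : ℂ) - (Nat.card 𝓀[K] : ℂ)⁻¹) * ((cubeMeasure K N).real S : ℂ) = 0 := by
    linear_combination h1
  have h5 := (mul_eq_zero.mp h4).resolve_left (sub_ne_zero.mpr h3.symm)
  exact (measureReal_eq_zero_iff).mp (by exact_mod_cast h5)

/-- The integrand is nonnegative and, off the null set of collisions, strictly positive. -/
theorem partIntegral_zero_zero_ne_zero {s : Pairs N → ℝ} (hs : ∀ p, 0 < s p)
    (P : Finpartition (univ : Finset (Fin N))) : partIntegral K 0 0 s P ≠ 0 := by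
  have hI := integrable_partWeight_zero (K := K) hs P
  set f : (Fin N → K) → ℝ := fun x => ∏ p ∈ samePairs P, (pairDist x p : ℝ) ^ s p with hf
  have hfP : ∀ x, partWeight 0 0 s P x = (f x : ℂ) := fun x => by
    rw [partWeight_zero_zero, hf]
    push_cast
    exact prod_congr rfl fun p _ => (Complex.ofReal_cpow (NNReal.coe_nonneg _) _).symm
  have hfI : Integrable f (cubeMeasure K N) := by
    have := hI.re
    refine this.congr (Filter.Eventually.of_forall fun x => ?_)
    simp [hfP]
  have hf0 : 0 ≤ f := fun x => prod_nonneg fun p _ => Real.rpow_nonneg (NNReal.coe_nonneg _) _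
  intro h
  have h1 : ∫ x, f x ∂cubeMeasure K N = 0 := by
    rw [partIntegral, integral_congr_ae (Filter.Eventually.of_forall hfP), integral_complex_ofReal] at h
    exact_mod_cast h
  rw [integral_eq_zero_iff_of_nonneg hf0 hfI] at h1
  have h2 : ∀ᵐ x ∂cubeMeasure K N, ∀ p : Pairs N, pairDist x p ≠ 0 := by
    rw [ae_all_iff]
    intro p
    rw [ae_iff]
    simpa [pairDist] using measure_collision_eq_zero (K := K) p.2.ne
  obtain ⟨x, hx1, hx2⟩ := (h1.and h2).exists
  refine (prod_pos fun p _ => Real.rpow_pos_of_pos ?_ _).ne' hx1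
  exact_mod_cast pos_iff_ne_zero.mpr (hx2 p)

end Global

/-! ### Moments of the gas -/

section Gas

variable {K : Type*} [Field K] [ValuativeRel K] [TopologicalSpace K] [IsNonarchimedeanLocalField K]
  [MeasurableSpace K] [BorelSpace K] {N : ℕ}

theorem nonempty_pairs (hN : 2 ≤ N) : Nonempty (Pairs N) :=
  ⟨⟨(⟨0, by omega⟩, ⟨1, by omega⟩), by simp⟩⟩

theorem exists_parts_eq_univ (hN : 2 ≤ N) :
    ∃ P₀ : Finpartition (univ : Finset (Fin N)), P₀.parts = {univ} := by
  have : Nonempty (Fin N) := ⟨⟨0, by omega⟩⟩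
  exact ⟨Finpartition.indiscrete univ_nonempty.ne_empty, rfl⟩

theorem maxDist_eq (hN : 2 ≤ N) (x : Fin N → K) : maxDist x = maxOn univ (pairDist x) := by
  have := nonempty_pairs hN
  rw [maxOn, dif_pos univ_nonempty, sup'_univ_eq_ciSup]
  rfl

theorem minDist_eq (hN : 2 ≤ N) (x : Fin N → K) : minDist x = minOn univ (pairDist x) := by
  have := nonempty_pairs hN
  rw [minOn, dif_pos univ_nonempty, inf'_univ_eq_ciInf]
  rfl

theorem rootFunction_ne_zero {q : ℕ} (hq : 1 < q) {ρ : ℝ≥0 → ℝ≥0}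
    (hρ0 : ∃ m : ℤ, ρ ((q : ℝ≥0) ^ m) ≠ 0) {z : ℝ} (hz : 1 < z)
    (hsum : Summable (rootTerm q ρ z)) : rootFunction q ρ z ≠ 0 := by
  have hq0 : (0 : ℝ) < q := by exact_mod_cast (zero_lt_one.trans hq)
  refine mul_ne_zero (div_ne_zero (one_sub_cpow_ne_zero hq ?_) (one_sub_cpow_ne_zero hq ?_)) ?_
  · rw [Complex.ofReal_re]
    linarith
  · simpa using hz
  · have h1 : ∀ m : ℤ, rootTerm q ρ z m =
        ((ρ ((q : ℝ≥0) ^ m) * (q : ℝ) ^ (m * z) : ℝ) : ℂ) := fun m => by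
      rw [rootTerm]
      push_cast [Complex.ofReal_cpow hq0.le]
      rfl
    have h2 : Summable fun m : ℤ => (ρ ((q : ℝ≥0) ^ m) * (q : ℝ) ^ (m * z) : ℝ) := by
      rw [← Complex.summable_ofReal]
      exact hsum.congr fun m => h1 m
    rw [tsum_congr h1, ← Complex.ofReal_tsum]
    obtain ⟨m, hm⟩ := hρ0
    have h3 : 0 < ∑' m : ℤ, (ρ ((q : ℝ≥0) ^ m) * (q : ℝ) ^ (m * z) : ℝ) :=
      h2.tsum_pos (fun m => by positivity) m
        (mul_pos (by exact_mod_cast pos_iff_ne_zero.mpr hm) (Real.rpow_pos_of_pos hq0 _))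
    exact_mod_cast h3.ne'

/-- The lower bound on Re(a + b) gives Re z ≥ 1 + ∑ s > 1. This one inequality yields convergence of
the series, integrability on the unit ball, and nonvanishing of 1 - q^(-(z-1)). -/
theorem integral_density (hN : 2 ≤ N) {ρ : ℝ≥0 → ℝ≥0} (hρ : GrowthCondition ρ) {s : Pairs N → ℝ}
    (hs : ∀ p, 0 < s p) {a b : ℂ} (hb : -1 ≤ b.re) (ha : 1 - (N : ℝ) ≤ (a + b).re)
    {P₀ : Finpartition (univ : Finset (Fin N))} (h0 : P₀.parts = {univ}) :
    Summable (rootTerm (Nat.card 𝓀[K]) ρ (N + a + b + ∑ p, (s p : ℂ))) ∧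
    Integrable (fun x : Fin N → K => ((ρ (standardNorm x) : ℝ) : ℂ) * partWeight a b s P₀ x)
        (haarPi K N) ∧
      ∫ x, ((ρ (standardNorm x) : ℝ) : ℂ) * partWeight a b s P₀ x ∂haarPi K N =
        rootFunction (Nat.card 𝓀[K]) ρ (N + a + b + ∑ p, (s p : ℂ)) *
          levelSum (Nat.card 𝓀[K]) b (fun p => (s p : ℂ)) := by
  have hq := one_lt_card_residue (K := K)
  have hP := ne_bot_of_parts_eq hN h0
  have hpos : 0 < ∑ p, s p := by
    have := nonempty_pairs hN
    exact sum_pos (fun p _ => hs p) univ_nonempty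
  have hre : (N + a + b + ∑ p, (s p : ℂ)).re = N + a.re + b.re + ∑ p, s p := by simp
  rw [Complex.add_re] at ha
  have hsum := summable_rootTerm hq hρ (z := N + a + b + ∑ p, (s p : ℂ)) (by rw [hre]; linarith)
  have hE : partExponent s P₀ = N - 1 + ∑ p, s p := by
    rw [partExponent, h0, card_singleton, samePairs_of_parts_eq h0, Nat.cast_one]
  have hI : Integrable (partWeight a b s P₀) (cubeMeasure K N) :=
    integrable_partWeight hs hb fun _ => by rw [hE]; linarith
  have h1 := integral_density_partWeight (ρ := ρ) hs hP hI
    (by rw [samePairs_of_parts_eq h0]; exact hsum)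
  rw [samePairs_of_parts_eq h0] at h1
  refine ⟨hsum, h1.1, h1.2.trans ?_⟩
  rw [← partIntegral_univ_mul (K := K) hN hs hb h0 (by rwa [Complex.add_re]), rootFunction]
  have h2 : (1 : ℂ) - (Nat.card 𝓀[K] : ℂ) ^ (-(N + a + b + ∑ p, (s p : ℂ) - 1)) ≠ 0 :=
    one_sub_cpow_ne_zero hq (by rw [Complex.sub_re, hre, Complex.one_re]; linarith)
  field_simp

theorem coe_gasWeight {ρ : ℝ≥0 → ℝ≥0} (c : Fin N → ℝ) (β : ℝ)
    {P₀ : Finpartition (univ : Finset (Fin N))} (h0 : P₀.parts = {univ}) (x : Fin N → K) :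
    ((gasWeight ρ c β x : ℝ) : ℂ) = ((ρ (standardNorm x) : ℝ) : ℂ) *
      partWeight 0 0 (fun p : Pairs N => c p.1.1 * c p.1.2 * β) P₀ x := by
  rw [partWeight_zero_zero, samePairs_of_parts_eq h0, gasWeight]
  push_cast
  congr 1
  refine prod_congr rfl fun p _ => ?_
  rw [Complex.ofReal_cpow (NNReal.coe_nonneg _)]
  push_cast
  rfl

theorem coe_gasWeight_mul (hN : 2 ≤ N) {ρ : ℝ≥0 → ℝ≥0} (c : Fin N → ℝ) (β : ℝ)
    {P₀ : Finpartition (univ : Finset (Fin N))} (h0 : P₀.parts = {univ}) (a b : ℂ) (x : Fin N → K) :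
    ((gasWeight ρ c β x : ℝ) : ℂ) * (((maxDist x : ℝ) : ℂ) ^ a * ((minDist x : ℝ) : ℂ) ^ b) =
      ((ρ (standardNorm x) : ℝ) : ℂ) *
        partWeight a b (fun p : Pairs N => c p.1.1 * c p.1.2 * β) P₀ x := by
  rw [coe_gasWeight c β h0, partWeight_zero_zero, partWeight, pairWeight, samePairs_of_parts_eq h0,
    maxDist_eq hN, minDist_eq hN]
  ring

end Gas

/-- Multiplying the gas weight by max^a min^b only changes the exponents of `partWeight`, so
partition function and moments are instances of the same integral. -/
theorem gas_moments {K : Type*} [Field K] [ValuativeRel K] [TopologicalSpace K]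
    [IsNonarchimedeanLocalField K] [MeasurableSpace K] [BorelSpace K]
    {N : ℕ} (hN : 2 ≤ N) {ρ : ℝ≥0 → ℝ≥0} (hρ : GrowthCondition ρ)
    (hρ0 : ∃ m : ℤ, ρ ((Nat.card 𝓀[K] : ℝ≥0) ^ m) ≠ 0)
    {c : Fin N → ℝ} (hc : ∀ i, 0 < c i) {β : ℝ} (hβ : 0 < β) :
    ((0 < partitionFunction K ρ c β ∧ partitionFunction K ρ c β < ⊤) ∧
      IsProbabilityMeasure (gasLaw K ρ c β) ∧
      Summable (rootTerm (Nat.card 𝓀[K]) ρ (N + ∑ p, chargeTuple c β p)) ∧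
      rootFunction (Nat.card 𝓀[K]) ρ (N + ∑ p, chargeTuple c β p) ≠ 0 ∧
      levelSum (Nat.card 𝓀[K]) 0 (chargeTuple c β) ≠ 0 ∧
      branchSum (Nat.card 𝓀[K]) (chargeTuple c β) = levelSum (Nat.card 𝓀[K]) 0 (chargeTuple c β)) ∧
    ∀ a b : ℂ, -1 ≤ b.re → 1 - (N : ℝ) ≤ (a + b).re →
      Summable (rootTerm (Nat.card 𝓀[K]) ρ (N + a + b + ∑ p, chargeTuple c β p)) ∧
      Integrable (fun x : Fin N → K => ((maxDist x : ℝ) : ℂ) ^ a * ((minDist x : ℝ) : ℂ) ^ b)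
        (gasLaw K ρ c β) ∧
      ∫ x : Fin N → K, ((maxDist x : ℝ) : ℂ) ^ a * ((minDist x : ℝ) : ℂ) ^ b ∂(gasLaw K ρ c β) =
        (rootFunction (Nat.card 𝓀[K]) ρ (N + a + b + ∑ p, chargeTuple c β p) *
            levelSum (Nat.card 𝓀[K]) b (chargeTuple c β)) /
          (rootFunction (Nat.card 𝓀[K]) ρ (N + ∑ p, chargeTuple c β p) *
            levelSum (Nat.card 𝓀[K]) 0 (chargeTuple c β)) := by
  obtain ⟨P₀, h0⟩ := exists_parts_eq_univ hN
  have hq := one_lt_card_residue (K := K)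
  set s : Pairs N → ℝ := fun p => c p.1.1 * c p.1.2 * β with hsdef
  have hs : ∀ p, 0 < s p := fun p => mul_pos (mul_pos (hc _) (hc _)) hβ
  have hct : (fun p => (s p : ℂ)) = chargeTuple c β := rfl
  have hre0 : 1 - (N : ℝ) ≤ ((0 : ℂ) + 0).re := by
    have : (2 : ℝ) ≤ N := by exact_mod_cast hN
    rw [add_zero, Complex.zero_re]
    linarith
  have hpos : 0 < ∑ p, s p := by
    have := nonempty_pairs hN
    exact sum_pos (fun p _ => hs p) univ_nonempty
  have hN1 : (1 : ℝ) ≤ N := by exact_mod_cast (by omega : 1 ≤ N)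
  obtain ⟨hsum0, hI0, hint0⟩ := integral_density (K := K) hN hρ hs (a := 0) (b := 0) (by simp) hre0 h0
  rw [add_zero, add_zero] at hsum0 hint0
  have hz : (N + ∑ p, (s p : ℂ) : ℂ) = ((N + ∑ p, s p : ℝ) : ℂ) := by push_cast; rfl
  have hH : rootFunction (Nat.card 𝓀[K]) ρ (N + ∑ p, (s p : ℂ)) ≠ 0 := by
    rw [hz] at hsum0 ⊢
    exact rootFunction_ne_zero hq hρ0 (by linarith) hsum0
  have hL : levelSum (Nat.card 𝓀[K]) 0 (fun p => (s p : ℂ)) ≠ 0 := by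
    rw [← partIntegral_univ_mul (K := K) (a := 0) hN hs (by simp) h0 hre0]
    refine mul_ne_zero (partIntegral_zero_zero_ne_zero hs P₀) (one_sub_cpow_ne_zero hq ?_)
    simp
    linarith
  set Z := rootFunction (Nat.card 𝓀[K]) ρ (N + ∑ p, (s p : ℂ)) *
    levelSum (Nat.card 𝓀[K]) 0 (fun p => (s p : ℂ)) with hZ
  have hZ0 : Z ≠ 0 := mul_ne_zero hH hL
  have hgC : Integrable (fun x : Fin N → K => ((gasWeight ρ c β x : ℝ) : ℂ)) (haarPi K N) :=
    hI0.congr (Filter.Eventually.of_forall fun x => (coe_gasWeight c β h0 x).symm)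
  have hgR : Integrable (fun x : Fin N → K => (gasWeight ρ c β x : ℝ)) (haarPi K N) := by
    simpa using hgC.re
  -- No measurability of ρ is assumed; it is inherited from the integrability established sphere by
  -- sphere.
  have hgm : AEMeasurable (fun x : Fin N → K => gasWeight ρ c β x) (haarPi K N) := by
    simpa using hgR.1.aemeasurable.real_toNNReal
  have hintR : ((∫ x : Fin N → K, (gasWeight ρ c β x : ℝ) ∂haarPi K N : ℝ) : ℂ) = Z := by
    rw [← hint0, ← integral_complex_ofReal]
    exact integral_congr_ae (Filter.Eventually.of_forall fun x => coe_gasWeight c β h0 x)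
  set I := ∫ x : Fin N → K, (gasWeight ρ c β x : ℝ) ∂haarPi K N with hI
  have hIpos : 0 < I := by
    -- Positivity of the partition function: a nonnegative real integral whose closed form Z is
    -- nonzero.
    refine lt_of_le_of_ne (integral_nonneg fun x => NNReal.coe_nonneg _) fun h => hZ0 ?_
    rw [← hintR, ← h, Complex.ofReal_zero]
  have hpart : partitionFunction K ρ c β = ENNReal.ofReal I := by
    rw [hI, ofReal_integral_eq_lintegral_ofReal hgR
      (Filter.Eventually.of_forall fun x => NNReal.coe_nonneg _), partitionFunction]
    simp
  have hlaw : gasLaw K ρ c β = (haarPi K N).withDensity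
      fun x => ((I.toNNReal⁻¹ * gasWeight ρ c β x : ℝ≥0) : ℝ≥0∞) := by
    rw [gasLaw, hpart]
    congr 1
    funext x
    rw [ENNReal.coe_mul, ENNReal.coe_inv (Real.toNNReal_pos.mpr hIpos).ne']
    rfl
  have hdm : AEMeasurable (fun x : Fin N → K => I.toNNReal⁻¹ * gasWeight ρ c β x) (haarPi K N) :=
    hgm.const_mul _
  have hIinv : ((I.toNNReal⁻¹ : ℝ≥0) : ℂ) = Z⁻¹ := by
    rw [← hintR, NNReal.coe_inv, Real.coe_toNNReal _ hIpos.le, Complex.ofReal_inv]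
  refine ⟨⟨⟨?_, ?_⟩, ⟨?_⟩, hsum0, hH, hL, branchSum_eq_levelSum (K := K) hN hs h0⟩, ?_⟩
  · rw [hpart]
    exact ENNReal.ofReal_pos.mpr hIpos
  · rw [hpart]
    exact ENNReal.ofReal_lt_top
  · have h1 : 0 < partitionFunction K ρ c β := by rw [hpart]; exact ENNReal.ofReal_pos.mpr hIpos
    rw [gasLaw, withDensity_apply _ MeasurableSet.univ, Measure.restrict_univ,
      lintegral_const_mul'' _ hgm.coe_nnreal_ennreal]
    exact ENNReal.inv_mul_cancel h1.ne' (by rw [hpart]; exact ENNReal.ofReal_ne_top)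
  · intro a b hb ha
    obtain ⟨h1, h2, h3⟩ := integral_density (K := K) hN hρ hs hb ha h0
    have hfun : ∀ x : Fin N → K, (I.toNNReal⁻¹ * gasWeight ρ c β x) •
        (((maxDist x : ℝ) : ℂ) ^ a * ((minDist x : ℝ) : ℂ) ^ b) =
        Z⁻¹ * (((ρ (standardNorm x) : ℝ) : ℂ) * partWeight a b s P₀ x) := fun x => by
      rw [← coe_gasWeight_mul hN c β h0, ← hIinv, NNReal.smul_def, Complex.real_smul, ← mul_assoc]
      push_cast
      ring
    refine ⟨h1, ?_, ?_⟩
    · rw [hlaw, integrable_withDensity_iff_integrable_smul₀ hdm]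
      exact (h2.const_mul Z⁻¹).congr (Filter.Eventually.of_forall fun x => (hfun x).symm)
    · rw [hlaw, integral_withDensity_eq_integral_smul₀ hdm,
        integral_congr_ae (Filter.Eventually.of_forall hfun), integral_const_mul, h3, hct]
      rw [div_eq_inv_mul]
      rfl

end CoulombGas

theorem mainTheorem4 {K : Type*} [Field K] [ValuativeRel K] [TopologicalSpace K]
    [IsNonarchimedeanLocalField K] [MeasurableSpace K] [BorelSpace K]
    (q : ℕ) (hq : Nat.card 𝓀[K] = q) (N : ℕ) (hN : 2 ≤ N)
    (ρ : ℝ≥0 → ℝ≥0) (hρ : GrowthCondition ρ) (hρ0 : ∃ m : ℤ, ρ ((q : ℝ≥0) ^ m) ≠ 0)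
    (c : Fin N → ℝ) (hc : ∀ i, 0 < c i) (β : ℝ) (hβ : 0 < β) :
    -- the gas is well defined, and the denominators below converge and do not vanish
    ((0 < partitionFunction K ρ c β ∧ partitionFunction K ρ c β < ⊤) ∧
      IsProbabilityMeasure (gasLaw K ρ c β) ∧
      Summable (rootTerm q ρ (N + ∑ p, chargeTuple c β p)) ∧
      rootFunction q ρ (N + ∑ p, chargeTuple c β p) ≠ 0 ∧
      levelSum q 0 (chargeTuple c β) ≠ 0 ∧
      branchSum q (chargeTuple c β) ≠ 0) ∧
    -- joint moments of the diameter and the minimum distance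
    (∀ a b : ℂ, -1 ≤ b.re → 1 - (N : ℝ) ≤ (a + b).re →
      Summable (rootTerm q ρ (N + a + b + ∑ p, chargeTuple c β p)) ∧
      Integrable (fun x : Fin N → K => ((maxDist x : ℝ) : ℂ) ^ a * ((minDist x : ℝ) : ℂ) ^ b)
        (gasLaw K ρ c β) ∧
      ∫ x : Fin N → K, ((maxDist x : ℝ) : ℂ) ^ a * ((minDist x : ℝ) : ℂ) ^ b ∂(gasLaw K ρ c β) =
        (rootFunction q ρ (N + a + b + ∑ p, chargeTuple c β p) *
            levelSum q b (chargeTuple c β)) /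
          (rootFunction q ρ (N + ∑ p, chargeTuple c β p) * levelSum q 0 (chargeTuple c β)) ∧
      ∫ x : Fin N → K, ((maxDist x : ℝ) : ℂ) ^ a * ((minDist x : ℝ) : ℂ) ^ b ∂(gasLaw K ρ c β) =
        (rootFunction q ρ (N + a + b + ∑ p, chargeTuple c β p) *
            levelSum q b (chargeTuple c β)) /
          (rootFunction q ρ (N + ∑ p, chargeTuple c β p) * branchSum q (chargeTuple c β))) ∧
    -- moments of the diameter alone
    (∀ a : ℂ, 1 - (N : ℝ) ≤ a.re →
      Summable (rootTerm q ρ (N + a + ∑ p, chargeTuple c β p)) ∧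
      Integrable (fun x : Fin N → K => ((maxDist x : ℝ) : ℂ) ^ a) (gasLaw K ρ c β) ∧
      ∫ x : Fin N → K, ((maxDist x : ℝ) : ℂ) ^ a ∂(gasLaw K ρ c β) =
        rootFunction q ρ (N + a + ∑ p, chargeTuple c β p) /
          rootFunction q ρ (N + ∑ p, chargeTuple c β p)) := by
  subst hq
  obtain ⟨⟨h1, h2, h3, h4, h5, h6⟩, h7⟩ := gas_moments (K := K) hN hρ hρ0 hc hβ
  refine ⟨⟨h1, h2, h3, h4, h5, h6 ▸ h5⟩, fun a b hb ha => ?_, fun a ha => ?_⟩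
  · obtain ⟨h8, h9, h10⟩ := h7 a b hb ha
    exact ⟨h8, h9, h10, by rw [h6]; exact h10⟩
  -- For b = 0 the same level sum stands above and below and cancels.
  · obtain ⟨h8, h9, h10⟩ := h7 a 0 (by simp) (by rwa [add_zero])
    simp only [add_zero, Complex.cpow_zero, mul_one] at h8 h9 h10
    exact ⟨h8, h9, by rw [h10, mul_div_mul_right _ _ h5]⟩
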